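/- Let $n\ge 3$, $d\ge 1$, and let $\mathbb R^{d\times n}_*=\{c=(c_1,\dots,c_n)\in(\mathbb R^d)^n : c_i\ne c_{i+1}\ \text{for all } i\in\mathbb Z/n\mathbb Z\}$, an open subset of $(\mathbb R^d)^n$ with tangent spaces $(\mathbb R^d)^n$ (indices are always read modulo $n$). For $c\in\mathbb R^{d\times n}_*$ put $e_i=c_{i+1}-c_i$, $\mu_i=\tfrac12(|e_i|+|e_{i-1}|)$, $\ell(c)=\sum_{i=1}^n|e_i|$, and for $h\in(\mathbb R^d)^n$ define $D_s^0h_i=h_i$ and $$D_s^{j+1}h_i=\frac{D_s^jh_{i+1}-D_s^jh_i}{|e_i|}\ \ (j\text{ even},\ j\ge 0),\qquad D_s^{j+1}h_i=\frac{D_s^jh_i-D_s^jh_{i-1}}{\mu_i}\ \ (j\text{ odd}).$$ Let $\mu_{i,m}=\mu_i$ for even $m\ge 2$ and $\mu_{i,m}=|e_i|$ for odd $m$; for the order $0$ let either $\mu_{i,0}=\mu_i$ for all $i$ (and all $c$), or $\mu_{i,0}=|e_i|$ for all $i$ (and all $c$); everything below holds for both choices. For $m\ge 0$ set $$\dot{\tilde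 g}^m_c(h,k)=\sum_{i=1}^n\langle D_s^mh_i,D_s^mk_i\rangle\,\mu_{i,m},\qquad \tilde g^m_c(h,k)=\dot{\tilde g}^0_c(h,k)+\dot{\tilde g}^m_c(h,k).$$ This is the constant-coefficient discrete Sobolev metric of order $m$; it is a smooth Riemannian metric on $\mathbb R^{d\times n}_*$. Its geodesic distance is the infimum of the lengths $\int_0^1\sqrt{\tilde g^m_\gamma(\dot\gamma,\dot\gamma)}\,dt$ of piecewise $C^\infty$ paths $\gamma:[0,1]\to\mathbb R^{d\times n}_*$ between two given points ($+\infty$ if there is none). Then: 1. For all $m\ge1$, $c\in\mathbb R^{d\times n}_*$ and $h\in(\mathbb R^d)^n$: $\ \dot{\tilde g}^m_c(h,h)\le\dfrac{\ell(c)^2}{4}\,\dot{\tilde g}^{m+1}_c(h,h)$. (This holds for every $n\ge1$.) 2. If $m\ge2$, then $\ell$ and $1/\ell$ are bounded on every metric ball of the geodesic distance of $\tilde g^m$. 3. If $m\ge2$ and $d\ge2$, then $(\mathbb R^{d\times n}_*,\tilde g^m)$ is metrically complete (the geodesic distance is a finite-valued metric, and every Cauchy sequence for it converges) and geodesically complete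 (for every $p\in\mathbb R^{d\times n}_*$ and $v\in(\mathbb R^d)^n$ the geodesic equation has a solution $\gamma:\mathbb R\to\mathbb R^{d\times n}_*$ with $\gamma(0)=p$, $\gamma'(0)=v$), and any two points of $\mathbb R^{d\times n}_*$ are joined by a geodesic whose length equals their geodesic distance (geodesic convexity). -/

import Mathlib

open scoped ContDiff ENNReal

noncomputable section

namespace DiscreteSobolev

section Riemannian

/-! Riemannian geometry of an open subset `U` of a finite-dimensional normed space `V`. The tangent
space at every point is `V`, and a metric is a function `g : V → V → V → ℝ`, written `g c h k`,
of which only the values at base points `c ∈ U` matter. -/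

variable {V : Type*} [NormedAddCommGroup V] [NormedSpace ℝ V]

/-- `g` is a (smooth) Riemannian metric on `U`. -/
structure IsRiemannianMetricOn (U : Set V) (g : V → V → V → ℝ) : Prop where
  isOpen : IsOpen U
  add_left : ∀ c ∈ U, ∀ h₁ h₂ k, g c (h₁ + h₂) k = g c h₁ k + g c h₂ k
  smul_left : ∀ c ∈ U, ∀ (a : ℝ) (h k), g c (a • h) k = a * g c h k
  symm : ∀ c ∈ U, ∀ h k, g c h k = g c k h
  pos : ∀ c ∈ U, ∀ h, h ≠ 0 → 0 < g c h h
  smooth : ∀ h k, ContDiffOn ℝ ∞ (fun c => g c h k) U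

/-- `γ` restricts to a piecewise `C^∞` path `[0,1] → U` from `p` to `q`: it is continuous on
`[0,1]` and smooth, up to the end points, on each interval of a finite subdivision of `[0,1]`. -/
def IsPiecewiseSmoothPath (U : Set V) (p q : V) (γ : ℝ → V) : Prop :=
  γ 0 = p ∧ γ 1 = q ∧ (∀ t ∈ Set.Icc (0 : ℝ) 1, γ t ∈ U) ∧ ContinuousOn γ (Set.Icc 0 1) ∧
    ∃ (N : ℕ) (t : ℕ → ℝ), Monotone t ∧ t 0 = 0 ∧ t N = 1 ∧
      ∀ i < N, ContDiffOn ℝ ∞ γ (Set.Icc (t i) (t (i + 1)))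

/-- The length `∫₀¹ √(g_γ(γ', γ')) dt` of a path on `[0,1]`. -/
def pathLength (g : V → V → V → ℝ) (γ : ℝ → V) : ℝ≥0∞ :=
  ∫⁻ t in Set.Icc (0 : ℝ) 1, ENNReal.ofReal √(g (γ t) (deriv γ t) (deriv γ t))

/-- The geodesic distance: the infimum of the lengths of piecewise smooth paths in `U`
(`∞` if there is no such path). -/
def geodesicDist (U : Set V) (g : V → V → V → ℝ) (p q : V) : ℝ≥0∞ :=
  ⨅ (γ : ℝ → V) (_ : IsPiecewiseSmoothPath U p q γ), pathLength g γ

/-- The open metric ball of the geodesic distance. -/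
def geodesicBall (U : Set V) (g : V → V → V → ℝ) (p : V) (r : ℝ) : Set V :=
  {q | q ∈ U ∧ geodesicDist U g p q < ENNReal.ofReal r}

/-- `U` is a (genuine, finite-valued) metric space under the geodesic distance, and this metric
space is complete. -/
def IsMetricallyComplete (U : Set V) (g : V → V → V → ℝ) : Prop :=
  ∃ M : MetricSpace U,
    (∀ p q : U, ENNReal.ofReal (M.dist p q) = geodesicDist U g p q) ∧
      @CompleteSpace U M.toUniformSpace

/-- `γ : ℝ → U` is a geodesic defined for all time: it is smooth and solves the geodesic equation
`∇_{γ'} γ' = 0`. By the Koszul formula in the flat coordinates of `V`,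
`g_γ(∇_{γ'} γ', v) = g_γ(γ'', v) + (D_{γ'} g)_γ(γ', v) - ½ (D_v g)_γ(γ', γ')`. -/
def IsGeodesic (U : Set V) (g : V → V → V → ℝ) (γ : ℝ → V) : Prop :=
  ContDiff ℝ ∞ γ ∧ (∀ t, γ t ∈ U) ∧
    ∀ (t : ℝ) (v : V),
      g (γ t) (deriv (deriv γ) t) v
        + fderiv ℝ (fun c => g c (deriv γ t) v) (γ t) (deriv γ t)
        - 1 / 2 * fderiv ℝ (fun c => g c (deriv γ t) (deriv γ t)) (γ t) v = 0

/-- The geodesic equation has a solution for all time for all initial data. -/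
def IsGeodesicallyComplete (U : Set V) (g : V → V → V → ℝ) : Prop :=
  ∀ p ∈ U, ∀ v : V, ∃ γ : ℝ → V, IsGeodesic U g γ ∧ γ 0 = p ∧ deriv γ 0 = v

/-- Any two points of `U` are joined by a length-minimizing geodesic. -/
def IsGeodesicallyConvex (U : Set V) (g : V → V → V → ℝ) : Prop :=
  ∀ p ∈ U, ∀ q ∈ U, ∃ γ : ℝ → V,
    IsGeodesic U g γ ∧ γ 0 = p ∧ γ 1 = q ∧ pathLength g γ = geodesicDist U g p q

end Riemannian

section Curves

variable {n d : ℕ}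

/-- Closed `n`-gons in `ℝ^d` (`n`-tuples of points, indexed cyclically); also the tangent
vectors. -/
abbrev Polygon (n d : ℕ) : Type := ZMod n → EuclideanSpace ℝ (Fin d)

/-- The discrete regular curves: consecutive vertices are distinct. -/
def regularCurves (n d : ℕ) : Set (Polygon n d) := {c | ∀ i, c i ≠ c (i + 1)}

/-- The length `|e_i|` of the edge `e_i = c_{i+1} - c_i`. -/
def edgeLength (c : Polygon n d) (i : ZMod n) : ℝ := ‖c (i + 1) - c i‖

/-- `μ_i = (|e_i| + |e_{i-1}|) / 2`. -/
def vertexLength (c : Polygon n d) (i : ZMod n) : ℝ :=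
  (edgeLength c i + edgeLength c (i - 1)) / 2

/-- The length `ℓ(c)` of the curve. -/
def curveLength [NeZero n] (c : Polygon n d) : ℝ := ∑ i, edgeLength c i

/-- The discrete arc-length derivatives `D_s^j h_i`. -/
def discreteDeriv (c h : Polygon n d) : ℕ → Polygon n d
  | 0 => h
  | j + 1 => fun i =>
      if Even j then
        (edgeLength c i)⁻¹ • (discreteDeriv c h j (i + 1) - discreteDeriv c h j i)
      else
        (vertexLength c i)⁻¹ • (discreteDeriv c h j i - discreteDeriv c h j (i - 1))

/-- The weights `μ_{i,m}`: `μ_i` for even `m > 0`, `|e_i|` for odd `m`, and for `m = 0` the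
weight `w₀`, a parameter that will be `μ_i` or `|e_i|`. -/
def weight (w₀ : Polygon n d → ZMod n → ℝ) (m : ℕ) (c : Polygon n d) (i : ZMod n) : ℝ :=
  if m = 0 then w₀ c i else if Even m then vertexLength c i else edgeLength c i

/-- The homogeneous constant-coefficient form `∑_i ⟨D_s^m h_i, D_s^m k_i⟩ μ_{i,m}`. -/
def homMetric [NeZero n] (w₀ : Polygon n d → ZMod n → ℝ) (m : ℕ) (c h k : Polygon n d) : ℝ :=
  ∑ i, inner ℝ (discreteDeriv c h m i) (discreteDeriv c k m i) * weight w₀ m c i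

/-- The constant-coefficient discrete Sobolev metric of order `m`: the sum of the homogeneous
forms of orders `0` and `m`. -/
def sobolevMetric [NeZero n] (w₀ : Polygon n d → ZMod n → ℝ) (m : ℕ) (c h k : Polygon n d) : ℝ :=
  homMetric w₀ 0 c h k + homMetric w₀ m c h k

end Curves

end DiscreteSobolev

end

/-!
The theorem rests on one estimate for the Sobolev metric `g` of order `m ≥ 2` and on a version of
the Hopf-Rinow theorem for an open subset `U` of a finite-dimensional vector space.

**The estimate.** The derivatives of order at least one of a deformation `h` have weighted mean
zero, and two values of a function on a cycle differ by at most half of its total variation. With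
the Cauchy-Schwarz inequality this gives a uniform Wirtinger inequality
(`norm_sq_le_of_sum_eq_zero`), `|D^m h_i|² ≤ ℓ / 4` times the form of order `m + 1`, and after
summation the comparison of consecutive orders (`homMetric_le_mul_homMetric_succ`). It implies
`∑ |h_{i+1} - h_i| ≤ C ℓ √g(h, h)` with `C` independent of the curve (`exists_sum_norm_sub_le`). For
`ℓ ≤ 1` this is Wirtinger's inequality. For `ℓ ≥ 1` it suffices to bound each `|h_i|` by a multiple
of `ℓ √g(h, h)`: from the vertex `i` one walks along short edges, where `h` changes little, to an
edge that is not short, where the form of order `0` controls `h`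
(`norm_sq_le_mul_sobolevMetric`). The change of `h` on the way is controlled by the form of order
`2`, which, by logarithmic convexity in the order, is at most that of order `m` or that of order
`1`; in the latter case summation by parts allows one to absorb it.

The left-hand side of the estimate bounds the derivative of `ℓ` in the direction `h`, so `log ℓ` is
Lipschitz for the geodesic distance and `ℓ` and `1 / ℓ` are bounded on balls
(`exists_curveLength_le`). On a ball Wirtinger's inequality now bounds `|D^1 h_i|`, which is at
least the derivative of `log |e_i|`. So the edges are bounded away from `0` on a ball, and the
form of order `0` then dominates a fixed norm: every ball lies in a compact set of regular curves
(`hasRelativelyCompactBalls_sobolevMetric`). If `d ≥ 2`, two regular curves are joined by a broken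
line of regular curves whose corner avoids finitely many proper subspaces
(`geodesicDist_sobolevMetric_ne_top`).

**Hopf-Rinow.** Let all balls be relatively compact in `U`. Locally the geodesic distance of `x` and
`y` is comparable with the norm of `y - x` measured at `x`, up to a factor that tends to `1`; hence
it is a metric for the usual topology, and it is complete
(`isMetricallyComplete_of_compact_balls`). Geodesics are the projections of the integral curves of
the Hamiltonian field of the kinetic energy. As energy is conserved, these stay in a compact subset
of phase space for bounded times, and so they exist for all times
(`isGeodesicallyComplete_of_compact_balls`).

A minimizing geodesic from `p` to `q` is a limit of minimizers `x_0 = p, …, x_N = q` of the discrete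
energy `∑ g_{x_k}(x_{k+1} - x_k, x_{k+1} - x_k)` over a compact set. These stay in its interior, so
they satisfy an Euler-Lagrange equation, and in terms of the momenta `N g_{x_k}(x_{k+1} - x_k, ·)`
that equation is the symplectic Euler scheme for Hamilton's equations. The energy bounds the
momenta, so the initial momenta converge along a subsequence, and convergence of the scheme
(`symplectic_euler_error`) gives a geodesic from `p` to `q` whose energy is at most the square of
the distance (`exists_minimizing_hamiltonian`). As its speed is constant, its length is at most the
distance. This route needs no convex neighbourhoods and no regularity theory of minimizers.
-/

-- required for instances on iterated spaces of continuous linear maps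
set_option maxSynthPendingDepth 3

namespace DiscreteSobolev

open Set MeasureTheory Filter Topology

/-! ### Piecewise smooth paths and their lengths -/

section Paths

variable {V : Type*} [NormedAddCommGroup V] [NormedSpace ℝ V]
  {U : Set V} {g : V → V → V → ℝ} {γ σ : ℝ → V} {a b c : ℝ}

/-- `γ` is smooth, up to the end points, on each interval of a finite subdivision of `[a, b]`.
The subdivision is built up one interval at a time, which makes properties of piecewise smooth
paths accessible to induction. -/
inductive PiecewiseSmooth (γ : ℝ → V) (a : ℝ) : ℝ → Prop
  | refl : PiecewiseSmooth γ a a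
  | snoc {b c : ℝ} (h : PiecewiseSmooth γ a b) (hbc : b ≤ c)
      (hc : ContDiffOn ℝ ∞ γ (Icc b c)) : PiecewiseSmooth γ a c

namespace PiecewiseSmooth

theorem le (h : PiecewiseSmooth γ a b) : a ≤ b := by
  induction h with
  | refl => exact le_rfl
  | snoc _ hbc _ ih => exact ih.trans hbc

theorem single (hab : a ≤ b) (h : ContDiffOn ℝ ∞ γ (Icc a b)) : PiecewiseSmooth γ a b :=
  .snoc .refl hab h

theorem trans (h₁ : PiecewiseSmooth γ a b) (h₂ : PiecewiseSmooth γ b c) :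
    PiecewiseSmooth γ a c := by
  induction h₂ with
  | refl => exact h₁
  | snoc _ hbc hc ih => exact ih.snoc hbc hc

theorem congr (h : PiecewiseSmooth γ a b) (hσ : EqOn σ γ (Icc a b)) : PiecewiseSmooth σ a b := by
  induction h with
  | refl => exact .refl
  | snoc h hbc hc ih =>
    exact (ih fun t ht => hσ ⟨ht.1, ht.2.trans hbc⟩).snoc hbc
      (hc.congr fun t ht => hσ ⟨h.le.trans ht.1, ht.2⟩)

theorem continuousOn (h : PiecewiseSmooth γ a b) : ContinuousOn γ (Icc a b) := by
  induction h with
  | refl => simp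
  | snoc h hbc hc ih =>
    rw [← Icc_union_Icc_eq_Icc h.le hbc]
    exact ih.union_of_isClosed hc.continuousOn isClosed_Icc isClosed_Icc

theorem restrict_right (h : PiecewiseSmooth γ a b) {t : ℝ} (hat : a ≤ t) (htb : t ≤ b) :
    PiecewiseSmooth γ a t := by
  induction h with
  | refl => exact le_antisymm hat htb ▸ .refl
  | @snoc b c h hbc hc ih =>
    rcases le_total t b with htb' | hbt
    · exact ih htb'
    · exact h.snoc hbt (hc.mono (Icc_subset_Icc_right htb))

theorem restrict_left (h : PiecewiseSmooth γ a b) {s : ℝ} (has : a ≤ s) (hsb : s ≤ b) :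
    PiecewiseSmooth γ s b := by
  induction h with
  | refl => exact le_antisymm has hsb ▸ .refl
  | @snoc b c h hbc hc ih =>
    rcases le_total s b with hs | hs
    · exact (ih hs).snoc hbc hc
    · exact .single hsb (hc.mono (Icc_subset_Icc_left hs))

theorem comp_affine (h : PiecewiseSmooth γ a b) {α β : ℝ} (hα : 0 < α) :
    PiecewiseSmooth (fun t => γ (α * t + β)) ((a - β) / α) ((b - β) / α) := by
  induction h with
  | refl => exact .refl
  | @snoc b c h hbc hc ih =>
    refine ih.snoc (by gcongr) (hc.comp (by fun_prop) fun t ht => ?_)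
    rw [mem_Icc, div_le_iff₀ hα, le_div_iff₀ hα] at ht
    constructor <;> linarith [ht.1, ht.2]

theorem comp_neg (h : PiecewiseSmooth γ a b) :
    PiecewiseSmooth (fun t => γ (-t)) (-b) (-a) := by
  induction h with
  | refl => exact .refl
  | @snoc b c h hbc hc ih =>
    refine (single (neg_le_neg hbc) (hc.comp (by fun_prop) fun t ht => ?_)).trans ih
    exact ⟨by linarith [ht.2], by linarith [ht.1]⟩

theorem exists_partition (h : PiecewiseSmooth γ a b) :
    ∃ (N : ℕ) (t : ℕ → ℝ), Monotone t ∧ t 0 = a ∧ t N = b ∧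
      ∀ i < N, ContDiffOn ℝ ∞ γ (Icc (t i) (t (i + 1))) := by
  induction h with
  | refl => exact ⟨0, fun _ => a, monotone_const, rfl, rfl, by simp⟩
  | @snoc b c h hbc hc ih =>
    obtain ⟨N, t, ht, h0, hN, hs⟩ := ih
    refine ⟨N + 1, fun i => if i ≤ N then t i else c, ?_, by simpa, by simp, ?_⟩
    · refine monotone_nat_of_le_succ fun i => ?_
      rcases lt_trichotomy i N with hi | rfl | hi
      · simpa [hi.le, Nat.succ_le_iff.2 hi] using ht (Nat.le_succ i)
      · simpa [hN] using hbc
      · simp [hi.not_ge, (hi.trans (Nat.lt_succ_self i)).not_ge]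
    · intro i hi
      rcases (Nat.lt_succ_iff.1 hi).lt_or_eq with hi | rfl
      · simpa [hi.le, Nat.succ_le_iff.2 hi] using hs i hi
      · simpa [hN] using hc

theorem of_partition {N : ℕ} {t : ℕ → ℝ} (ht : Monotone t)
    (hs : ∀ i < N, ContDiffOn ℝ ∞ γ (Icc (t i) (t (i + 1)))) :
    PiecewiseSmooth γ (t 0) (t N) := by
  induction N with
  | zero => exact .refl
  | succ N ih =>
    exact (ih fun i hi => hs i (hi.trans N.lt_succ_self)).snoc (ht N.le_succ)
      (hs N N.lt_succ_self)

end PiecewiseSmooth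

theorem isPiecewiseSmoothPath_iff {p q : V} :
    IsPiecewiseSmoothPath U p q γ ↔
      γ 0 = p ∧ γ 1 = q ∧ (∀ t ∈ Icc (0 : ℝ) 1, γ t ∈ U) ∧ PiecewiseSmooth γ 0 1 := by
  constructor
  · rintro ⟨h0, h1, hU, -, N, t, ht, ht0, htN, hs⟩
    exact ⟨h0, h1, hU, ht0 ▸ htN ▸ .of_partition ht hs⟩
  · rintro ⟨h0, h1, hU, h⟩
    exact ⟨h0, h1, hU, h.continuousOn, h.exists_partition⟩

/-- The length of the restriction of the path `γ` to `[a, b]`. -/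
noncomputable def arcLength (g : V → V → V → ℝ) (γ : ℝ → V) (a b : ℝ) : ℝ≥0∞ :=
  ∫⁻ t in Icc a b, ENNReal.ofReal √(g (γ t) (deriv γ t) (deriv γ t))

theorem pathLength_eq_arcLength : pathLength g γ = arcLength g γ 0 1 := rfl

theorem arcLength_add (hab : a ≤ b) (hbc : b ≤ c) :
    arcLength g γ a b + arcLength g γ b c = arcLength g γ a c := by
  simp only [arcLength]
  rw [← Icc_union_Ioc_eq_Icc hab hbc, lintegral_union measurableSet_Ioc,
    restrict_Ioc_eq_restrict_Icc]
  exact disjoint_left.2 fun t h₁ h₂ => h₂.1.not_ge h₁.2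

theorem arcLength_mono {a' b' : ℝ} (ha : a' ≤ a) (hb : b ≤ b') :
    arcLength g γ a b ≤ arcLength g γ a' b' :=
  lintegral_mono_set (Icc_subset_Icc ha hb)

theorem arcLength_congr (h : EqOn σ γ (Ioo a b)) : arcLength g σ a b = arcLength g γ a b := by
  simp only [arcLength, ← restrict_Ioo_eq_restrict_Icc]
  refine setLIntegral_congr_fun measurableSet_Ioo fun t ht => ?_
  have : σ =ᶠ[𝓝 t] γ := h.eventuallyEq_of_mem (Ioo_mem_nhds ht.1 ht.2)
  simp only [this.deriv_eq, this.eq_of_nhds]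

theorem IsRiemannianMetricOn.smul_smul (hg : IsRiemannianMetricOn U g) {p : V} (hp : p ∈ U)
    (r : ℝ) (h : V) : g p (r • h) (r • h) = r ^ 2 * g p h h := by
  rw [hg.smul_left p hp, hg.symm p hp, hg.smul_left p hp]; ring

theorem arcLength_comp_affine (hg : IsRiemannianMetricOn U g) {α β : ℝ} (hα : α ≠ 0)
    (hU : ∀ t ∈ Icc a b, γ (α * t + β) ∈ U) :
    arcLength g (fun t => γ (α * t + β)) a b =
      ∫⁻ t in (fun t => α * t + β) '' Icc a b,
        ENNReal.ofReal √(g (γ t) (deriv γ t) (deriv γ t)) := by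
  rw [lintegral_image_eq_lintegral_abs_deriv_mul (f' := fun _ => α) measurableSet_Icc
    (fun t _ => by simpa using ((hasDerivAt_id t).const_mul α).add_const β |>.hasDerivWithinAt)
    (fun s _ t _ h => by simpa [hα] using h)]
  refine setLIntegral_congr_fun measurableSet_Icc fun t ht => ?_
  have hd : deriv (fun t => γ (α * t + β)) t = α • deriv γ (α * t + β) := by
    rw [deriv_comp_mul_left α (fun s => γ (s + β)) t, deriv_comp_add_const]
  simp only [hd]
  rw [hg.smul_smul (hU t ht), Real.sqrt_mul (sq_nonneg α), Real.sqrt_sq_eq_abs,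
    ENNReal.ofReal_mul (abs_nonneg α)]

theorem arcLength_comp_affine_of_pos (hg : IsRiemannianMetricOn U g) {α β : ℝ} (hα : 0 < α)
    (hU : ∀ t ∈ Icc a b, γ t ∈ U) :
    arcLength g (fun t => γ (α * t + β)) ((a - β) / α) ((b - β) / α) = arcLength g γ a b := by
  have him : (fun t => α * t + β) '' Icc ((a - β) / α) ((b - β) / α) = Icc a b := by
    rw [image_affine_Icc' hα]
    congr 1 <;> field_simp <;> ring
  rw [arcLength_comp_affine hg hα.ne' fun t ht => hU _ (him ▸ mem_image_of_mem _ ht), him]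
  rfl

theorem arcLength_comp_neg (hg : IsRiemannianMetricOn U g) (hU : ∀ t ∈ Icc a b, γ t ∈ U) :
    arcLength g (fun t => γ (-t)) (-b) (-a) = arcLength g γ a b := by
  have him : (fun t => -1 * t + 0) '' Icc (-b) (-a) = Icc a b := by simp
  have := arcLength_comp_affine (a := -b) (b := -a) (γ := γ) (β := 0) hg (by norm_num : (-1 : ℝ) ≠ 0)
    fun t ht => hU _ (him ▸ mem_image_of_mem _ ht)
  rw [him] at this
  simpa [arcLength] using this

/-- A function whose derivative is dominated by the norm of the metric along a path varies along
this path at most by the length of the path. -/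
theorem enorm_sub_le_arcLength {E : Type*} [NormedAddCommGroup E] [NormedSpace ℝ E] {f : V → E}
    {C : ℝ} (hUo : IsOpen U) (hf : ContDiffOn ℝ 1 f U) (h : PiecewiseSmooth γ a b)
    (hU : ∀ t ∈ Icc a b, γ t ∈ U)
    (hC : ∀ t ∈ Icc a b, ∀ v, ‖fderiv ℝ f (γ t) v‖ ≤ C * √(g (γ t) v v)) :
    ‖f (γ b) - f (γ a)‖ₑ ≤ ENNReal.ofReal C * arcLength g γ a b := by
  induction h with
  | refl => simp
  | @snoc b c h hbc hc ih =>
    have hab := h.le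
    have hsub : Icc b c ⊆ Icc a c := Icc_subset_Icc_left hab
    have ih' := ih (fun t ht => hU t ⟨ht.1, ht.2.trans hbc⟩)
      (fun t ht => hC t ⟨ht.1, ht.2.trans hbc⟩)
    have hfc : ContDiffOn ℝ 1 (f ∘ γ) (Icc b c) :=
      hf.comp (hc.of_le (by norm_cast)) fun t ht => hU t (hsub ht)
    have h2 : ‖f (γ c) - f (γ b)‖ₑ ≤ ENNReal.ofReal C * arcLength g γ b c := by
      refine (enorm_sub_le_lintegral_deriv_of_contDiffOn_Icc hfc hbc).trans ?_
      rw [arcLength, ← lintegral_const_mul' _ _ ENNReal.ofReal_ne_top,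
        ← restrict_Ioo_eq_restrict_Icc]
      refine lintegral_mono_ae ?_
      filter_upwards [self_mem_ae_restrict measurableSet_Ioo] with t ht
      have ht' : t ∈ Icc a c := hsub (Ioo_subset_Icc_self ht)
      have hγ : DifferentiableAt ℝ γ t :=
        ((hc t (Ioo_subset_Icc_self ht)).contDiffAt (Icc_mem_nhds ht.1 ht.2)).differentiableAt
          (by simp)
      have hfd : DifferentiableAt ℝ f (γ t) :=
        (hf.contDiffAt (hUo.mem_nhds (hU t ht'))).differentiableAt (by simp)
      rw [fderiv_comp_deriv t hfd hγ, ← ofReal_norm]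
      have h3 := hC t ht' (deriv γ t)
      rcases le_or_gt 0 C with hC0 | hC0
      · rw [← ENNReal.ofReal_mul hC0]
        exact ENNReal.ofReal_le_ofReal h3
      · have : ‖fderiv ℝ f (γ t) (deriv γ t)‖ ≤ 0 :=
          h3.trans (mul_nonpos_of_nonpos_of_nonneg hC0.le (Real.sqrt_nonneg _))
        rw [ENNReal.ofReal_of_nonpos this]; simp
    calc ‖f (γ c) - f (γ a)‖ₑ = ‖(f (γ c) - f (γ b)) + (f (γ b) - f (γ a))‖ₑ := by congr 1; abel
      _ ≤ ‖f (γ c) - f (γ b)‖ₑ + ‖f (γ b) - f (γ a)‖ₑ := enorm_add_le _ _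
      _ ≤ ENNReal.ofReal C * arcLength g γ b c + ENNReal.ofReal C * arcLength g γ a b :=
        add_le_add h2 ih'
      _ = ENNReal.ofReal C * arcLength g γ a c := by
        rw [← arcLength_add hab hbc, mul_add, add_comm]

theorem norm_sub_le_arcLength {E : Type*} [NormedAddCommGroup E] [NormedSpace ℝ E] {f : V → E}
    {C : ℝ} (hC0 : 0 ≤ C) (hUo : IsOpen U) (hf : ContDiffOn ℝ 1 f U) (h : PiecewiseSmooth γ a b)
    (hU : ∀ t ∈ Icc a b, γ t ∈ U)
    (hC : ∀ t ∈ Icc a b, ∀ v, ‖fderiv ℝ f (γ t) v‖ ≤ C * √(g (γ t) v v)) {L : ℝ} (hL0 : 0 ≤ L)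
    (hL : arcLength g γ a b ≤ ENNReal.ofReal L) :
    ‖f (γ b) - f (γ a)‖ ≤ C * L := by
  have := (enorm_sub_le_arcLength hUo hf h hU hC).trans (mul_le_mul_right hL _)
  rw [← ENNReal.ofReal_mul hC0, ← ofReal_norm] at this
  exact (ENNReal.ofReal_le_ofReal_iff (mul_nonneg hC0 hL0)).1 this

end Paths

/-! ### The geodesic distance -/

section Distance

variable {V : Type*} [NormedAddCommGroup V] [NormedSpace ℝ V]
  {U : Set V} {g : V → V → V → ℝ} {γ σ : ℝ → V} {a b c : ℝ} {p q x y : V}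

theorem IsRiemannianMetricOn.nonneg (hg : IsRiemannianMetricOn U g) {c : V} (hc : c ∈ U) (h : V) :
    0 ≤ g c h h := by
  rcases eq_or_ne h 0 with rfl | hh
  · simpa using (hg.smul_left c hc 0 0 0).ge
  · exact (hg.pos c hc h hh).le

theorem geodesicDist_self (hg : IsRiemannianMetricOn U g) (hp : p ∈ U) :
    geodesicDist U g p p = 0 := by
  have h : IsPiecewiseSmoothPath U p p (fun _ => p) :=
    isPiecewiseSmoothPath_iff.2 ⟨rfl, rfl, fun _ _ => hp, .single zero_le_one contDiffOn_const⟩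
  refine le_antisymm ((iInf₂_le _ h).trans ?_) bot_le
  have h0 : g p 0 0 = 0 := by simpa using hg.smul_left p hp 0 0 0
  simp [pathLength, h0]

theorem geodesicDist_le_arcLength (hg : IsRiemannianMetricOn U g) (h : PiecewiseSmooth γ a b)
    (hU : ∀ t ∈ Icc a b, γ t ∈ U) : geodesicDist U g (γ a) (γ b) ≤ arcLength g γ a b := by
  rcases h.le.eq_or_lt with rfl | hab
  · rw [geodesicDist_self hg (hU a ⟨le_rfl, le_rfl⟩)]; exact bot_le
  · have hα : 0 < b - a := sub_pos.2 hab
    have h0 : (a - a) / (b - a) = 0 := by simp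
    have h1 : (b - a) / (b - a) = 1 := div_self hα.ne'
    have hps := h.comp_affine (β := a) hα
    have hlen := arcLength_comp_affine_of_pos (β := a) hg hα hU
    rw [h0, h1] at hps hlen
    have hpath : IsPiecewiseSmoothPath U (γ a) (γ b) (fun t => γ ((b - a) * t + a)) := by
      refine isPiecewiseSmoothPath_iff.2 ⟨by simp, by simp, fun t ht => hU _ ?_, hps⟩
      constructor <;> nlinarith [ht.1, ht.2]
    exact (iInf₂_le _ hpath).trans hlen.le

theorem exists_path_of_geodesicDist_lt {r : ℝ≥0∞} (h : geodesicDist U g p q < r) :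
    ∃ γ : ℝ → V, γ 0 = p ∧ γ 1 = q ∧ (∀ t ∈ Icc (0 : ℝ) 1, γ t ∈ U) ∧ PiecewiseSmooth γ 0 1 ∧
      arcLength g γ 0 1 < r := by
  simp only [geodesicDist, iInf_lt_iff] at h
  obtain ⟨γ, hγ, hlt⟩ := h
  obtain ⟨h0, h1, hU, hs⟩ := isPiecewiseSmoothPath_iff.1 hγ
  exact ⟨γ, h0, h1, hU, hs, hlt⟩

theorem geodesicDist_comm_le (hg : IsRiemannianMetricOn U g) :
    geodesicDist U g q p ≤ geodesicDist U g p q := by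
  refine le_of_forall_gt fun r hr => ?_
  obtain ⟨γ, rfl, rfl, hU, hs, hlt⟩ := exists_path_of_geodesicDist_lt hr
  have := geodesicDist_le_arcLength hg hs.comp_neg
    fun t ht => hU _ ⟨by linarith [ht.2], by linarith [ht.1]⟩
  rw [arcLength_comp_neg hg hU, neg_neg, neg_neg] at this
  exact this.trans_lt hlt

theorem geodesicDist_comm (hg : IsRiemannianMetricOn U g) :
    geodesicDist U g p q = geodesicDist U g q p :=
  le_antisymm (geodesicDist_comm_le hg) (geodesicDist_comm_le hg)

theorem geodesicDist_triangle (hg : IsRiemannianMetricOn U g) :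
    geodesicDist U g p q ≤ geodesicDist U g p x + geodesicDist U g x q := by
  refine ENNReal.le_of_forall_pos_le_add fun ε hε hfin => ?_
  have hε2 : (ε : ℝ≥0∞) / 2 ≠ 0 := by simpa using hε.ne'
  have hp : geodesicDist U g p x ≠ ⊤ := (le_self_add.trans_lt hfin).ne
  have hq : geodesicDist U g x q ≠ ⊤ := (le_add_self.trans_lt hfin).ne
  obtain ⟨γ, rfl, rfl, hU, hs, hlt⟩ := exists_path_of_geodesicDist_lt (ENNReal.lt_add_right hp hε2)
  obtain ⟨σ, h0, rfl, hU', hs', hlt'⟩ :=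
    exists_path_of_geodesicDist_lt (ENNReal.lt_add_right hq hε2)
  -- the concatenation is run on `[0, 2]`
  set τ : ℝ → V := fun t => if t ≤ 1 then γ t else σ (1 * t + (-1)) with hτ
  have e₁ : EqOn τ γ (Icc 0 1) := fun t ht => if_pos ht.2
  have e₂ : EqOn τ (fun t => σ (1 * t + (-1))) (Icc 1 2) := by
    intro t ht
    rcases ht.1.eq_or_lt with rfl | h
    · simp [hτ, h0]
    · simp [hτ, h.not_ge]
  have hs₂ := hs'.comp_affine (β := -1) one_pos
  have hl₂ := arcLength_comp_affine_of_pos (β := -1) hg one_pos hU'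
  norm_num only at hs₂ hl₂
  have hps : PiecewiseSmooth τ 0 2 := (hs.congr e₁).trans (hs₂.congr (by simpa using e₂))
  have hτU : ∀ t ∈ Icc (0 : ℝ) 2, τ t ∈ U := by
    intro t ht
    rcases le_total t 1 with h | h
    · rw [e₁ ⟨ht.1, h⟩]; exact hU t ⟨ht.1, h⟩
    · rw [e₂ ⟨h, ht.2⟩]; exact hU' _ ⟨by linarith, by linarith [ht.2]⟩
  have key := geodesicDist_le_arcLength hg hps hτU
  rw [← arcLength_add zero_le_one one_le_two, arcLength_congr (e₁.mono Ioo_subset_Icc_self),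
    arcLength_congr (e₂.mono Ioo_subset_Icc_self)] at key
  rw [hl₂, e₁ ⟨le_rfl, zero_le_one⟩, e₂ ⟨one_le_two, le_rfl⟩] at key
  norm_num only at key
  refine key.trans ((add_le_add hlt.le hlt'.le).trans_eq ?_)
  rw [add_add_add_comm, ENNReal.add_halves]

/-- Along a path the distance of two points is at most the length of the piece between them. -/
theorem geodesicDist_le_arcLength_of_path (hg : IsRiemannianMetricOn U g)
    (h : PiecewiseSmooth γ a b) (hU : ∀ t ∈ Icc a b, γ t ∈ U) {s t : ℝ} (hs : a ≤ s)
    (hst : s ≤ t) (ht : t ≤ b) : geodesicDist U g (γ s) (γ t) ≤ arcLength g γ s t :=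
  geodesicDist_le_arcLength hg ((h.restrict_right (hs.trans hst) ht).restrict_left hs hst)
    fun _ hr => hU _ ⟨hs.trans hr.1, hr.2.trans ht⟩

theorem geodesicDist_add_le (hg : IsRiemannianMetricOn U g) {v : V} {B : ℝ}
    (hU : ∀ t ∈ Icc (0 : ℝ) 1, x + t • v ∈ U)
    (hB : ∀ t ∈ Icc (0 : ℝ) 1, √(g (x + t • v) v v) ≤ B) :
    geodesicDist U g x (x + v) ≤ ENNReal.ofReal B := by
  have hs : PiecewiseSmooth (fun t : ℝ => x + t • v) 0 1 :=
    .single zero_le_one (by fun_prop)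
  have := geodesicDist_le_arcLength hg hs hU
  simp only [zero_smul, add_zero, one_smul] at this
  refine this.trans ?_
  have hd : ∀ t : ℝ, deriv (fun t : ℝ => x + t • v) t = v := fun t => by
    simpa using (((hasDerivAt_id t).smul_const v).const_add x).deriv
  calc arcLength g (fun t : ℝ => x + t • v) 0 1
      ≤ ∫⁻ _ in Icc (0 : ℝ) 1, ENNReal.ofReal B := by
        refine setLIntegral_mono' measurableSet_Icc fun t ht => ?_
        rw [hd]
        exact ENNReal.ofReal_le_ofReal (hB t ht)
    _ = ENNReal.ofReal B := by simp

theorem geodesicBall_subset_of_path (hg : IsRiemannianMetricOn U g) {R : ℝ}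
    (hs : PiecewiseSmooth γ a b) (hU : ∀ t ∈ Icc a b, γ t ∈ U)
    (hlt : geodesicDist U g p (γ a) + arcLength g γ a b < ENNReal.ofReal R) :
    ∀ t ∈ Icc a b, γ t ∈ geodesicBall U g p R := fun t ht =>
  ⟨hU t ht, (geodesicDist_triangle hg).trans_lt ((add_le_add le_rfl
    ((geodesicDist_le_arcLength_of_path hg hs hU le_rfl ht.1 ht.2).trans
      (arcLength_mono le_rfl ht.2))).trans_lt hlt)⟩

end Distance

/-! ### The metric as a smooth field of bilinear forms -/

section Form

variable {V : Type*} [NormedAddCommGroup V] [NormedSpace ℝ V] [FiniteDimensional ℝ V]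
  {U : Set V} {g : V → V → V → ℝ}

/-- The metric at `c` as a continuous bilinear form, defined through the coefficients of `g c` in
a basis. It agrees with `g c` where the latter is bilinear. -/
noncomputable def metricForm (g : V → V → V → ℝ) (c : V) : V →L[ℝ] V →L[ℝ] ℝ :=
  ∑ i, ∑ j, g c (Module.finBasis ℝ V i) (Module.finBasis ℝ V j) •
    (LinearMap.toContinuousLinearMap ((Module.finBasis ℝ V).coord i)).smulRight
      (LinearMap.toContinuousLinearMap ((Module.finBasis ℝ V).coord j))

theorem metricForm_apply (hg : IsRiemannianMetricOn U g) {c : V} (hc : c ∈ U) (h k : V) :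
    metricForm g c h k = g c h k := by
  set B : V →ₗ[ℝ] V →ₗ[ℝ] ℝ := LinearMap.mk₂ ℝ (g c) (hg.add_left c hc)
    (fun r h k => hg.smul_left c hc r h k)
    (fun h k₁ k₂ => by
      rw [hg.symm c hc, hg.add_left c hc, hg.symm c hc k₁, hg.symm c hc k₂])
    (fun r h k => by rw [hg.symm c hc, hg.smul_left c hc, hg.symm c hc k, smul_eq_mul]) with hB
  have hBg : ∀ h k, g c h k = B h k := fun _ _ => rfl
  conv_rhs => rw [hBg, ← LinearMap.sum_repr_mul_repr_mul (Module.finBasis ℝ V)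
    (Module.finBasis ℝ V)]
  simp only [metricForm, sum_apply, smul_apply,
    ContinuousLinearMap.smulRight_apply, LinearMap.coe_toContinuousLinearMap',
    Module.Basis.coord_apply, smul_eq_mul, hBg]
  rw [Finsupp.sum_fintype _ _ (by simp)]
  refine Finset.sum_congr rfl fun i _ => ?_
  rw [Finsupp.sum_fintype _ _ (by simp)]
  refine Finset.sum_congr rfl fun j _ => ?_
  ring

theorem contDiffOn_metricForm (hg : IsRiemannianMetricOn U g) :
    ContDiffOn ℝ ∞ (metricForm g) U :=
  ContDiffOn.sum fun _ _ => ContDiffOn.sum fun _ _ => (hg.smooth _ _).smul contDiffOn_const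

theorem metricForm_symm (hg : IsRiemannianMetricOn U g) {c : V} (hc : c ∈ U) (h k : V) :
    metricForm g c h k = metricForm g c k h := by
  rw [metricForm_apply hg hc, metricForm_apply hg hc, hg.symm c hc]

theorem IsRiemannianMetricOn.abs_le_sqrt_mul_sqrt (hg : IsRiemannianMetricOn U g) {c : V}
    (hc : c ∈ U) (h k : V) : |g c h k| ≤ √(g c h h) * √(g c k k) := by
  rw [← Real.sqrt_mul (hg.nonneg hc h)]
  refine Real.abs_le_sqrt ?_
  have key : ∀ t : ℝ, 0 ≤ g c k k * (t * t) + 2 * g c h k * t + g c h h := fun t => by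
    have := hg.nonneg hc (h + t • k)
    rw [← metricForm_apply hg hc] at this
    simp only [map_add, map_smul, add_apply, smul_apply,
      smul_eq_mul, metricForm_apply hg hc] at this
    rw [hg.symm c hc k h] at this
    linarith
  have := discrim_le_zero key
  rw [discrim] at this
  linarith

/-- The metric gives an isomorphism from the space onto its dual. -/
noncomputable def metricEquiv (hg : IsRiemannianMetricOn U g) {c : V} (hc : c ∈ U) :
    V ≃L[ℝ] (V →L[ℝ] ℝ) :=
  (LinearEquiv.ofInjectiveOfFinrankEq (metricForm g c).toLinearMap
    ((injective_iff_map_eq_zero _).2 fun v hv => by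
      by_contra h
      have := hg.pos c hc v h
      rw [← metricForm_apply hg hc] at this
      have h0 : metricForm g c v = 0 := hv
      simp [h0] at this)
    (by
      rw [← (LinearMap.toContinuousLinearMap (𝕜 := ℝ) (E := V) (F' := ℝ)).finrank_eq]
      exact (Subspace.dual_finrank_eq (K := ℝ) (V := V)).symm)).toContinuousLinearEquiv

theorem coe_metricEquiv (hg : IsRiemannianMetricOn U g) {c : V} (hc : c ∈ U) :
    (metricEquiv hg hc : V →L[ℝ] (V →L[ℝ] ℝ)) = metricForm g c := by
  ext v w; rfl

/-- The velocity that corresponds to a momentum `P` at `c`. -/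
noncomputable def sharp (g : V → V → V → ℝ) (c : V) : (V →L[ℝ] ℝ) →L[ℝ] V :=
  (metricForm g c).inverse

theorem metricForm_sharp (hg : IsRiemannianMetricOn U g) {c : V} (hc : c ∈ U) (P : V →L[ℝ] ℝ) :
    metricForm g c (sharp g c P) = P := by
  rw [sharp, ← coe_metricEquiv hg hc, ContinuousLinearMap.inverse_equiv]
  exact (metricEquiv hg hc).apply_symm_apply P

theorem sharp_metricForm (hg : IsRiemannianMetricOn U g) {c : V} (hc : c ∈ U) (v : V) :
    sharp g c (metricForm g c v) = v := by
  rw [sharp, ← coe_metricEquiv hg hc, ContinuousLinearMap.inverse_equiv]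
  exact (metricEquiv hg hc).symm_apply_apply v

theorem contDiffOn_sharp (hg : IsRiemannianMetricOn U g) : ContDiffOn ℝ ∞ (sharp g) U := by
  have : CompleteSpace V := FiniteDimensional.complete ℝ V
  intro c hc
  have h1 := contDiffAt_map_inverse (𝕜 := ℝ) (n := ∞) (metricEquiv hg hc)
  rw [coe_metricEquiv hg hc] at h1
  exact h1.comp_contDiffWithinAt c (contDiffOn_metricForm hg c hc)

end Form

/-! ### Uniform estimates on compact sets -/

section Compact

variable {V : Type*} [NormedAddCommGroup V] [NormedSpace ℝ V]
  {U K : Set V} {g : V → V → V → ℝ}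

theorem exists_lipschitz_of_contDiffOn {E : Type*} [NormedAddCommGroup E] [NormedSpace ℝ E]
    {f : V → E} (hU : IsOpen U) (hf : ContDiffOn ℝ 1 f U) (hK : IsCompact K) (hKU : K ⊆ U) :
    ∃ C : ℝ, 0 ≤ C ∧ ∀ x ∈ K, ∀ y ∈ K, ‖f x - f y‖ ≤ C * ‖x - y‖ := by
  obtain ⟨C, hC⟩ := LocallyLipschitzOn.exists_lipschitzOnWith_of_compact (f := f) hK fun x hx => by
    obtain ⟨C, t, ht, h⟩ := (hf.contDiffAt (hU.mem_nhds (hKU hx))).exists_lipschitzOnWith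
    exact ⟨C, t, mem_nhdsWithin_of_mem_nhds ht, h⟩
  exact ⟨C, C.2, fun x hx y hy => by simpa [dist_eq_norm] using hC.dist_le_mul x hx y hy⟩

variable [FiniteDimensional ℝ V]

theorem exists_mul_norm_le_sqrt (hg : IsRiemannianMetricOn U g) (hK : IsCompact K)
    (hKU : K ⊆ U) : ∃ a : ℝ, 0 < a ∧ ∀ c ∈ K, ∀ v, a * ‖v‖ ≤ √(g c v v) := by
  have : ProperSpace V := FiniteDimensional.proper ℝ V
  have hcont : ContinuousOn (fun z : V × V => metricForm g z.1 z.2 z.2) (K ×ˢ Metric.sphere 0 1) :=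
    ((((contDiffOn_metricForm hg).continuousOn.mono hKU).comp continuousOn_fst
      fun z hz => hz.1).clm_apply continuousOn_snd).clm_apply continuousOn_snd
  obtain ⟨a, ha, hmin⟩ := (hK.prod (isCompact_sphere (0 : V) 1)).exists_forall_le' hcont (a := 0)
    fun z hz => by
      rw [metricForm_apply hg (hKU hz.1)]
      exact hg.pos _ (hKU hz.1) _ (ne_zero_of_mem_unit_sphere ⟨z.2, hz.2⟩)
  refine ⟨√a, Real.sqrt_pos.2 ha, fun c hc v => ?_⟩
  rcases eq_or_ne v 0 with rfl | hv
  · simp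
  · have h1 := hmin (c, ‖v‖⁻¹ • v) ⟨hc, by simp [norm_smul, hv]⟩
    rw [metricForm_apply hg (hKU hc), hg.smul_smul (hKU hc)] at h1
    have hv' : 0 < ‖v‖ := norm_pos_iff.2 hv
    refine Real.le_sqrt_of_sq_le ?_
    rw [mul_pow, Real.sq_sqrt ha.le]
    calc a * ‖v‖ ^ 2 ≤ ((‖v‖⁻¹) ^ 2 * g c v v) * ‖v‖ ^ 2 := by gcongr
      _ = g c v v := by field_simp

theorem exists_sqrt_le_mul_norm (hg : IsRiemannianMetricOn U g) (hK : IsCompact K)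
    (hKU : K ⊆ U) : ∃ A : ℝ, 0 < A ∧ ∀ c ∈ K, ∀ v, √(g c v v) ≤ A * ‖v‖ := by
  obtain ⟨M, hM⟩ := hK.exists_bound_of_continuousOn
    ((contDiffOn_metricForm hg).continuousOn.mono hKU)
  refine ⟨√(|M| + 1), by positivity, fun c hc v => Real.sqrt_le_left (by positivity) |>.2 ?_⟩
  rw [mul_pow, Real.sq_sqrt (by positivity), ← metricForm_apply hg (hKU hc)]
  calc metricForm g c v v ≤ ‖metricForm g c v v‖ := le_abs_self _
    _ ≤ ‖metricForm g c‖ * ‖v‖ * ‖v‖ := (metricForm g c).le_opNorm₂ v v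
    _ ≤ (|M| + 1) * ‖v‖ * ‖v‖ := by
      gcongr
      exact (hM c hc).trans ((le_abs_self M).trans (by linarith))
    _ = (|M| + 1) * ‖v‖ ^ 2 := by ring

/-- On a compact set the norms of the metric at two points differ by a factor that is close to `1`
when the points are close to each other. -/
theorem exists_sqrt_le_one_add_mul_sqrt (hg : IsRiemannianMetricOn U g) (hK : IsCompact K)
    (hKU : K ⊆ U) : ∃ C : ℝ, 0 ≤ C ∧ ∀ x ∈ K, ∀ y ∈ K, ∀ v,
      √(g x v v) ≤ (1 + C * ‖x - y‖) * √(g y v v) := by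
  obtain ⟨a, ha, hmin⟩ := exists_mul_norm_le_sqrt hg hK hKU
  obtain ⟨C, hC, hlip⟩ := exists_lipschitz_of_contDiffOn hg.isOpen
    ((contDiffOn_metricForm hg).of_le (by norm_cast)) hK hKU
  refine ⟨C / a ^ 2, by positivity, fun x hx y hy v => Real.sqrt_le_left (by positivity) |>.2 ?_⟩
  have h1 : g x v v - g y v v ≤ C * ‖x - y‖ * ‖v‖ ^ 2 := by
    rw [← metricForm_apply hg (hKU hx), ← metricForm_apply hg (hKU hy)]
    calc metricForm g x v v - metricForm g y v v = (metricForm g x - metricForm g y) v v := rfl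
      _ ≤ ‖(metricForm g x - metricForm g y) v v‖ := le_abs_self _
      _ ≤ ‖metricForm g x - metricForm g y‖ * ‖v‖ * ‖v‖ := ContinuousLinearMap.le_opNorm₂ _ v v
      _ ≤ C * ‖x - y‖ * ‖v‖ * ‖v‖ := by gcongr; exact hlip x hx y hy
      _ = _ := by ring
  have h2 : a ^ 2 * ‖v‖ ^ 2 ≤ g y v v := by
    rw [← mul_pow, ← Real.sq_sqrt (hg.nonneg (hKU hy) v)]
    exact pow_le_pow_left₀ (by positivity) (hmin y hy v) 2
  have h3 : C * ‖x - y‖ * ‖v‖ ^ 2 ≤ C / a ^ 2 * ‖x - y‖ * g y v v := by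
    calc C * ‖x - y‖ * ‖v‖ ^ 2 = C / a ^ 2 * ‖x - y‖ * (a ^ 2 * ‖v‖ ^ 2) := by field_simp
      _ ≤ _ := by gcongr
  rw [mul_pow, Real.sq_sqrt (hg.nonneg (hKU hy) v)]
  have h4 : 0 ≤ C / a ^ 2 * ‖x - y‖ := by positivity
  have h5 := hg.nonneg (hKU hy) v
  nlinarith [mul_nonneg h4 h5, mul_nonneg (mul_nonneg h4 h4) h5]

end Compact

/-! ### Comparison of the geodesic distance with the norms of the metric -/

section Comparison

variable {V : Type*} [NormedAddCommGroup V] [NormedSpace ℝ V] [FiniteDimensional ℝ V]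
  {U K : Set V} {g : V → V → V → ℝ} {p q x y : V} {R : ℝ}

/-- Near a compact set, straight segments bound the geodesic distance by the norm of the metric at
the starting point, up to a factor that tends to `1` with the length of the segment. -/
theorem exists_geodesicDist_le (hg : IsRiemannianMetricOn U g) (hK : IsCompact K) (hKU : K ⊆ U) :
    ∃ δ > 0, ∃ C : ℝ, 0 ≤ C ∧ ∀ x ∈ K, ∀ y, ‖y - x‖ ≤ δ → y ∈ U ∧
      geodesicDist U g x y ≤ ENNReal.ofReal ((1 + C * ‖y - x‖) * √(g x (y - x) (y - x))) := by
  have : ProperSpace V := FiniteDimensional.proper ℝ V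
  obtain ⟨δ, hδ, hsub⟩ := hK.exists_cthickening_subset_open hg.isOpen hKU
  obtain ⟨C, hC, hcomp⟩ := exists_sqrt_le_one_add_mul_sqrt hg hK.cthickening hsub
  have hmem : ∀ x ∈ K, ∀ z, ‖z - x‖ ≤ δ → z ∈ Metric.cthickening δ K := fun x hx z hz =>
    Metric.mem_cthickening_of_dist_le z x δ K hx (by rwa [dist_eq_norm])
  refine ⟨δ, hδ, C, hC, fun x hx y hy => ⟨hsub (hmem x hx y hy), ?_⟩⟩
  have hseg : ∀ t ∈ Icc (0 : ℝ) 1, ‖x + t • (y - x) - x‖ ≤ ‖y - x‖ := fun t ht => by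
    rw [add_sub_cancel_left, norm_smul, Real.norm_of_nonneg ht.1]
    exact mul_le_of_le_one_left (norm_nonneg _) ht.2
  have := geodesicDist_add_le (x := x) (v := y - x)
    (B := (1 + C * ‖y - x‖) * √(g x (y - x) (y - x))) hg
    (fun t ht => hsub (hmem x hx _ ((hseg t ht).trans hy))) fun t ht => by
      refine (hcomp _ (hmem x hx _ ((hseg t ht).trans hy)) x
        (Metric.self_subset_cthickening K hx) _).trans ?_
      gcongr
      exact hseg t ht
  rwa [add_sub_cancel] at this

theorem tendsto_geodesicDist (hg : IsRiemannianMetricOn U g) (hp : p ∈ U) :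
    Tendsto (geodesicDist U g p) (𝓝 p) (𝓝 0) := by
  have hsub : {p} ⊆ U := singleton_subset_iff.2 hp
  obtain ⟨δ, hδ, C, hC, hle⟩ := exists_geodesicDist_le hg isCompact_singleton hsub
  obtain ⟨A, hA, hAle⟩ := exists_sqrt_le_mul_norm hg isCompact_singleton hsub
  have hlim : Tendsto (fun y => ENNReal.ofReal ((1 + C * ‖y - p‖) * (A * ‖y - p‖))) (𝓝 p) (𝓝 0) := by
    have : Continuous fun y => ENNReal.ofReal ((1 + C * ‖y - p‖) * (A * ‖y - p‖)) :=
      ENNReal.continuous_ofReal.comp (by fun_prop)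
    simpa using this.tendsto p
  refine tendsto_of_tendsto_of_tendsto_of_le_of_le' tendsto_const_nhds hlim
    (Eventually.of_forall fun _ => bot_le) ?_
  filter_upwards [Metric.closedBall_mem_nhds p hδ] with y hy
  rw [mem_closedBall_iff_norm] at hy
  refine (hle p rfl y hy).2.trans (ENNReal.ofReal_le_ofReal ?_)
  gcongr
  exact hAle p rfl _

theorem geodesicBall_mem_nhds (hg : IsRiemannianMetricOn U g) (hx : x ∈ geodesicBall U g p R) :
    geodesicBall U g p R ∈ 𝓝 x := by
  obtain ⟨hxU, hlt⟩ := hx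
  have h0 : 0 < ENNReal.ofReal R - geodesicDist U g p x := tsub_pos_of_lt hlt
  filter_upwards [hg.isOpen.mem_nhds hxU, (tendsto_geodesicDist hg hxU).eventually_lt_const h0]
    with y hy hd
  exact ⟨hy, (geodesicDist_triangle hg).trans_lt (lt_tsub_iff_left.1 hd)⟩

/-- Every ball of the geodesic distance is contained in a compact subset of `U`. -/
def HasRelativelyCompactBalls (U : Set V) (g : V → V → V → ℝ) : Prop :=
  ∀ p ∈ U, ∀ R : ℝ, ∃ K ⊆ U, IsCompact K ∧ geodesicBall U g p R ⊆ K

/-- The converse of the comparison by segments: on bounded sets the norm of `y - x`, measured at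
`x`, is at most the geodesic distance of `x` and `y`, up to a factor that tends to `1` with this
distance. -/
theorem exists_sqrt_le_of_geodesicDist_lt (hg : IsRiemannianMetricOn U g)
    (hH : HasRelativelyCompactBalls U g) (hp : p ∈ U) (hR : 0 ≤ R) :
    ∃ C : ℝ, 0 ≤ C ∧ ∀ x ∈ geodesicBall U g p R, ∀ y, ∀ s : ℝ, 0 ≤ s → s ≤ 1 →
      geodesicDist U g x y < ENNReal.ofReal s →
      √(g x (y - x) (y - x)) ≤ (1 + C * s) * s := by
  obtain ⟨K, hKU, hK, hball⟩ := hH p hp (R + 1)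
  obtain ⟨a, ha, hmin⟩ := exists_mul_norm_le_sqrt hg hK hKU
  obtain ⟨C, hC, hcomp⟩ := exists_sqrt_le_one_add_mul_sqrt hg hK hKU
  refine ⟨C / a, by positivity, fun x hx y s hs0 hs1 hs => ?_⟩
  obtain ⟨γ, rfl, rfl, hU, hps, hlt⟩ := exists_path_of_geodesicDist_lt hs
  have hγK : ∀ t ∈ Icc (0 : ℝ) 1, γ t ∈ K := fun t ht =>
    hball (geodesicBall_subset_of_path hg hps hU (by
      rw [ENNReal.ofReal_add hR zero_le_one]
      exact ENNReal.add_lt_add hx.2 (hlt.trans_le (ENNReal.ofReal_le_ofReal hs1))) t ht)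
  have hdist : ∀ t ∈ Icc (0 : ℝ) 1, ‖γ t - γ 0‖ ≤ s / a := fun t ht => by
    have := norm_sub_le_arcLength (f := fun z : V => z) (inv_nonneg.2 ha.le) hg.isOpen
      contDiffOn_id (hps.restrict_right ht.1 ht.2) (fun r hr => hU r ⟨hr.1, hr.2.trans ht.2⟩)
      (fun r hr v => by
        have := hmin _ (hγK r ⟨hr.1, hr.2.trans ht.2⟩) v
        simpa [le_inv_mul_iff₀ ha] using this) hs0
      ((arcLength_mono le_rfl ht.2).trans hlt.le)
    rwa [inv_mul_eq_div] at this
  have h0K := hγK 0 ⟨le_rfl, zero_le_one⟩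
  set w := γ 1 - γ 0 with hw
  set n := √(g (γ 0) w w) with hn
  rcases (Real.sqrt_nonneg (g (γ 0) w w)).eq_or_lt with h0 | hpos
  · rw [hn, ← h0]; positivity
  -- the linear functional dual to `w` at the starting point has slope at most `n` along the path
  have hlin := norm_sub_le_arcLength (f := fun z : V => metricForm g (γ 0) w z)
    (C := n * (1 + C * (s / a))) (by positivity) hg.isOpen
    (metricForm g (γ 0) w).contDiff.contDiffOn hps hU (fun t ht v => by
      rw [ContinuousLinearMap.fderiv, metricForm_apply hg (hKU h0K), Real.norm_eq_abs]
      refine (hg.abs_le_sqrt_mul_sqrt (hKU h0K) w v).trans ?_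
      rw [mul_assoc]
      refine mul_le_mul_of_nonneg_left ?_ (Real.sqrt_nonneg _)
      refine (hcomp _ h0K _ (hγK t ht) v).trans ?_
      gcongr
      rw [norm_sub_rev]
      exact hdist t ht) hs0 hlt.le
  rw [← map_sub, ← hw, metricForm_apply hg (hKU h0K), Real.norm_of_nonneg (hg.nonneg (hKU h0K) w),
    ← Real.mul_self_sqrt (hg.nonneg (hKU h0K) w), ← hn, mul_assoc] at hlin
  have := le_of_mul_le_mul_left hlin hpos
  calc n ≤ (1 + C * (s / a)) * s := this
    _ = (1 + C / a * s) * s := by ring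

theorem eq_of_geodesicDist_eq_zero (hg : IsRiemannianMetricOn U g)
    (hH : HasRelativelyCompactBalls U g) (hp : p ∈ U) (h : geodesicDist U g p q = 0) : q = p := by
  obtain ⟨C, hC, hle⟩ := exists_sqrt_le_of_geodesicDist_lt hg hH hp zero_le_one
  have hpm : p ∈ geodesicBall U g p 1 := ⟨hp, by simp [geodesicDist_self hg hp]⟩
  have hz : √(g p (q - p) (q - p)) ≤ 0 := by
    have hlim : Tendsto (fun s : ℝ => (1 + C * s) * s) (𝓝[>] 0) (𝓝 0) := by
      have : Continuous fun s : ℝ => (1 + C * s) * s := by fun_prop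
      simpa using (this.tendsto 0).mono_left nhdsWithin_le_nhds
    refine ge_of_tendsto hlim ?_
    filter_upwards [Ioc_mem_nhdsGT zero_lt_one] with s hs
    exact hle p hpm q s hs.1.le hs.2 (by rw [h]; simpa using hs.1)
  by_contra hne
  exact ((Real.sqrt_pos.2 (hg.pos p hp _ (sub_ne_zero.2 hne))).not_ge hz)

omit [NormedSpace ℝ V] [FiniteDimensional ℝ V] in
/-- A metric space is complete if its balls lie in compact sets for another topology, here induced
by `f`, that is finer than that of the metric. -/
theorem completeSpace_of_compact_balls {α : Type*} [MetricSpace α] (f : α → V)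
    (hcpt : ∀ (p : α) (R : ℝ), ∃ K ⊆ U, IsCompact K ∧ ∀ q, dist q p < R → f q ∈ K)
    (hlim : ∀ z ∈ U, ∃ q, ∀ ε > 0, ∀ᶠ y in 𝓝 z, ∀ x, f x = y → dist x q < ε) :
    CompleteSpace α := by
  refine Metric.complete_of_cauchySeq_tendsto fun u hu => ?_
  obtain ⟨R, -, hR⟩ := cauchySeq_bdd hu
  obtain ⟨K, hKU, hK, hmem⟩ := hcpt (u 0) R
  obtain ⟨z, hz, φ, hφ, hlimz⟩ := hK.tendsto_subseq fun k => hmem (u k) (hR k 0)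
  obtain ⟨q, hq⟩ := hlim z (hKU hz)
  refine ⟨q, tendsto_nhds_of_cauchySeq_of_subseq hu hφ.tendsto_atTop ?_⟩
  refine Metric.tendsto_nhds.2 fun ε hε => ?_
  filter_upwards [hlimz.eventually (hq ε hε)] with k hk
  exact hk _ rfl

/-- If balls are relatively compact and distances finite, the metric is metrically complete. -/
theorem isMetricallyComplete_of_compact_balls (hg : IsRiemannianMetricOn U g)
    (hH : HasRelativelyCompactBalls U g)
    (hfin : ∀ p ∈ U, ∀ q ∈ U, geodesicDist U g p q ≠ ⊤) : IsMetricallyComplete U g := by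
  let M : MetricSpace U :=
    { dist := fun p q => (geodesicDist U g p q).toReal
      dist_self := fun p => by simp [geodesicDist_self hg p.2]
      dist_comm := fun p q => by rw [geodesicDist_comm hg]
      dist_triangle := fun p q r => by
        rw [← ENNReal.toReal_add (hfin _ p.2 _ q.2) (hfin _ q.2 _ r.2)]
        exact ENNReal.toReal_mono
          (ENNReal.add_ne_top.2 ⟨hfin _ p.2 _ q.2, hfin _ q.2 _ r.2⟩) (geodesicDist_triangle hg)
      eq_of_dist_eq_zero := fun {p q} h => by
        have h' := (ENNReal.toReal_eq_zero_iff _).1 h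
        exact Subtype.ext (eq_of_geodesicDist_eq_zero hg hH p.2
          (h'.resolve_right (hfin _ p.2 _ q.2))).symm }
  have hdist : ∀ p q : U, M.dist p q = (geodesicDist U g p q).toReal := fun _ _ => rfl
  refine ⟨M, fun p q => ENNReal.ofReal_toReal (hfin _ p.2 _ q.2), ?_⟩
  refine @completeSpace_of_compact_balls V _ U U M Subtype.val (fun p R => ?_) fun z hz => ?_
  · obtain ⟨K, hKU, hK, hball⟩ := hH p p.2 R
    refine ⟨K, hKU, hK, fun q hq => hball ⟨q.2, ?_⟩⟩
    rw [hdist, geodesicDist_comm hg] at hq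
    exact (ENNReal.lt_ofReal_iff_toReal_lt (hfin _ p.2 _ q.2)).2 hq
  · refine ⟨⟨z, hz⟩, fun ε hε => ?_⟩
    filter_upwards [(tendsto_geodesicDist hg hz).eventually_lt_const (ENNReal.ofReal_pos.2 hε)]
      with y hy x hx
    rw [hdist, geodesicDist_comm hg, hx]
    exact (ENNReal.lt_ofReal_iff_toReal_lt hy.ne_top).1 hy

end Comparison

/-! ### Vector fields that are smooth near a compact set -/

section VectorField

variable {E F : Type*} [NormedAddCommGroup E] [NormedSpace ℝ E] [FiniteDimensional ℝ E]
  [NormedAddCommGroup F] [NormedSpace ℝ F] {W K : Set E}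

theorem exists_contDiff_hasCompactSupport_eqOn {f : E → F} (hW : IsOpen W)
    (hf : ContDiffOn ℝ ∞ f W) (hK : IsCompact K) (hKW : K ⊆ W) :
    ∃ f' : E → F, ContDiff ℝ ∞ f' ∧ HasCompactSupport f' ∧
      ∃ O, IsOpen O ∧ K ⊆ O ∧ O ⊆ W ∧ EqOn f' f O := by
  have : ProperSpace E := FiniteDimensional.proper ℝ E
  obtain ⟨L, hL, hKL, hLW⟩ := exists_compact_between hK hW hKW
  obtain ⟨χ, h0, h1, -⟩ := exists_contMDiffMap_zero_one_nhds_of_isClosed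
    (modelWithCornersSelf ℝ E) (n := ⊤) (s := (interior L)ᶜ) (t := K)
    isOpen_interior.isClosed_compl hK.isClosed (disjoint_compl_left_iff_subset.2 hKL)
  have hχ : ContDiff ℝ ∞ χ := χ.contMDiff.contDiff
  have hzero : ∀ x ∉ L, (fun x => χ x • f x) =ᶠ[𝓝 x] 0 := fun x hx => by
    have hx' : x ∈ (interior L)ᶜ := fun h => hx (interior_subset h)
    filter_upwards [h0.filter_mono (nhds_le_nhdsSet hx')] with y hy
    simp [hy]
  refine ⟨fun x => χ x • f x, ?_, ?_, ?_⟩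
  · refine contDiff_iff_contDiffAt.2 fun x => ?_
    by_cases hx : x ∈ L
    · exact hχ.contDiffAt.smul (hf.contDiffAt (hW.mem_nhds (hLW hx)))
    · exact contDiffAt_const.congr_of_eventuallyEq (hzero x hx)
  · refine HasCompactSupport.intro hL fun x hx => (hzero x hx).eq_of_nhds
  · obtain ⟨O, hO, hKO, hOs⟩ := mem_nhdsSet_iff_exists.1 h1
    refine ⟨O ∩ W, hO.inter hW, subset_inter hKO hKW, inter_subset_right, fun x hx => ?_⟩
    have : χ x = 1 := hOs hx.1
    simp [this]

theorem exists_integralCurve_of_hasCompactSupport {f : E → E} (hf : ContDiff ℝ 1 f)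
    (hc : HasCompactSupport f) (y : E) (T : ℝ) :
    ∃ Y : ℝ → E, Y 0 = y ∧ ∀ t ∈ Ioo (-T) T, HasDerivAt Y (f (Y t)) t := by
  rcases le_or_gt T 0 with hT | hT
  · exact ⟨fun _ => y, rfl, fun t ht => absurd (ht.1.trans ht.2) (by linarith)⟩
  have : CompleteSpace E := FiniteDimensional.complete ℝ E
  obtain ⟨C, hC⟩ := hf.lipschitzWith_of_hasCompactSupport hc one_ne_zero
  obtain ⟨M, hM⟩ := hc.exists_bound_of_continuous hf.continuous
  have hM0 : 0 ≤ M := (norm_nonneg _).trans (hM 0)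
  have hpl : IsPicardLindelof (fun _ => f) (tmin := -T) (tmax := T) ⟨0, by simp [hT.le]⟩ y
      ⟨M * T, by positivity⟩ 0 ⟨M, hM0⟩ C :=
    .of_time_independent (fun x _ => hM x) hC.lipschitzOnWith (by simp; exact le_rfl)
  obtain ⟨Y, h0, hY⟩ := hpl.exists_eq_forall_mem_Icc_hasDerivWithinAt₀
  exact ⟨Y, h0, fun t ht => (hY t (Ioo_subset_Icc_self ht)).hasDerivAt (Icc_mem_nhds ht.1 ht.2)⟩

omit [FiniteDimensional ℝ E] in
theorem eqOn_of_hasDerivAt_of_contDiffOn {f : E → E} (hW : IsOpen W) (hf : ContDiffOn ℝ 1 f W)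
    {Y Z : ℝ → E} {T : ℝ} (hY : ∀ t ∈ Ioo (-T) T, Y t ∈ W ∧ HasDerivAt Y (f (Y t)) t)
    (hZ : ∀ t ∈ Ioo (-T) T, Z t ∈ W ∧ HasDerivAt Z (f (Z t)) t) (h0 : Y 0 = Z 0) :
    EqOn Y Z (Ioo (-T) T) := by
  intro t ht
  obtain ⟨S, hS, hST⟩ := exists_between (abs_lt.2 ht)
  have hsub : Icc (-S) S ⊆ Ioo (-T) T := fun r hr => ⟨by linarith [hr.1], by linarith [hr.2]⟩
  have hcpt : ∀ {X : ℝ → E}, (∀ t ∈ Ioo (-T) T, X t ∈ W ∧ HasDerivAt X (f (X t)) t) →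
      IsCompact (X '' Icc (-S) S) := fun hX =>
    isCompact_Icc.image_of_continuousOn fun r hr =>
      (hX r (hsub hr)).2.continuousAt.continuousWithinAt
  obtain ⟨C, hC, hlip⟩ := exists_lipschitz_of_contDiffOn hW hf ((hcpt hY).union (hcpt hZ)) (by
    rintro _ (⟨r, hr, rfl⟩ | ⟨r, hr, rfl⟩)
    exacts [(hY r (hsub hr)).1, (hZ r (hsub hr)).1])
  have hS0 : 0 < S := (abs_nonneg t).trans_lt hS
  refine ODE_solution_unique_of_mem_Ioo (v := fun _ => f) (K := ⟨C, hC⟩)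
    (s := fun _ => Y '' Icc (-S) S ∪ Z '' Icc (-S) S) (t₀ := 0) (a := -S) (b := S)
    (fun _ _ => LipschitzOnWith.of_dist_le_mul fun x hx y hy => ?_) (by simpa using hS0)
    (fun r hr => ⟨(hY r (hsub (Ioo_subset_Icc_self hr))).2,
      .inl (mem_image_of_mem _ (Ioo_subset_Icc_self hr))⟩)
    (fun r hr => ⟨(hZ r (hsub (Ioo_subset_Icc_self hr))).2,
      .inr (mem_image_of_mem _ (Ioo_subset_Icc_self hr))⟩) h0 (abs_lt.1 hS)
  rw [dist_eq_norm, dist_eq_norm]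
  exact hlip x hx y hy

omit [FiniteDimensional ℝ E] in
/-- Integral curves in `W` on all bounded intervals fit together to one on the whole line. -/
theorem exists_integralCurve_of_forall_Ioo {f : E → E} (hW : IsOpen W) (hf : ContDiffOn ℝ 1 f W)
    {y : E} (h : ∀ T : ℝ, ∃ Y : ℝ → E, Y 0 = y ∧
      ∀ t ∈ Ioo (-T) T, Y t ∈ W ∧ HasDerivAt Y (f (Y t)) t) :
    ∃ Y : ℝ → E, Y 0 = y ∧ ∀ t, Y t ∈ W ∧ HasDerivAt Y (f (Y t)) t := by
  choose Y h0 hY using h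
  have hcompat : ∀ S T t : ℝ, |t| < S → |t| < T → Y S t = Y T t := by
    intro S T t hS hT
    have hsub : ∀ {R : ℝ}, min S T ≤ R → Ioo (-min S T) (min S T) ⊆ Ioo (-R) R := fun hR =>
      Ioo_subset_Ioo (neg_le_neg hR) hR
    exact eqOn_of_hasDerivAt_of_contDiffOn (T := min S T) hW hf
      (fun r hr => hY S r (hsub (min_le_left _ _) hr))
      (fun r hr => hY T r (hsub (min_le_right _ _) hr)) ((h0 S).trans (h0 T).symm)
      (abs_lt.1 (lt_min hS hT))
  refine ⟨fun t => Y (|t| + 1) t, h0 _, fun t => ?_⟩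
  have ht : t ∈ Ioo (-(|t| + 1)) (|t| + 1) := abs_lt.1 (by linarith)
  refine ⟨(hY _ t ht).1, (hY _ t ht).2.congr_of_eventuallyEq ?_⟩
  filter_upwards [Ioo_mem_nhds ht.1 ht.2] with s hs
  exact hcompat _ _ s (by linarith) (abs_lt.2 hs)

end VectorField

/-! ### The geodesic flow in Hamiltonian form -/

section Flow

variable {V : Type*} [NormedAddCommGroup V] [NormedSpace ℝ V] [FiniteDimensional ℝ V]
  {U : Set V} {g : V → V → V → ℝ}

/-- The derivative of the kinetic energy `½ g_c(v, v)` in the base point, as a covector. -/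
noncomputable def energyGradient (g : V → V → V → ℝ) (c v : V) : V →L[ℝ] ℝ :=
  (1 / 2 : ℝ) • (ContinuousLinearMap.apply ℝ ℝ v ∘L
    ContinuousLinearMap.apply ℝ (V →L[ℝ] ℝ) v ∘L fderiv ℝ (metricForm g) c)

theorem energyGradient_apply (c v w : V) :
    energyGradient g c v w = 1 / 2 * fderiv ℝ (metricForm g) c w v v := rfl

/-- The Hamiltonian vector field of the kinetic energy on the cotangent space: at position `c` and
momentum `P`, the velocity is `v = P^♯` and the force is the gradient of `½ g_c(v, v)` in `c`. -/
noncomputable def hamiltonianField (g : V → V → V → ℝ) (y : V × (V →L[ℝ] ℝ)) :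
    V × (V →L[ℝ] ℝ) :=
  (sharp g y.1 y.2, energyGradient g y.1 (sharp g y.1 y.2))

theorem contDiffOn_sharp_apply (hg : IsRiemannianMetricOn U g) :
    ContDiffOn ℝ ∞ (fun y : V × (V →L[ℝ] ℝ) => sharp g y.1 y.2) (U ×ˢ univ) :=
  ((contDiffOn_sharp hg).comp contDiffOn_fst fun _ hy => hy.1).clm_apply contDiffOn_snd

theorem contDiffOn_hamiltonianField (hg : IsRiemannianMetricOn U g) :
    ContDiffOn ℝ ∞ (hamiltonianField g) (U ×ˢ univ) := by
  have h1 := contDiffOn_sharp_apply hg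
  have h2 : ContDiffOn ℝ ∞ (fun y : V × (V →L[ℝ] ℝ) => fderiv ℝ (metricForm g) y.1)
      (U ×ˢ univ) :=
    ((contDiffOn_metricForm hg).fderiv_of_isOpen hg.isOpen (by simp)).comp contDiffOn_fst
      fun _ hy => hy.1
  refine h1.prodMk (ContDiffOn.const_smul _ ?_)
  exact ((ContinuousLinearMap.contDiff _).comp_contDiffOn h1).clm_comp
    (((ContinuousLinearMap.contDiff _).comp_contDiffOn h1).clm_comp h2)

theorem fderiv_metric_apply (hg : IsRiemannianMetricOn U g) {c : V} (hc : c ∈ U) (u w z : V) :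
    fderiv ℝ (fun x => g x u w) c z = fderiv ℝ (metricForm g) c z u w := by
  have hd : DifferentiableAt ℝ (metricForm g) c :=
    ((contDiffOn_metricForm hg).contDiffAt (hg.isOpen.mem_nhds hc)).differentiableAt (by simp)
  have heq : (fun x => g x u w) =ᶠ[𝓝 c] fun x => metricForm g x u w := by
    filter_upwards [hg.isOpen.mem_nhds hc] with x hx
    rw [metricForm_apply hg hx]
  rw [heq.fderiv_eq, ((hd.hasFDerivAt.clm_apply (hasFDerivAt_const u c)).clm_apply
    (hasFDerivAt_const w c)).fderiv]
  simp

/-- `Y` is an integral curve of the Hamiltonian vector field over the set of times `I`. -/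
def IsHamiltonianOn (U : Set V) (g : V → V → V → ℝ) (Y : ℝ → V × (V →L[ℝ] ℝ)) (I : Set ℝ) : Prop :=
  ∀ t ∈ I, Y t ∈ U ×ˢ univ ∧ HasDerivAt Y (hamiltonianField g (Y t)) t

variable {Y : ℝ → V × (V →L[ℝ] ℝ)} {a b : ℝ}

namespace IsHamiltonianOn

theorem hasDerivAt_fst {I : Set ℝ} (hY : IsHamiltonianOn U g Y I) {t : ℝ} (ht : t ∈ I) :
    HasDerivAt (fun s => (Y s).1) (sharp g (Y t).1 (Y t).2) t :=
  (ContinuousLinearMap.fst ℝ V (V →L[ℝ] ℝ)).hasFDerivAt.comp_hasDerivAt t (hY t ht).2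

theorem hasDerivAt_snd {I : Set ℝ} (hY : IsHamiltonianOn U g Y I) {t : ℝ} (ht : t ∈ I) :
    HasDerivAt (fun s => (Y s).2) (energyGradient g (Y t).1 (sharp g (Y t).1 (Y t).2)) t :=
  (ContinuousLinearMap.snd ℝ V (V →L[ℝ] ℝ)).hasFDerivAt.comp_hasDerivAt t (hY t ht).2

/-- The derivative of the velocity of a Hamiltonian curve satisfies the geodesic equation. -/
theorem exists_hasDerivAt_velocity (hg : IsRiemannianMetricOn U g)
    (hY : IsHamiltonianOn U g Y (Ioo a b)) {t : ℝ} (ht : t ∈ Ioo a b) :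
    ∃ v', HasDerivAt (fun s => sharp g (Y s).1 (Y s).2) v' t ∧
      ∀ w, fderiv ℝ (metricForm g) (Y t).1 (sharp g (Y t).1 (Y t).2)
          (sharp g (Y t).1 (Y t).2) w + metricForm g (Y t).1 v' w =
        1 / 2 * fderiv ℝ (metricForm g) (Y t).1 w (sharp g (Y t).1 (Y t).2)
          (sharp g (Y t).1 (Y t).2) := by
  have hYt := (hY t ht).1
  have hopen : IsOpen (U ×ˢ (univ : Set (V →L[ℝ] ℝ))) := hg.isOpen.prod isOpen_univ
  have hs : DifferentiableAt ℝ (fun y : V × (V →L[ℝ] ℝ) => sharp g y.1 y.2) (Y t) :=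
    ((contDiffOn_sharp_apply hg).contDiffAt (hopen.mem_nhds hYt)).differentiableAt (by simp)
  have hv : HasDerivAt (fun s => sharp g (Y s).1 (Y s).2) _ t :=
    hs.hasFDerivAt.comp_hasDerivAt t (hY t ht).2
  refine ⟨_, hv, fun w => ?_⟩
  have hG : HasDerivAt (fun s => metricForm g (Y s).1) _ t :=
    HasFDerivAt.comp_hasDerivAt (l := metricForm g) (f := fun s => (Y s).1) t
      (((contDiffOn_metricForm hg).contDiffAt (hg.isOpen.mem_nhds hYt.1)).differentiableAt
        (by simp)).hasFDerivAt (hY.hasDerivAt_fst ht)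
  have hP := hG.clm_apply hv
  have heq : (fun s => (Y s).2) =ᶠ[𝓝 t] fun s => metricForm g (Y s).1 (sharp g (Y s).1 (Y s).2) := by
    filter_upwards [Ioo_mem_nhds ht.1 ht.2] with s hs
    rw [metricForm_sharp hg (hY s hs).1.1]
  have := (hP.congr_of_eventuallyEq heq).unique (hY.hasDerivAt_snd ht)
  exact congrArg (fun L : V →L[ℝ] ℝ => L w) this

/-- Conservation of energy, here in the form of the pairing of momentum and velocity. -/
theorem energy_eq (hg : IsRiemannianMetricOn U g) (hY : IsHamiltonianOn U g Y (Ioo a b)) {s t : ℝ}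
    (hs : s ∈ Ioo a b) (ht : t ∈ Ioo a b) :
    (Y s).2 (sharp g (Y s).1 (Y s).2) = (Y t).2 (sharp g (Y t).1 (Y t).2) := by
  have hd : ∀ r ∈ Ioo a b, HasDerivAt (fun r => (Y r).2 (sharp g (Y r).1 (Y r).2)) 0 r := by
    intro r hr
    obtain ⟨v', hv', heq⟩ := hY.exists_hasDerivAt_velocity hg hr
    have h1 := (hY.hasDerivAt_snd hr).clm_apply hv'
    have h2 := heq (sharp g (Y r).1 (Y r).2)
    rw [metricForm_symm hg (hY r hr).1.1, metricForm_sharp hg (hY r hr).1.1] at h2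
    rw [energyGradient_apply] at h1
    exact h1.congr_deriv (by linarith)
  exact isOpen_Ioo.is_const_of_deriv_eq_zero isPreconnected_Ioo
    (fun r hr => (hd r hr).differentiableAt.differentiableWithinAt)
    (fun r hr => (hd r hr).deriv) hs ht

theorem contDiffOn (hg : IsRiemannianMetricOn U g) {I : Set ℝ} (hY : IsHamiltonianOn U g Y I)
    (hI : Icc a b ⊆ I) : ContDiffOn ℝ ∞ Y (Icc a b) := by
  have : CompleteSpace V := FiniteDimensional.complete ℝ V
  refine ODE.contDiffOn_enat_Icc_of_hasDerivWithinAt (f := fun _ => hamiltonianField g)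
    (u := U ×ˢ univ) ?_ (fun t ht => (hY t (hI ht)).2.hasDerivWithinAt)
    (fun t ht => (hY t (hI ht)).1)
  exact (contDiffOn_hamiltonianField hg).comp contDiffOn_snd fun z hz => hz.2

theorem metric_deriv_fst (hg : IsRiemannianMetricOn U g) {I : Set ℝ} (hY : IsHamiltonianOn U g Y I)
    {t : ℝ} (ht : t ∈ I) :
    g (Y t).1 (deriv (fun s => (Y s).1) t) (deriv (fun s => (Y s).1) t) =
      (Y t).2 (sharp g (Y t).1 (Y t).2) := by
  rw [(hY.hasDerivAt_fst ht).deriv, ← metricForm_apply hg (hY t ht).1.1,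
    metricForm_sharp hg (hY t ht).1.1]

/-- Hamiltonian curves have constant speed. -/
theorem arcLength_eq (hg : IsRiemannianMetricOn U g) (hY : IsHamiltonianOn U g Y (Ioo a b))
    {r s t : ℝ} (hr : r ∈ Ioo a b) (hs : s ∈ Ioo a b) (ht : t ∈ Ioo a b) :
    arcLength g (fun r => (Y r).1) s t =
      ENNReal.ofReal (√((Y r).2 (sharp g (Y r).1 (Y r).2)) * (t - s)) := by
  have : ∀ u ∈ Icc s t, u ∈ Ioo a b := fun u hu => ⟨hs.1.trans_le hu.1, hu.2.trans_lt ht.2⟩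
  rw [arcLength, setLIntegral_congr_fun (g := fun _ =>
    ENNReal.ofReal √((Y r).2 (sharp g (Y r).1 (Y r).2))) measurableSet_Icc fun u hu => by
      simp only [hY.metric_deriv_fst hg (this u hu), hY.energy_eq hg (this u hu) hr]]
  simp [ENNReal.ofReal_mul (Real.sqrt_nonneg _)]

theorem geodesicDist_le (hg : IsRiemannianMetricOn U g) (hY : IsHamiltonianOn U g Y (Ioo a b))
    {r s t : ℝ} (hr : r ∈ Ioo a b) (hs : s ∈ Ioo a b) (ht : t ∈ Ioo a b) :
    geodesicDist U g (Y s).1 (Y t).1 ≤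
      ENNReal.ofReal (√((Y r).2 (sharp g (Y r).1 (Y r).2)) * |t - s|) := by
  wlog hst : s ≤ t generalizing s t
  · rw [geodesicDist_comm hg, abs_sub_comm]
    exact this ht hs (le_of_not_ge hst)
  have hsub : Icc s t ⊆ Ioo a b := fun u hu => ⟨hs.1.trans_le hu.1, hu.2.trans_lt ht.2⟩
  rw [abs_of_nonneg (sub_nonneg.2 hst), ← hY.arcLength_eq hg hr hs ht]
  exact geodesicDist_le_arcLength hg (γ := fun r => (Y r).1)
    (.single hst (contDiff_fst.comp_contDiffOn (hY.contDiffOn hg hsub)))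
    fun u hu => (hY u (hsub hu)).1.1

theorem isGeodesic (hg : IsRiemannianMetricOn U g) (hY : IsHamiltonianOn U g Y univ) :
    IsGeodesic U g fun t => (Y t).1 := by
  have hd : deriv (fun t => (Y t).1) = fun t => sharp g (Y t).1 (Y t).2 :=
    funext fun t => (hY.hasDerivAt_fst (mem_univ t)).deriv
  refine ⟨?_, fun t => (hY t (mem_univ t)).1.1, fun t w => ?_⟩
  · refine contDiff_fst.comp (contDiff_iff_contDiffAt.2 fun t => ?_)
    exact (hY.contDiffOn hg (subset_univ (Icc (t - 1) (t + 1)))).contDiffAt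
      (Icc_mem_nhds (by linarith) (by linarith))
  · have hY' : IsHamiltonianOn U g Y (Ioo (t - 1) (t + 1)) := fun s _ => hY s (mem_univ s)
    obtain ⟨v', hv', heq⟩ := hY'.exists_hasDerivAt_velocity hg (t := t) ⟨by linarith, by linarith⟩
    have hU := (hY t (mem_univ t)).1.1
    rw [hd, hv'.deriv, fderiv_metric_apply hg hU, fderiv_metric_apply hg hU,
      ← metricForm_apply hg hU]
    have := heq w
    linarith

end IsHamiltonianOn

/-- If balls are relatively compact, Hamiltonian curves exist for all time: by conservation of
energy they stay in a bounded set for bounded times, and there the vector field may be cut off. -/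
theorem exists_isHamiltonianOn_univ (hg : IsRiemannianMetricOn U g)
    (hH : HasRelativelyCompactBalls U g) {p : V} (hp : p ∈ U) (P : V →L[ℝ] ℝ) :
    ∃ Y : ℝ → V × (V →L[ℝ] ℝ), Y 0 = (p, P) ∧ IsHamiltonianOn U g Y univ := by
  have hopen : IsOpen (U ×ˢ (univ : Set (V →L[ℝ] ℝ))) := hg.isOpen.prod isOpen_univ
  have hsmooth := contDiffOn_hamiltonianField hg
  suffices h : ∀ T : ℝ, ∃ Y : ℝ → V × (V →L[ℝ] ℝ), Y 0 = (p, P) ∧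
      ∀ t ∈ Ioo (-T) T, Y t ∈ U ×ˢ univ ∧ HasDerivAt Y (hamiltonianField g (Y t)) t by
    obtain ⟨Y, h0, hY⟩ := exists_integralCurve_of_forall_Ioo hopen
      (hsmooth.of_le (by norm_cast)) h
    exact ⟨Y, h0, fun t _ => hY t⟩
  intro T
  have : ProperSpace (V →L[ℝ] ℝ) := FiniteDimensional.proper ℝ _
  set e : ℝ := √(P (sharp g p P)) with he
  obtain ⟨K, hKU, hK, hball⟩ := hH p hp (e * |T| + 1)
  obtain ⟨A, hA, hAle⟩ := exists_sqrt_le_mul_norm hg hK hKU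
  set B : Set (V × (V →L[ℝ] ℝ)) := K ×ˢ Metric.closedBall 0 (e * A) with hB
  have hBW : B ⊆ U ×ˢ univ := fun y hy => ⟨hKU hy.1, mem_univ _⟩
  have hBc : IsCompact B := hK.prod (isCompact_closedBall _ _)
  obtain ⟨f, hf, hfc, O, hO, hBO, hOW, hfO⟩ :=
    exists_contDiff_hasCompactSupport_eqOn hopen hsmooth hBc hBW
  obtain ⟨Y, h0, hY⟩ := exists_integralCurve_of_hasCompactSupport (hf.of_le (by norm_cast)) hfc
    (p, P) (|T| + 1)
  have hcont : ∀ t ∈ Ioo (-(|T| + 1)) (|T| + 1), ContinuousAt Y t := fun t ht =>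
    (hY t ht).continuousAt
  -- as long as the curve stays in `O`, energy conservation confines it to `B`
  have hstay : ∀ S : ℝ, S ≤ |T| + 1 → (∀ t ∈ Ioo (-S) S, Y t ∈ O) →
      ∀ t ∈ Ioo (-S) S, |t| ≤ |T| → Y t ∈ B := by
    intro S hS hYO t ht htT
    have hHam : IsHamiltonianOn U g Y (Ioo (-S) S) := fun r hr => by
      refine ⟨hOW (hYO r hr), ?_⟩
      rw [← hfO (hYO r hr)]
      exact hY r ⟨by linarith [hr.1], by linarith [hr.2]⟩
    have hS0 : (0 : ℝ) ∈ Ioo (-S) S := by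
      have := ht.1.trans ht.2
      constructor <;> linarith
    have hdist := hHam.geodesicDist_le hg hS0 hS0 ht
    have hE := hHam.energy_eq hg ht hS0
    have hU := (hHam t ht).1.1
    rw [h0] at hE hdist
    have hxK : (Y t).1 ∈ K := by
      refine hball ⟨hU, hdist.trans_lt ?_⟩
      rw [sub_zero, ENNReal.ofReal_lt_ofReal_iff (by positivity)]
      have : e * |t| ≤ e * |T| := by gcongr
      linarith
    refine ⟨hxK, mem_closedBall_zero_iff.2 (ContinuousLinearMap.opNorm_le_bound _ (by positivity)
      fun w => ?_)⟩
    have h1 := hg.abs_le_sqrt_mul_sqrt hU (sharp g (Y t).1 (Y t).2) w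
    simp only [← metricForm_apply hg hU] at h1
    rw [metricForm_sharp hg hU, hE, metricForm_apply hg hU] at h1
    rw [mul_assoc]
    exact h1.trans (mul_le_mul_of_nonneg_left (hAle _ hxK w) (Real.sqrt_nonneg _))
  -- the curve stays in `B`, by a continuity argument in `t` for the intervals `[-t, t]`, which are
  -- parametrized by `ρ * t`
  have hind : Icc 0 |T| ⊆ {t | ∀ ρ ∈ Icc (-1 : ℝ) 1, Y (ρ * t) ∈ B} := by
    have habs : ∀ t ∈ Icc (0 : ℝ) |T|, ∀ ρ ∈ Icc (-1 : ℝ) 1, |ρ * t| ≤ |T| := fun t ht ρ hρ => by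
      rw [abs_mul, abs_of_nonneg ht.1]
      exact (mul_le_of_le_one_left ht.1 (abs_le.2 hρ)).trans ht.2
    refine IsClosed.Icc_subset_of_forall_mem_nhdsWithin ?_ ?_ ?_
    · have : {t | ∀ ρ ∈ Icc (-1 : ℝ) 1, Y (ρ * t) ∈ B} ∩ Icc 0 |T| =
          ⋂ ρ ∈ Icc (-1 : ℝ) 1, Icc 0 |T| ∩ (fun t => Y (ρ * t)) ⁻¹' B := by
        ext t
        simp only [mem_inter_iff, mem_iInter, mem_preimage, mem_ofPred_eq]
        exact ⟨fun h ρ hρ => ⟨h.2, h.1 ρ hρ⟩, fun h =>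
          ⟨fun ρ hρ => (h ρ hρ).2, (h 0 (by norm_num)).1⟩⟩
      rw [this]
      refine isClosed_biInter fun ρ hρ =>
        ContinuousOn.preimage_isClosed_of_isClosed (fun t ht => ?_) isClosed_Icc hBc.isClosed
      have h1 := hcont (ρ * t) (abs_lt.1 ((habs t ht ρ hρ).trans_lt (by linarith)))
      exact (ContinuousAt.comp (f := fun t => ρ * t) h1 (by fun_prop)).continuousWithinAt
    · intro ρ _
      have hP0 : P (sharp g p P) = e ^ 2 := by
        rw [he, Real.sq_sqrt]
        have := hg.nonneg hp (sharp g p P)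
        rwa [← metricForm_apply hg hp, metricForm_sharp hg hp] at this
      have hpK : p ∈ K := hball ⟨hp, by
        rw [geodesicDist_self hg hp]; exact ENNReal.ofReal_pos.2 (by positivity)⟩
      rw [mul_zero, h0]
      refine ⟨hpK, mem_closedBall_zero_iff.2 (ContinuousLinearMap.opNorm_le_bound _ (by positivity)
        fun w => ?_)⟩
      have h1 := hg.abs_le_sqrt_mul_sqrt hp (sharp g p P) w
      simp only [← metricForm_apply hg hp] at h1
      rw [metricForm_sharp hg hp, metricForm_apply hg hp, ← he] at h1
      rw [mul_assoc]
      exact h1.trans (mul_le_mul_of_nonneg_left (hAle _ hpK w) (Real.sqrt_nonneg _))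
    · rintro t ⟨ht, ht0, htT⟩
      have hmem : ∀ r, |r| ≤ t → Y r ∈ B := fun r hr => by
        rcases ht0.eq_or_lt with rfl | ht0
        · simpa [abs_nonpos_iff.1 hr] using ht 0 (by norm_num)
        · have := ht (r / t) (abs_le.1 (by rw [abs_div, abs_of_pos ht0]; exact (div_le_one ht0).2 hr))
          rwa [div_mul_cancel₀ _ ht0.ne'] at this
      have hev : ∀ r, |r| = t → ∀ᶠ s in 𝓝 r, Y s ∈ O := fun r hr =>
        (hcont r (abs_lt.1 (by linarith))).eventually_mem (hO.mem_nhds (hBO (hmem r hr.le)))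
      obtain ⟨ε₁, hε₁, h₁⟩ := Metric.eventually_nhds_iff.1 (hev t (abs_of_nonneg ht0))
      obtain ⟨ε₂, hε₂, h₂⟩ := Metric.eventually_nhds_iff.1 (hev (-t) (by rw [abs_neg, abs_of_nonneg ht0]))
      have hlt : t < min (min (t + ε₁) (t + ε₂)) |T| := by
        refine lt_min (lt_min ?_ ?_) htT <;> linarith
      filter_upwards [Ioo_mem_nhdsGT hlt] with s hs ρ hρ
      obtain ⟨S, hsS, hS⟩ := exists_between hs.2
      simp only [lt_min_iff] at hS
      have hsT : |ρ * s| ≤ s := by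
        rw [abs_mul, abs_of_nonneg (ht0.trans hs.1.le)]
        exact mul_le_of_le_one_left (ht0.trans hs.1.le) (abs_le.2 hρ)
      refine hstay S (by linarith) (fun r hr => ?_) _ (abs_lt.1 (hsT.trans_lt hsS))
        (by linarith)
      rcases le_or_gt |r| t with hrt | hrt
      · exact hBO (hmem r hrt)
      · rcases lt_abs.1 hrt with h | h
        · exact h₁ (by rw [Real.dist_eq, abs_lt]; constructor <;> linarith [hr.2])
        · exact h₂ (by rw [Real.dist_eq, abs_lt]; constructor <;> linarith [hr.1])
  refine ⟨Y, h0, fun t ht => ?_⟩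
  have htT : |t| ≤ |T| := (abs_lt.2 ht).le.trans (le_abs_self T)
  have hmem : Y t ∈ B := by
    rcases le_total 0 t with h | h
    · simpa using hind ⟨abs_nonneg t, htT⟩ 1 (by norm_num) |> fun h' => by
        simpa [abs_of_nonneg h] using h'
    · simpa using hind ⟨abs_nonneg t, htT⟩ (-1) (by norm_num) |> fun h' => by
        simpa [abs_of_nonpos h] using h'
  refine ⟨hBW hmem, ?_⟩
  rw [← hfO (hBO hmem)]
  exact hY t (abs_lt.1 (by linarith))

/-- If balls are relatively compact, the metric is geodesically complete. -/
theorem isGeodesicallyComplete_of_compact_balls (hg : IsRiemannianMetricOn U g)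
    (hH : HasRelativelyCompactBalls U g) : IsGeodesicallyComplete U g := by
  intro p hp v
  obtain ⟨Y, h0, hY⟩ := exists_isHamiltonianOn_univ hg hH hp (metricForm g p v)
  refine ⟨fun t => (Y t).1, hY.isGeodesic hg, by simp [h0], ?_⟩
  rw [(hY.hasDerivAt_fst (mem_univ 0)).deriv, h0]
  exact sharp_metricForm hg hp v

end Flow

/-! ### Minimizers of the discrete energy -/

section Discrete

variable {V : Type*} [NormedAddCommGroup V] [NormedSpace ℝ V]
  {U K : Set V} {g : V → V → V → ℝ} {p q : V}

theorem continuousOn_arcLength {γ : ℝ → V} (hfin : arcLength g γ 0 1 ≠ ⊤) :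
    ContinuousOn (fun t => (arcLength g γ 0 t).toReal) (Icc 0 1) := by
  set F : ℝ → ℝ≥0∞ := fun t => ENNReal.ofReal √(g (γ t) (deriv γ t) (deriv γ t)) with hF
  have hfin' : ∀ {s t : ℝ}, 0 ≤ s → t ≤ 1 → arcLength g γ s t ≠ ⊤ := fun hs ht =>
    ne_top_of_le_ne_top hfin (arcLength_mono hs ht)
  rw [Metric.continuousOn_iff]
  intro t ht ε hε
  obtain ⟨δ, hδ, hlt⟩ := exists_pos_setLIntegral_lt_of_measure_lt
    (μ := volume.restrict (Icc 0 1)) (f := F) hfin (ENNReal.ofReal_pos.2 hε).ne'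
  obtain ⟨r, hr0, hr⟩ := ENNReal.lt_iff_exists_nnreal_btwn.1 hδ
  have key : ∀ s ∈ Icc (0 : ℝ) 1, ∀ t ∈ Icc (0 : ℝ) 1, s ≤ t → t - s < r →
      dist (arcLength g γ 0 s).toReal (arcLength g γ 0 t).toReal < ε := by
    intro s hs t ht hst hd
    rw [← arcLength_add hs.1 hst, ENNReal.toReal_add (hfin' le_rfl hs.2) (hfin' hs.1 ht.2),
      dist_self_add_right, Real.norm_of_nonneg ENNReal.toReal_nonneg]
    have hle : volume.restrict (Icc (0 : ℝ) 1) (Icc s t) < δ := by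
      refine (Measure.restrict_apply_le _ _).trans_lt (lt_trans ?_ hr)
      rw [Real.volume_Icc, ← ENNReal.ofReal_coe_nnreal]
      exact (ENNReal.ofReal_lt_ofReal_iff (lt_of_le_of_lt (sub_nonneg.2 hst) hd)).2 hd
    have h2 := hlt _ hle
    rw [Measure.restrict_restrict measurableSet_Icc,
      inter_eq_left.2 (Icc_subset_Icc hs.1 ht.2)] at h2
    exact (ENNReal.lt_ofReal_iff_toReal_lt (hfin' hs.1 ht.2)).1 h2
  refine ⟨r, by exact_mod_cast hr0, fun s hs hd => ?_⟩
  rw [Real.dist_eq] at hd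
  rcases le_total s t with hst | hst
  · exact key s hs t ht hst (by rw [abs_sub_comm] at hd; exact (le_abs_self _).trans_lt hd)
  · rw [dist_comm]
    exact key t ht s hs hst ((le_abs_self _).trans_lt hd)

variable [FiniteDimensional ℝ V]

/-- Points at equal arc length along an almost minimizing path. -/
theorem exists_equidistant_points (hg : IsRiemannianMetricOn U g)
    (hH : HasRelativelyCompactBalls U g) (hp : p ∈ U) {L : ℝ}
    (hL : geodesicDist U g p q < ENNReal.ofReal L) {N : ℕ} (hN : 0 < N) :
    ∃ x : ℕ → V, x 0 = p ∧ x N = q ∧ (∀ k, x k ∈ geodesicBall U g p L) ∧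
      ∀ k < N, geodesicDist U g (x k) (x (k + 1)) < ENNReal.ofReal (L / N) := by
  obtain ⟨γ, rfl, rfl, hU, hs, hlt⟩ := exists_path_of_geodesicDist_lt hL
  have hfin' : ∀ {s t : ℝ}, 0 ≤ s → t ≤ 1 → arcLength g γ s t ≠ ⊤ := fun hs ht =>
    ne_top_of_le_ne_top hlt.ne_top (arcLength_mono hs ht)
  set l : ℝ → ℝ := fun t => (arcLength g γ 0 t).toReal with hl
  have hl0 : l 0 = 0 := by simp [hl, arcLength]
  have hdist : ∀ s ∈ Icc (0 : ℝ) 1, ∀ t ∈ Icc (0 : ℝ) 1,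
      geodesicDist U g (γ s) (γ t) ≤ ENNReal.ofReal |l t - l s| := by
    intro s hs' t ht
    wlog hst : s ≤ t generalizing s t
    · rw [geodesicDist_comm hg, abs_sub_comm]
      exact this t ht s hs' (le_of_not_ge hst)
    refine (geodesicDist_le_arcLength_of_path hg hs hU hs'.1 hst ht.2).trans ?_
    have : l t = l s + (arcLength g γ s t).toReal := by
      rw [hl, ← ENNReal.toReal_add (hfin' le_rfl hs'.2) (hfin' hs'.1 ht.2),
        arcLength_add hs'.1 hst]
    rw [this, add_sub_cancel_left, abs_of_nonneg ENNReal.toReal_nonneg,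
      ENNReal.ofReal_toReal (hfin' hs'.1 ht.2)]
  have hL0 : l 1 < L := (ENNReal.lt_ofReal_iff_toReal_lt hlt.ne_top).1 hlt
  have hl1 : 0 ≤ l 1 := ENNReal.toReal_nonneg
  have hN' : (0 : ℝ) < N := by exact_mod_cast hN
  have hivt : ∀ k : ℕ, ∃ t ∈ Icc (0 : ℝ) 1, l t = min (k : ℝ) N * (l 1 / N) := by
    intro k
    have := intermediate_value_Icc zero_le_one (continuousOn_arcLength hlt.ne_top)
    refine this ⟨?_, ?_⟩
    · change l 0 ≤ _
      rw [hl0]; positivity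
    · change _ ≤ l 1
      calc min (k : ℝ) N * (l 1 / N) ≤ N * (l 1 / N) := by gcongr; exact min_le_right _ _
        _ = l 1 := by field_simp
  choose t ht hlt' using hivt
  have hlN : l (t N) = l 1 := by rw [hlt', min_self]; field_simp
  refine ⟨fun k => γ (t k), ?_, ?_, fun k => ⟨hU _ (ht k), ?_⟩, fun k hk => ?_⟩
  · refine eq_of_geodesicDist_eq_zero hg hH hp (le_antisymm ?_ bot_le)
    simpa [hl0, hlt'] using hdist 0 ⟨le_rfl, zero_le_one⟩ (t 0) (ht 0)
  · refine eq_of_geodesicDist_eq_zero hg hH (hU 1 ⟨zero_le_one, le_rfl⟩) (le_antisymm ?_ bot_le)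
    simpa [hlN] using hdist 1 ⟨zero_le_one, le_rfl⟩ (t N) (ht N)
  · refine (geodesicDist_le_arcLength_of_path hg hs hU le_rfl (ht k).1 (ht k).2).trans_lt ?_
    exact (arcLength_mono le_rfl (ht k).2).trans_lt hlt
  · refine (hdist _ (ht k) _ (ht (k + 1))).trans_lt ?_
    have hk1 : (k : ℝ) + 1 ≤ N := by exact_mod_cast hk
    rw [hlt', hlt', Nat.cast_add_one, min_eq_left hk1, min_eq_left (by linarith), ← sub_mul,
      add_sub_cancel_left, one_mul, abs_of_nonneg (by positivity)]
    exact (ENNReal.ofReal_lt_ofReal_iff (by have := hl1.trans_lt hL0; positivity)).2 (by gcongr)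

/-- The energy of the first `N` steps of the discrete curve `x`, without the factor `N` that makes
it comparable to the energy of a path on the unit interval. -/
noncomputable def discreteEnergy (g : V → V → V → ℝ) (N : ℕ) (x : ℕ → V) : ℝ :=
  ∑ k ∈ Finset.range N, g (x k) (x (k + 1) - x k) (x (k + 1) - x k)

theorem exists_minimizer_discreteEnergy (hg : IsRiemannianMetricOn U g) (hK : IsCompact K)
    (hKU : K ⊆ U) (N : ℕ) {z : ℕ → V} (hz : ∀ k, z k ∈ K) :
    ∃ x : ℕ → V, x 0 = z 0 ∧ x N = z N ∧ (∀ k, x k ∈ K) ∧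
      ∀ y : ℕ → V, y 0 = z 0 → y N = z N → (∀ k, y k ∈ K) →
        discreteEnergy g N x ≤ discreteEnergy g N y := by
  set S : Set (ℕ → V) := (univ.pi fun _ => K) ∩ ({x | x 0 = z 0} ∩ {x | x N = z N}) with hS
  have hSc : IsCompact S := (isCompact_univ_pi fun _ => hK).inter_right
    ((isClosed_eq (continuous_apply 0) continuous_const).inter
      (isClosed_eq (continuous_apply N) continuous_const))
  have hcont : ContinuousOn (discreteEnergy g N) S := by
    refine continuousOn_finsetSum _ fun k _ => ?_
    have h1 : ContinuousOn (fun x : ℕ → V => metricForm g (x k)) S :=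
      ((contDiffOn_metricForm hg).continuousOn.mono hKU).comp (continuous_apply k).continuousOn
        fun x hx => hx.1 k (mem_univ k)
    have h2 : ContinuousOn (fun x : ℕ → V => x (k + 1) - x k) S := by fun_prop
    refine ((h1.clm_apply h2).clm_apply h2).congr fun x hx => ?_
    exact (metricForm_apply hg (hKU (hx.1 k (mem_univ k))) _ _).symm
  obtain ⟨x, hx, hmin⟩ := hSc.exists_isMinOn ⟨z, fun k _ => hz k, rfl, rfl⟩ hcont
  exact ⟨x, hx.2.1, hx.2.2, fun k => hx.1 k (mem_univ k),
    fun y h0 hN hy => hmin ⟨fun k _ => hy k, h0, hN⟩⟩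

theorem hasFDerivAt_two_steps (hg : IsRiemannianMetricOn U g) {a b c : V} (ha : a ∈ U)
    (hc : c ∈ U) :
    HasFDerivAt (fun z => metricForm g a (z - a) (z - a) + metricForm g z (b - z) (b - z))
      ((2 : ℝ) • (metricForm g a (c - a) + energyGradient g c (b - c) -
        metricForm g c (b - c))) c := by
  have hG : HasFDerivAt (metricForm g) (fderiv ℝ (metricForm g) c) c :=
    (((contDiffOn_metricForm hg).contDiffAt (hg.isOpen.mem_nhds hc)).differentiableAt
      (by simp)).hasFDerivAt
  have h1 : HasFDerivAt (fun z => z - a) (ContinuousLinearMap.id ℝ V) c :=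
    (hasFDerivAt_id c).sub_const a
  have h2 : HasFDerivAt (fun z => b - z) (-ContinuousLinearMap.id ℝ V) c :=
    (hasFDerivAt_id c).const_sub b
  have h3 := (((metricForm g a).hasFDerivAt.comp c h1).clm_apply h1).add
    ((hG.clm_apply h2).clm_apply h2)
  refine h3.congr_fderiv ?_
  ext w
  have e1 := metricForm_symm hg ha (c - a) w
  have e2 := metricForm_symm hg hc (b - c) w
  simp only [map_sub, sub_apply] at e1 e2
  simp [energyGradient_apply]
  linarith

/-- A minimizer of the discrete energy satisfies the discrete Euler-Lagrange equation at each
interior point that has a neighbourhood in which it may be varied. -/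
theorem discrete_euler_lagrange (hg : IsRiemannianMetricOn U g) (hKU : K ⊆ U) {N : ℕ}
    {x : ℕ → V} (hx : ∀ k, x k ∈ K)
    (hmin : ∀ y : ℕ → V, y 0 = x 0 → y N = x N → (∀ k, y k ∈ K) →
      discreteEnergy g N x ≤ discreteEnergy g N y)
    {k : ℕ} (hk : k + 1 < N) (hnhds : K ∈ 𝓝 (x (k + 1))) :
    metricForm g (x k) (x (k + 1) - x k) + energyGradient g (x (k + 1)) (x (k + 2) - x (k + 1)) =
      metricForm g (x (k + 1)) (x (k + 2) - x (k + 1)) := by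
  have hloc : IsLocalMin (fun z => metricForm g (x k) (z - x k) (z - x k) +
      metricForm g z (x (k + 2) - z) (x (k + 2) - z)) (x (k + 1)) := by
    filter_upwards [hnhds] with z hz
    set y := Function.update x (k + 1) z with hy
    have hyne : ∀ j, j ≠ k + 1 → y j = x j := fun j hj => Function.update_of_ne hj _ _
    have hyk : y (k + 1) = z := Function.update_self ..
    have hE := hmin y (hyne 0 (by omega)) (hyne N (by omega)) fun j => by
      by_cases hj : j = k + 1
      · rw [hj, hyk]; exact hz
      · rw [hyne j hj]; exact hx j
    have hsub : ({k, k + 1} : Finset ℕ) ⊆ Finset.range N := by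
      intro j hj
      simp only [Finset.mem_insert, Finset.mem_singleton] at hj
      simp only [Finset.mem_range]
      omega
    rw [← sub_nonneg, discreteEnergy, discreteEnergy, ← Finset.sum_sub_distrib,
      ← Finset.sum_subset hsub fun j _ hj => by
        simp only [Finset.mem_insert, Finset.mem_singleton, not_or] at hj
        rw [hyne j hj.2, hyne (j + 1) (by omega), sub_self],
      Finset.sum_pair (by omega)] at hE
    rw [hyk, hyne k (by omega), hyne (k + 1 + 1) (by omega)] at hE
    rw [metricForm_apply hg (hKU (hx k)), metricForm_apply hg (hKU (hx k)),
      metricForm_apply hg (hKU (hx (k + 1))), metricForm_apply hg (hKU hz)]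
    linarith
  have h0 := hloc.hasFDerivAt_eq_zero
    (hasFDerivAt_two_steps hg (hKU (hx k)) (hKU (hx (k + 1))))
  exact sub_eq_zero.1 ((smul_eq_zero.1 h0).resolve_left two_ne_zero)

end Discrete

/-! ### Discrete geodesics -/

section DiscreteGeodesics

variable {V : Type*} [NormedAddCommGroup V] [NormedSpace ℝ V] [FiniteDimensional ℝ V]
  {U K : Set V} {g : V → V → V → ℝ} {p q : V}

/-- Between two points there are discrete geodesics with any large number of steps, in a fixed
compact set and with energies that are asymptotically at most the square of the distance. -/
theorem exists_discrete_geodesics (hg : IsRiemannianMetricOn U g)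
    (hH : HasRelativelyCompactBalls U g) (hp : p ∈ U) (hfin : geodesicDist U g p q ≠ ⊤) :
    ∃ K ⊆ U, IsCompact K ∧ ∃ Λ : ℕ → ℝ, Tendsto Λ atTop (𝓝 (geodesicDist U g p q).toReal) ∧
      ∀ᶠ N : ℕ in atTop, ∃ x : ℕ → V, x 0 = p ∧ x N = q ∧ (∀ k, x k ∈ K) ∧
        N * discreteEnergy g N x ≤ Λ N ^ 2 ∧ ∀ k, k + 1 < N →
          metricForm g (x k) (x (k + 1) - x k) +
            energyGradient g (x (k + 1)) (x (k + 2) - x (k + 1)) =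
          metricForm g (x (k + 1)) (x (k + 2) - x (k + 1)) := by
  set L := (geodesicDist U g p q).toReal with hL
  have hL0 : 0 ≤ L := ENNReal.toReal_nonneg
  obtain ⟨K, hKU, hK, hball⟩ := hH p hp (L + 2)
  obtain ⟨C₁, hC₁, hsample⟩ := exists_sqrt_le_of_geodesicDist_lt hg hH hp
    (by positivity : 0 ≤ L + 1)
  obtain ⟨δ, hδ, C₂, hC₂, hseg⟩ := exists_geodesicDist_le hg hK hKU
  obtain ⟨a, ha, hmin⟩ := exists_mul_norm_le_sqrt hg hK hKU
  have hN1 : Tendsto (fun N : ℕ => 1 / (N : ℝ)) atTop (𝓝 0) := tendsto_one_div_atTop_nhds_zero_nat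
  set s : ℕ → ℝ := fun N => (L + 1 / N) / N with hs
  have hs0 : Tendsto s atTop (𝓝 0) := by
    have : Tendsto (fun N : ℕ => (L + 1 / N) * (1 / (N : ℝ))) atTop (𝓝 ((L + 0) * 0)) :=
      (hN1.const_add L).mul hN1
    simpa [hs, div_eq_mul_inv] using this
  set Λ : ℕ → ℝ := fun N => (1 + C₁ * s N) * (L + 1 / N) with hΛ
  have hΛL : Tendsto Λ atTop (𝓝 L) := by
    simpa [hΛ] using ((hs0.const_mul C₁).const_add 1).mul (hN1.const_add L)
  -- an upper bound for the norms of the steps of a curve of energy at most `Λ N ^ 2`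
  set η : ℕ → ℝ := fun N => (L + 1) / (a * √N) with hη
  have hη0 : Tendsto η atTop (𝓝 0) :=
    Tendsto.const_div_atTop ((Real.tendsto_sqrt_atTop.comp
      tendsto_natCast_atTop_atTop).const_mul_atTop ha) _
  have hηL : Tendsto (fun N => (1 + C₂ * η N) * (L + 1)) atTop (𝓝 (L + 1)) := by
    simpa using ((hη0.const_mul C₂).const_add 1).mul_const (L + 1)
  refine ⟨K, hKU, hK, Λ, hΛL, ?_⟩
  filter_upwards [eventually_gt_atTop 0, hs0.eventually_le_const zero_lt_one,
    hΛL.eventually_lt_const (by linarith : L < L + 1), hη0.eventually_le_const hδ,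
    hηL.eventually_lt_const (by linarith : L + 1 < L + 2)] with N hN hsN hΛN hηN hηLN
  have hN' : (0 : ℝ) < N := by exact_mod_cast hN
  have hN1 : 1 / (N : ℝ) ≤ 1 := by
    rw [div_le_one hN']; exact_mod_cast hN
  have hNpos : 0 < 1 / (N : ℝ) := by positivity
  have hsN0 : 0 ≤ s N := by simp only [hs]; positivity
  have hΛ0 : 0 ≤ Λ N := by simp only [hΛ]; positivity
  have hlt : geodesicDist U g p q < ENNReal.ofReal (L + 1 / N) := by
    rw [ENNReal.lt_ofReal_iff_toReal_lt hfin]; linarith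
  obtain ⟨z, hz0, hzN, hzball, hzd⟩ := exists_equidistant_points hg hH hp hlt hN
  have hballs : ∀ {r r' : ℝ}, r ≤ r' → geodesicBall U g p r ⊆ geodesicBall U g p r' :=
    fun h y hy => ⟨hy.1, hy.2.trans_le (ENNReal.ofReal_le_ofReal h)⟩
  have hzK : ∀ k, z k ∈ K := fun k => hball (hballs (by linarith) (hzball k))
  obtain ⟨x, hx0, hxN, hxK, hxmin⟩ := exists_minimizer_discreteEnergy hg hK hKU N hzK
  have hEz : N * discreteEnergy g N z ≤ Λ N ^ 2 := by
    have hterm : ∀ k ∈ Finset.range N, g (z k) (z (k + 1) - z k) (z (k + 1) - z k) ≤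
        ((1 + C₁ * s N) * s N) ^ 2 := fun k hk => by
      have := hsample (z k) (hballs (by linarith) (hzball k)) (z (k + 1)) (s N) hsN0 hsN
        (hzd k (Finset.mem_range.1 hk))
      rw [← Real.sq_sqrt (hg.nonneg (hKU (hzK k)) _)]
      exact pow_le_pow_left₀ (Real.sqrt_nonneg _) this 2
    calc N * discreteEnergy g N z ≤ N * ∑ _k ∈ Finset.range N, ((1 + C₁ * s N) * s N) ^ 2 := by
          gcongr; exact Finset.sum_le_sum hterm
      _ = ((1 + C₁ * s N) * (N * s N)) ^ 2 := by simp; ring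
      _ = Λ N ^ 2 := by
        have : N * s N = L + 1 / N := by simp only [hs]; field_simp
        rw [this]
  have hEx : N * discreteEnergy g N x ≤ Λ N ^ 2 :=
    (mul_le_mul_of_nonneg_left (hxmin z rfl rfl hzK) hN'.le).trans hEz
  have hnn : ∀ k, 0 ≤ g (x k) (x (k + 1) - x k) (x (k + 1) - x k) := fun k =>
    hg.nonneg (hKU (hxK k)) _
  have hsum : ∑ k ∈ Finset.range N, √(g (x k) (x (k + 1) - x k) (x (k + 1) - x k)) ≤ L + 1 := by
    refine le_trans ?_ hΛN.le
    refine le_of_sq_le_sq ?_ hΛ0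
    refine (sq_sum_le_card_mul_sum_sq).trans ?_
    rw [Finset.card_range]
    refine le_trans (le_of_eq ?_) hEx
    rw [discreteEnergy]
    congr 1
    exact Finset.sum_congr rfl fun k _ => Real.sq_sqrt (hnn k)
  have hstep : ∀ k < N, ‖x (k + 1) - x k‖ ≤ η N := by
    intro k hk
    have h1 : g (x k) (x (k + 1) - x k) (x (k + 1) - x k) ≤ discreteEnergy g N x :=
      Finset.single_le_sum (f := fun k => g (x k) (x (k + 1) - x k) (x (k + 1) - x k))
        (fun j _ => hnn j) (Finset.mem_range.2 hk)
    have h2 : √(g (x k) (x (k + 1) - x k) (x (k + 1) - x k)) ≤ (L + 1) / √N := by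
      rw [Real.sqrt_le_left (by positivity), div_pow, Real.sq_sqrt hN'.le, le_div_iff₀ hN']
      calc _ ≤ N * discreteEnergy g N x := by rw [mul_comm]; gcongr
        _ ≤ Λ N ^ 2 := hEx
        _ ≤ (L + 1) ^ 2 := by gcongr
    have h3 := (hmin (x k) (hxK k) (x (k + 1) - x k)).trans h2
    simp only [hη]
    rw [← div_div, div_right_comm, le_div_iff₀' ha]
    exact h3
  have hη00 : 0 ≤ η N := by simp only [hη]; positivity
  have hxd : ∀ k ≤ N, geodesicDist U g p (x k) ≤ ENNReal.ofReal ((1 + C₂ * η N) *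
      ∑ j ∈ Finset.range k, √(g (x j) (x (j + 1) - x j) (x (j + 1) - x j))) := by
    intro k
    induction k with
    | zero => intro _; rw [hx0, hz0, geodesicDist_self hg hp]; exact bot_le
    | succ k ih =>
      intro hk
      rw [Finset.sum_range_succ, mul_add, ENNReal.ofReal_add
        (mul_nonneg (by positivity) (Finset.sum_nonneg fun _ _ => Real.sqrt_nonneg _))
        (by positivity)]
      refine (geodesicDist_triangle hg (x := x k)).trans
        (add_le_add (ih (Nat.le_of_succ_le hk)) ?_)
      refine (hseg _ (hxK k) _ ((hstep k hk).trans hηN)).2.trans (ENNReal.ofReal_le_ofReal ?_)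
      gcongr
      exact hstep k hk
  have hxball : ∀ k ≤ N, x k ∈ geodesicBall U g p (L + 2) := fun k hk => by
    refine ⟨hKU (hxK k), (hxd k hk).trans_lt
      ((ENNReal.ofReal_lt_ofReal_iff (by linarith)).2 (lt_of_le_of_lt ?_ hηLN))⟩
    gcongr
    refine le_trans (Finset.sum_le_sum_of_subset_of_nonneg (Finset.range_mono hk)
      fun _ _ _ => Real.sqrt_nonneg _) hsum
  refine ⟨x, hx0.trans hz0, hxN.trans hzN, hxK, hEx, fun k hk => ?_⟩
  exact discrete_euler_lagrange hg hKU hxK (fun y h0 hyN hyK =>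
    hxmin y (h0.trans hx0) (hyN.trans hxN) hyK) hk
    (mem_of_superset (geodesicBall_mem_nhds hg (hxball (k + 1) hk.le)) hball)

/-- The momenta of discrete geodesics of bounded energy are bounded: by the Euler-Lagrange
equation their total variation is controlled by the energy. -/
theorem exists_bound_momentum (hg : IsRiemannianMetricOn U g) (hK : IsCompact K) (hKU : K ⊆ U)
    {M : ℝ} (hM : 0 ≤ M) : ∃ B : ℝ, ∀ (N : ℕ) (x : ℕ → V), (∀ k, x k ∈ K) →
      N * discreteEnergy g N x ≤ M ^ 2 → (∀ k, k + 1 < N →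
          metricForm g (x k) (x (k + 1) - x k) +
            energyGradient g (x (k + 1)) (x (k + 2) - x (k + 1)) =
          metricForm g (x (k + 1)) (x (k + 2) - x (k + 1))) →
      ∀ k < N, ‖(N : ℝ) • metricForm g (x k) (x (k + 1) - x k)‖ ≤ B := by
  obtain ⟨a, ha, hmin⟩ := exists_mul_norm_le_sqrt hg hK hKU
  obtain ⟨A, hA, hAle⟩ := exists_sqrt_le_mul_norm hg hK hKU
  obtain ⟨D, hD⟩ := hK.exists_bound_of_continuousOn
    (((contDiffOn_metricForm hg).continuousOn_fderiv_of_isOpen hg.isOpen (by simp)).mono hKU)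
  set C : ℝ := |D| / a ^ 2 with hC
  have hC0 : 0 ≤ C := by positivity
  have hgrad : ∀ c ∈ K, ∀ v, ‖energyGradient g c v‖ ≤ C * g c v v := by
    intro c hc v
    have h2 : a ^ 2 * ‖v‖ ^ 2 ≤ g c v v := by
      rw [← mul_pow, ← Real.sq_sqrt (hg.nonneg (hKU hc) v)]
      exact pow_le_pow_left₀ (by positivity) (hmin c hc v) 2
    have h3 : ‖energyGradient g c v‖ ≤ |D| * ‖v‖ ^ 2 := by
      refine ContinuousLinearMap.opNorm_le_bound _ (by positivity) fun w => ?_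
      rw [energyGradient_apply, norm_mul]
      have h4 : ‖fderiv ℝ (metricForm g) c w v v‖ ≤ |D| * ‖w‖ * ‖v‖ * ‖v‖ := by
        refine (ContinuousLinearMap.le_opNorm₂ _ v v).trans ?_
        gcongr
        refine (ContinuousLinearMap.le_opNorm _ w).trans ?_
        gcongr
        exact (hD c hc).trans (le_abs_self D)
      calc ‖(1 / 2 : ℝ)‖ * ‖fderiv ℝ (metricForm g) c w v v‖
          ≤ 1 * (|D| * ‖w‖ * ‖v‖ * ‖v‖) := by
            gcongr; norm_num
        _ = |D| * ‖v‖ ^ 2 * ‖w‖ := by ring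
    refine h3.trans ?_
    calc |D| * ‖v‖ ^ 2 = C * (a ^ 2 * ‖v‖ ^ 2) := by rw [hC]; field_simp
      _ ≤ C * g c v v := by gcongr
  have hflat : ∀ c ∈ K, ∀ v, ‖metricForm g c v‖ ≤ A * √(g c v v) := by
    intro c hc v
    refine ContinuousLinearMap.opNorm_le_bound _ (by positivity) fun w => ?_
    rw [metricForm_apply hg (hKU hc)]
    refine (hg.abs_le_sqrt_mul_sqrt (hKU hc) v w).trans ?_
    calc √(g c v v) * √(g c w w) ≤ √(g c v v) * (A * ‖w‖) := by gcongr; exact hAle c hc w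
      _ = _ := by ring
  refine ⟨A * M + 2 * (C * M ^ 2), fun N x hx hE hEL k hk => ?_⟩
  have hN' : (0 : ℝ) < N := by exact_mod_cast (Nat.zero_le k).trans_lt hk
  set e : ℕ → ℝ := fun k => g (x k) (x (k + 1) - x k) (x (k + 1) - x k) with he
  set P : ℕ → (V →L[ℝ] ℝ) := fun k => (N : ℝ) • metricForm g (x k) (x (k + 1) - x k) with hP
  have he0 : ∀ k, 0 ≤ e k := fun k => hg.nonneg (hKU (hx k)) _
  have hE' : ∑ k ∈ Finset.range N, N * e k ≤ M ^ 2 := by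
    rw [← Finset.mul_sum]; exact hE
  have hvar : ∀ j < N, ‖P j - P 0‖ ≤ C * M ^ 2 := by
    intro j hj
    have h1 := dist_le_range_sum_dist P j
    rw [dist_comm, dist_eq_norm] at h1
    refine h1.trans ?_
    have h2 : ∀ i ∈ Finset.range j, dist (P i) (P (i + 1)) ≤ C * (N * e (i + 1)) := by
      intro i hi
      have hi' : i + 1 < N := by have := Finset.mem_range.1 hi; omega
      rw [dist_comm, dist_eq_norm]
      have : P (i + 1) - P i =
          (N : ℝ) • energyGradient g (x (i + 1)) (x (i + 2) - x (i + 1)) := by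
        simp only [hP]
        rw [← smul_sub, ← hEL i hi', add_sub_cancel_left]
      rw [this, norm_smul, Real.norm_of_nonneg hN'.le]
      calc N * ‖energyGradient g (x (i + 1)) (x (i + 2) - x (i + 1))‖
          ≤ N * (C * e (i + 1)) := by gcongr; exact hgrad _ (hx _) _
        _ = _ := by ring
    refine (Finset.sum_le_sum h2).trans ?_
    rw [← Finset.mul_sum]
    gcongr
    refine le_trans ?_ hE'
    refine le_trans ?_ (Finset.sum_le_sum_of_subset_of_nonneg (Finset.range_mono hj)
      fun i _ _ => mul_nonneg hN'.le (he0 i))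
    rw [Finset.sum_range_succ' _ j]
    have := he0 0
    nlinarith
  obtain ⟨k₀, hk₀, hek₀⟩ := Finset.exists_le_of_sum_le (s := Finset.range N)
    (f := fun k => N * e k) (g := fun _ => M ^ 2 / N) ⟨k, Finset.mem_range.2 hk⟩ (by
      refine hE'.trans (le_of_eq ?_)
      simp; field_simp)
  have hk₀ := Finset.mem_range.1 hk₀
  have hPk₀ : ‖P k₀‖ ≤ A * M := by
    simp only [hP]
    rw [norm_smul, Real.norm_of_nonneg hN'.le]
    have h1 : √(e k₀) ≤ M / N := by
      rw [Real.sqrt_le_left (by positivity), div_pow, le_div_iff₀ (by positivity)]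
      rw [le_div_iff₀ hN'] at hek₀
      linarith
    calc N * ‖metricForm g (x k₀) (x (k₀ + 1) - x k₀)‖ ≤ N * (A * √(e k₀)) := by
          gcongr; exact hflat _ (hx _) _
      _ ≤ N * (A * (M / N)) := by gcongr
      _ = A * M := by field_simp
  have h1 := hvar k hk
  have h2 := hvar k₀ hk₀
  calc ‖P k‖ = ‖P k₀ + (P k - P 0) - (P k₀ - P 0)‖ := by congr 1; abel
    _ ≤ ‖P k₀‖ + ‖P k - P 0‖ + ‖P k₀ - P 0‖ :=
      (norm_sub_le _ _).trans (add_le_add (norm_add_le _ _) le_rfl)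
    _ ≤ A * M + 2 * (C * M ^ 2) := by linarith

end DiscreteGeodesics

/-! ### The symplectic Euler scheme -/

section Euler

variable {E F : Type*} [NormedAddCommGroup E] [NormedSpace ℝ E] [NormedAddCommGroup F]
  [NormedSpace ℝ F]

/-- One step of the symplectic Euler scheme, in which the first component of the field is evaluated
at the old and the second at the new point, has a local error of second order. -/
theorem symplectic_euler_step {f : E × F → E × F} {C M h t : ℝ} (hC : 0 ≤ C)
    (hM : ∀ y, ‖f y‖ ≤ M) (hlip : ∀ y z, ‖f y - f z‖ ≤ C * ‖y - z‖) (hh : 0 ≤ h) {Y : ℝ → E × F}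
    (hY : ∀ s ∈ Icc t (t + h), HasDerivAt Y (f (Y s)) s) {y y' : E × F}
    (hy : y' = y + h • ((f y).1, (f y').2)) :
    ‖y' - Y (t + h)‖ ≤ (1 + h * C) * ‖y - Y t‖ + 2 * C * M * h ^ 2 := by
  have hM0 : 0 ≤ M := (norm_nonneg _).trans (hM 0)
  have ht : t ∈ Icc t (t + h) := ⟨le_rfl, by linarith⟩
  have ht' : t + h ∈ Icc t (t + h) := ⟨by linarith, le_rfl⟩
  have hyy : ‖y' - y‖ ≤ h * M := by
    rw [hy, add_sub_cancel_left, norm_smul, Real.norm_of_nonneg hh]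
    gcongr
    exact max_le ((norm_fst_le (f y)).trans (hM _)) ((norm_snd_le (f y')).trans (hM _))
  have hYs : ∀ s ∈ Icc t (t + h), ‖Y s - Y t‖ ≤ M * h := fun s hs => by
    have := (convex_Icc t (t + h)).norm_image_sub_le_of_norm_hasDerivWithin_le
      (fun r hr => (hY r hr).hasDerivWithinAt) (fun r _ => hM _) ht hs
    refine this.trans ?_
    gcongr
    rw [Real.norm_of_nonneg (sub_nonneg.2 hs.1)]
    linarith [hs.2]
  have hstep : ‖Y (t + h) - Y t - h • f (Y t)‖ ≤ C * M * h ^ 2 := by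
    have hd : ∀ r ∈ Icc t (t + h), HasDerivWithinAt (fun r => Y r - r • f (Y t))
        (f (Y r) - f (Y t)) (Icc t (t + h)) r := fun r hr => by
      have := (hY r hr).sub ((hasDerivAt_id r).smul_const (f (Y t)))
      rw [one_smul] at this
      exact this.hasDerivWithinAt
    have := (convex_Icc t (t + h)).norm_image_sub_le_of_norm_hasDerivWithin_le
      (C := C * (M * h)) hd (fun r hr => (hlip _ _).trans (by gcongr; exact hYs r hr)) ht ht'
    rw [add_sub_cancel_left, Real.norm_of_nonneg hh] at this
    calc ‖Y (t + h) - Y t - h • f (Y t)‖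
        = ‖Y (t + h) - (t + h) • f (Y t) - (Y t - t • f (Y t))‖ := by
          congr 1; rw [add_smul]; abel
      _ ≤ C * (M * h) * h := this
      _ = C * M * h ^ 2 := by ring
  have hr : ‖((f y).1, (f y').2) - f y‖ ≤ C * (h * M) := by
    have : ((f y).1, (f y').2) - f y = (0, (f y' - f y).2) := by
      ext <;> simp
    rw [this]
    refine max_le (by simpa using by positivity) ((norm_snd_le (f y' - f y)).trans ((hlip _ _).trans ?_))
    gcongr
  have hdecomp : y' - Y (t + h) = (y - Y t) + h • (f y - f (Y t)) +
      h • (((f y).1, (f y').2) - f y) - (Y (t + h) - Y t - h • f (Y t)) := by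
    conv_lhs => rw [hy]
    module
  rw [hdecomp]
  refine (norm_sub_le _ _).trans ((add_le_add ((norm_add_le _ _).trans
    (add_le_add (norm_add_le _ _) le_rfl)) hstep).trans ?_)
  rw [norm_smul, norm_smul, Real.norm_of_nonneg hh]
  have h1 : h * ‖f y - f (Y t)‖ ≤ h * (C * ‖y - Y t‖) := by gcongr; exact hlip _ _
  have h2 : h * ‖((f y).1, (f y').2) - f y‖ ≤ h * (C * (h * M)) := by gcongr
  linarith

/-- The symplectic Euler scheme with `N` steps on the unit interval converges of first order. -/
theorem symplectic_euler_error {f : E × F → E × F} {C M : ℝ} (hC : 0 ≤ C)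
    (hM : ∀ y, ‖f y‖ ≤ M) (hlip : ∀ y z, ‖f y - f z‖ ≤ C * ‖y - z‖) {Y : ℝ → E × F}
    (hY : ∀ s ∈ Icc (0 : ℝ) 1, HasDerivAt Y (f (Y s)) s) {N : ℕ} {y : ℕ → E × F}
    (hy : ∀ k, k + 1 < N → y (k + 1) = y k + (1 / N : ℝ) • ((f (y k)).1, (f (y (k + 1))).2))
    {k : ℕ} (hk : k < N) :
    ‖y k - Y (k / N)‖ ≤ Real.exp C * (‖y 0 - Y 0‖ + 2 * C * M / N) := by
  have hM0 : 0 ≤ M := (norm_nonneg _).trans (hM 0)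
  have hN' : (0 : ℝ) < N := by exact_mod_cast (Nat.zero_le k).trans_lt hk
  have hind : ∀ k < N, ‖y k - Y (k / N)‖ ≤
      (1 + 1 / N * C) ^ k * (‖y 0 - Y 0‖ + k * (2 * C * M * (1 / N) ^ 2)) := by
    intro k
    induction k with
    | zero => simp
    | succ k ih =>
      intro hk
      have hk' : ((k : ℝ) + 1) ≤ N := by exact_mod_cast hk.le
      have heq : (k : ℝ) / N + 1 / N = ((k + 1 : ℕ) : ℝ) / N := by push_cast; ring
      have := symplectic_euler_step (t := k / N) (h := 1 / N) hC hM hlip (by positivity)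
        (fun s hs => hY s ⟨le_trans (by positivity) hs.1, hs.2.trans (by
          rw [← add_div, div_le_one hN']; exact hk')⟩) (hy k hk)
      rw [heq] at this
      refine this.trans ?_
      have h1 : (1 : ℝ) ≤ (1 + 1 / N * C) ^ (k + 1) := one_le_pow₀ (by
        have : 0 ≤ 1 / (N : ℝ) * C := by positivity
        linarith)
      have h2 := mul_le_mul_of_nonneg_left (ih (by omega))
        (by positivity : (0 : ℝ) ≤ 1 + 1 / N * C)
      have h3 : (0 : ℝ) ≤ 2 * C * M * (1 / N) ^ 2 := by positivity
      have h4 := mul_le_mul_of_nonneg_right h1 h3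
      push_cast
      linear_combination h2 + h4
  refine (hind k hk).trans ?_
  have hkN : (k : ℝ) ≤ N := by exact_mod_cast hk.le
  gcongr
  · calc (1 + 1 / N * C) ^ k ≤ Real.exp (1 / N * C) ^ k := by
          gcongr
          rw [add_comm]; exact Real.add_one_le_exp _
      _ = Real.exp (k * (1 / N * C)) := by rw [← Real.exp_nat_mul]
      _ ≤ Real.exp C := by
        gcongr
        calc (k : ℝ) * (1 / N * C) ≤ N * (1 / N * C) := by gcongr
          _ = C := by field_simp
  · calc (k : ℝ) * (2 * C * M * (1 / N) ^ 2) ≤ N * (2 * C * M * (1 / N) ^ 2) := by gcongr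
      _ = 2 * C * M / N := by field_simp

end Euler

/-! ### Minimizing geodesics as limits of discrete geodesics -/

section Convergence

variable {V : Type*} [NormedAddCommGroup V] [NormedSpace ℝ V] [FiniteDimensional ℝ V]
  {U K : Set V} {g : V → V → V → ℝ} {p q : V}

/-- The limit of discrete geodesics is a Hamiltonian curve with the same end points whose energy
is at most the square of their distance. -/
theorem exists_minimizing_hamiltonian (hg : IsRiemannianMetricOn U g)
    (hH : HasRelativelyCompactBalls U g) (hp : p ∈ U) (hfin : geodesicDist U g p q ≠ ⊤) :
    ∃ Y : ℝ → V × (V →L[ℝ] ℝ), IsHamiltonianOn U g Y univ ∧ (Y 0).1 = p ∧ (Y 1).1 = q ∧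
      (Y 0).2 (sharp g (Y 0).1 (Y 0).2) ≤ (geodesicDist U g p q).toReal ^ 2 := by
  obtain ⟨K, hKU, hK, Λ, hΛ, hev⟩ := exists_discrete_geodesics hg hH hp hfin
  set L := (geodesicDist U g p q).toReal with hL
  have hL0 : 0 ≤ L := ENNReal.toReal_nonneg
  obtain ⟨B, hB⟩ := exists_bound_momentum hg hK hKU (by positivity : 0 ≤ L + 1)
  have hev' := (hev.and (eventually_gt_atTop 0)).and
    ((hΛ.eventually_lt_const (by linarith : L < L + 1)).and
      (hΛ.eventually_const_lt (by linarith : L - (2 * L + 1) < L)))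
  obtain ⟨N₀, hN₀⟩ := eventually_atTop.1 hev'
  have hx : ∀ j : ℕ, ∃ x : ℕ → V, x 0 = p ∧ x (N₀ + j) = q ∧ (∀ k, x k ∈ K) ∧
      (N₀ + j : ℕ) * discreteEnergy g (N₀ + j) x ≤ Λ (N₀ + j) ^ 2 ∧ ∀ k, k + 1 < N₀ + j →
          metricForm g (x k) (x (k + 1) - x k) +
            energyGradient g (x (k + 1)) (x (k + 2) - x (k + 1)) =
          metricForm g (x (k + 1)) (x (k + 2) - x (k + 1)) := fun j =>
    (hN₀ (N₀ + j) (Nat.le_add_right _ _)).1.1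
  choose x hx0 hxN hxK hxE hxEL using hx
  have hNpos : ∀ j, 0 < N₀ + j := fun j => (hN₀ (N₀ + j) (Nat.le_add_right _ _)).1.2
  have hNpos' : ∀ j, (0 : ℝ) < (N₀ + j : ℕ) := fun j => by exact_mod_cast hNpos j
  -- the discrete trajectories in phase space
  set y : ℕ → ℕ → V × (V →L[ℝ] ℝ) := fun j k =>
    (x j k, ((N₀ + j : ℕ) : ℝ) • metricForm g (x j k) (x j (k + 1) - x j k)) with hy
  have hyB : ∀ j, ∀ k < N₀ + j, ‖(y j k).2‖ ≤ B := fun j k hk =>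
    hB (N₀ + j) (x j) (hxK j) ((hxE j).trans (by
      have := (hN₀ (N₀ + j) (Nat.le_add_right _ _)).2
      exact sq_le_sq' (by linarith [this.2]) this.1.le)) (hxEL j) k hk
  have hB0 : 0 ≤ B := (norm_nonneg _).trans (hyB 0 0 (hNpos 0))
  have : ProperSpace (V →L[ℝ] ℝ) := FiniteDimensional.proper ℝ _
  obtain ⟨P, -, φ, hφ, hlimP⟩ := (isCompact_closedBall (0 : V →L[ℝ] ℝ) B).tendsto_subseq
    (x := fun j => (y j 0).2) fun j => mem_closedBall_zero_iff.2 (hyB j 0 (hNpos j))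
  obtain ⟨Y, hY0, hY⟩ := exists_isHamiltonianOn_univ hg hH hp P
  have hYc : Continuous Y := continuous_iff_continuousAt.2 fun t =>
    (hY t (mem_univ t)).2.continuousAt
  -- cut off the Hamiltonian field outside a compact set that contains all these curves
  set S : Set (V × (V →L[ℝ] ℝ)) := K ×ˢ Metric.closedBall 0 B ∪ Y '' Icc 0 1 with hS
  have hSc : IsCompact S := (hK.prod (isCompact_closedBall _ _)).union (isCompact_Icc.image hYc)
  have hSU : S ⊆ U ×ˢ univ := by
    rintro z (hz | ⟨t, -, rfl⟩)
    exacts [⟨hKU hz.1, mem_univ _⟩, (hY t (mem_univ t)).1]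
  obtain ⟨f, hf, hfc, O, -, hSO, -, hfO⟩ := exists_contDiff_hasCompactSupport_eqOn
    (hg.isOpen.prod isOpen_univ) (contDiffOn_hamiltonianField hg) hSc hSU
  have hfS : ∀ z ∈ S, f z = hamiltonianField g z := fun z hz => hfO (hSO hz)
  obtain ⟨C, hC⟩ := hf.lipschitzWith_of_hasCompactSupport hfc (by simp)
  obtain ⟨M, hM⟩ := hfc.exists_bound_of_continuous hf.continuous
  have hM0 : 0 ≤ M := (norm_nonneg _).trans (hM 0)
  have hlip : ∀ z w, ‖f z - f w‖ ≤ C * ‖z - w‖ := fun z w => by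
    simpa [dist_eq_norm] using hC.dist_le_mul z w
  have hyS : ∀ j, ∀ k < N₀ + j, y j k ∈ S := fun j k hk =>
    .inl ⟨hxK j k, mem_closedBall_zero_iff.2 (hyB j k hk)⟩
  have hYS : ∀ t ∈ Icc (0 : ℝ) 1, Y t ∈ S := fun t ht => .inr (mem_image_of_mem Y ht)
  have hYf : ∀ t ∈ Icc (0 : ℝ) 1, HasDerivAt Y (f (Y t)) t := fun t ht => by
    rw [hfS _ (hYS t ht)]; exact (hY t (mem_univ t)).2
  have hfst : ∀ j, ∀ k < N₀ + j, x j (k + 1) - x j k = (1 / (N₀ + j : ℕ) : ℝ) • (f (y j k)).1 := by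
    intro j k hk
    rw [hfS _ (hyS j k hk)]
    simp only [hamiltonianField, hy]
    rw [map_smul, sharp_metricForm hg (hKU (hxK j k)), smul_smul, one_div,
      inv_mul_cancel₀ (hNpos' j).ne', one_smul]
  -- the discrete Euler-Lagrange equation is the symplectic Euler scheme for Hamilton's equations
  have hEuler : ∀ j k, k + 1 < N₀ + j → y j (k + 1) =
      y j k + (1 / (N₀ + j : ℕ) : ℝ) • ((f (y j k)).1, (f (y j (k + 1))).2) := by
    intro j k hk
    ext1
    · change x j (k + 1) = x j k + (1 / (N₀ + j : ℕ) : ℝ) • (f (y j k)).1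
      rw [← hfst j k (by omega)]; abel
    · rw [hfS _ (hyS j (k + 1) hk)]
      simp only [Prod.snd_add, Prod.smul_snd, hamiltonianField, hy]
      rw [map_smul, sharp_metricForm hg (hKU (hxK j _)), ← hxEL j k hk, smul_add]
      congr 1
      ext w
      simp only [smul_apply, energyGradient_apply, map_smul, smul_eq_mul]
      have := (hNpos' j).ne'
      field_simp
  -- the trajectories converge along the subsequence
  set ε : ℕ → ℝ := fun j => Real.exp C * (‖y j 0 - Y 0‖ + 2 * C * M / (N₀ + j : ℕ)) with hε
  have herr : ∀ j, ∀ k < N₀ + j, ‖y j k - Y (k / (N₀ + j : ℕ))‖ ≤ ε j := fun j k hk =>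
    symplectic_euler_error C.2 hM hlip hYf (hEuler j) hk
  have hNlim : Tendsto (fun j => ((N₀ + φ j : ℕ) : ℝ)) atTop atTop :=
    tendsto_natCast_atTop_atTop.comp (tendsto_atTop_mono (fun j => Nat.le_add_left _ _)
      hφ.tendsto_atTop)
  have hεlim : Tendsto (fun j => ε (φ j)) atTop (𝓝 0) := by
    have h1 : Tendsto (fun j => ‖y (φ j) 0 - Y 0‖) atTop (𝓝 0) := by
      have : ∀ j, y (φ j) 0 - Y 0 = (0, (y (φ j) 0).2 - P) := fun j => by
        rw [hY0]; ext1 <;> simp [hy, hx0]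
      simp only [this]
      have h2 : Tendsto (fun j => ((0 : V), (y (φ j) 0).2 - P)) atTop (𝓝 (0, P - P)) :=
        tendsto_const_nhds.prodMk_nhds (hlimP.sub_const P)
      simpa using h2.norm
    have h2 : Tendsto (fun j => 2 * C * M / (N₀ + φ j : ℕ)) atTop (𝓝 0) :=
      Tendsto.const_div_atTop hNlim _
    simpa [hε] using (h1.add h2).const_mul (Real.exp C)
  refine ⟨Y, hY, by rw [hY0], ?_, ?_⟩
  · -- the last but one point of the discrete curve is close to `q` and to the limit curve
    have htime : Tendsto (fun j => ((N₀ + φ j - 1 : ℕ) : ℝ) / (N₀ + φ j : ℕ)) atTop (𝓝 1) := by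
      have h1 : ∀ j, ((N₀ + φ j - 1 : ℕ) : ℝ) / (N₀ + φ j : ℕ) = 1 - 1 / (N₀ + φ j : ℕ) := fun j => by
        rw [Nat.cast_sub (hNpos _), Nat.cast_one, sub_div, div_self (hNpos' _).ne']
      simp only [h1]
      simpa using (Tendsto.const_div_atTop hNlim 1).const_sub 1
    have h1 : Tendsto (fun j => (Y (((N₀ + φ j - 1 : ℕ) : ℝ) / (N₀ + φ j : ℕ))).1) atTop
        (𝓝 (Y 1).1) := ((continuous_fst.comp hYc).tendsto 1).comp htime
    refine tendsto_nhds_unique h1 (tendsto_iff_norm_sub_tendsto_zero.2 ?_)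
    have h2 : Tendsto (fun j => ε (φ j) + M / (N₀ + φ j : ℕ)) atTop (𝓝 0) := by
      simpa using hεlim.add (Tendsto.const_div_atTop hNlim M)
    refine squeeze_zero (fun _ => norm_nonneg _) (fun j => ?_) h2
    have hlt : N₀ + φ j - 1 < N₀ + φ j := Nat.sub_lt (hNpos _) one_pos
    have h3 : ‖x (φ j) (N₀ + φ j - 1) - (Y (((N₀ + φ j - 1 : ℕ) : ℝ) / (N₀ + φ j : ℕ))).1‖ ≤
        ε (φ j) := (norm_fst_le (y (φ j) _ - Y _)).trans (herr (φ j) _ hlt)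
    have h4 := hfst (φ j) _ hlt
    rw [Nat.sub_add_cancel (hNpos (φ j)), hxN] at h4
    have h5 : ‖q - x (φ j) (N₀ + φ j - 1)‖ ≤ M / (N₀ + φ j : ℕ) := by
      rw [h4, norm_smul, Real.norm_of_nonneg (by positivity), one_div, inv_mul_eq_div]
      gcongr
      exact (norm_fst_le _).trans (hM _)
    rw [norm_sub_rev] at h3 ⊢
    calc ‖q - (Y (((N₀ + φ j - 1 : ℕ) : ℝ) / (N₀ + φ j : ℕ))).1‖
        = ‖(q - x (φ j) (N₀ + φ j - 1)) -
          ((Y (((N₀ + φ j - 1 : ℕ) : ℝ) / (N₀ + φ j : ℕ))).1 - x (φ j) (N₀ + φ j - 1))‖ := by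
          congr 1; abel
      _ ≤ M / (N₀ + φ j : ℕ) + ε (φ j) := (norm_sub_le _ _).trans (add_le_add h5 h3)
      _ = _ := add_comm _ _
  · -- the energy of the discrete curves, an average over time, converges to that of the limit
    set e := (Y 0).2 (sharp g (Y 0).1 (Y 0).2) with he
    obtain ⟨D, hD⟩ := hSc.isBounded.exists_norm_le
    have hYe : ∀ t ∈ Icc (0 : ℝ) 1, (Y t).2 (f (Y t)).1 = e := fun t ht => by
      rw [hfS _ (hYS t ht)]
      have hY' : IsHamiltonianOn U g Y (Ioo (-1) 2) := fun s _ => hY s (mem_univ s)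
      exact hY'.energy_eq hg ⟨by linarith [ht.1], by linarith [ht.2]⟩ ⟨by norm_num, by norm_num⟩
    have hlow : ∀ j, e - (D * C + M) * ε j ≤ Λ (N₀ + j) ^ 2 := by
      intro j
      refine le_trans ?_ (hxE j)
      rw [discreteEnergy, Finset.mul_sum]
      have hterm : ∀ k ∈ Finset.range (N₀ + j), (e - (D * C + M) * ε j) / (N₀ + j : ℕ) ≤
          (N₀ + j : ℕ) * g (x j k) (x j (k + 1) - x j k) (x j (k + 1) - x j k) := by
        intro k hk
        have hk := Finset.mem_range.1 hk
        have ht : (k : ℝ) / (N₀ + j : ℕ) ∈ Icc (0 : ℝ) 1 := by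
          refine ⟨by positivity, (div_le_one (hNpos' j)).2 ?_⟩
          exact_mod_cast hk.le
        set z := Y (k / (N₀ + j : ℕ)) with hz
        have hval : (N₀ + j : ℕ) * g (x j k) (x j (k + 1) - x j k) (x j (k + 1) - x j k) =
            (y j k).2 (f (y j k)).1 / (N₀ + j : ℕ) := by
          rw [← metricForm_apply hg (hKU (hxK j k))]
          have : (y j k).2 (f (y j k)).1 / (N₀ + j : ℕ) =
              (y j k).2 ((1 / (N₀ + j : ℕ) : ℝ) • (f (y j k)).1) := by
            rw [map_smul, smul_eq_mul]; ring
          rw [this, ← hfst j k hk]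
          rfl
        rw [hval]
        gcongr
        have h1 : z.2 (f z).1 - (y j k).2 (f (y j k)).1 =
            z.2 ((f z).1 - (f (y j k)).1) + (z.2 - (y j k).2) (f (y j k)).1 := by
          simp [map_sub]
        have herr' := herr j k hk
        rw [norm_sub_rev, ← hz] at herr'
        have hε0 : 0 ≤ ε j := (norm_nonneg _).trans herr'
        have h2 : ‖z.2 ((f z).1 - (f (y j k)).1)‖ ≤ D * (C * ε j) := by
          refine (z.2.le_opNorm _).trans (mul_le_mul ((norm_snd_le z).trans (hD _ (hYS _ ht)))
            ?_ (norm_nonneg _) ((norm_nonneg _).trans (hD _ (hYS _ ht))))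
          refine (norm_fst_le (f z - f (y j k))).trans ((hlip _ _).trans ?_)
          gcongr
        have h3 : ‖(z.2 - (y j k).2) (f (y j k)).1‖ ≤ ε j * M := by
          refine (ContinuousLinearMap.le_opNorm _ _).trans (mul_le_mul ?_
            ((norm_fst_le _).trans (hM _)) (norm_nonneg _) hε0)
          exact (norm_snd_le (z - y j k)).trans herr'
        have h4 := (le_abs_self _).trans (norm_add_le (z.2 ((f z).1 - (f (y j k)).1))
          ((z.2 - (y j k).2) (f (y j k)).1))
        rw [← h1, hYe _ ht] at h4
        linarith
      refine le_trans (le_of_eq ?_) (Finset.sum_le_sum hterm)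
      have := (hNpos' j).ne'
      simp only [Finset.sum_const, Finset.card_range, nsmul_eq_mul]
      field_simp
    have hl1 : Tendsto (fun j => e - (D * C + M) * ε (φ j)) atTop (𝓝 e) := by
      simpa using (hεlim.const_mul (D * C + M)).const_sub e
    have hl2 : Tendsto (fun j => Λ (N₀ + φ j) ^ 2) atTop (𝓝 (L ^ 2)) :=
      (hΛ.comp (tendsto_atTop_mono (fun j => Nat.le_add_left _ _) hφ.tendsto_atTop)).pow 2
    exact le_of_tendsto_of_tendsto' hl1 hl2 fun j => hlow (φ j)

/-- If balls are relatively compact, any two points at finite distance are joined by a minimizing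
geodesic: a Hamiltonian curve has constant speed, so that the bound on its energy bounds its
length. -/
theorem isGeodesicallyConvex_of_compact_balls (hg : IsRiemannianMetricOn U g)
    (hH : HasRelativelyCompactBalls U g)
    (hfin : ∀ p ∈ U, ∀ q ∈ U, geodesicDist U g p q ≠ ⊤) : IsGeodesicallyConvex U g := by
  intro p hp q hq
  obtain ⟨Y, hY, h0, h1, hE⟩ := exists_minimizing_hamiltonian hg hH hp (hfin p hp q hq)
  have hgeo := hY.isGeodesic hg
  refine ⟨fun t => (Y t).1, hgeo, h0, h1, le_antisymm ?_ (iInf₂_le _ ?_)⟩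
  · have hY' : IsHamiltonianOn U g Y (Ioo (-1) 2) := fun s _ => hY s (mem_univ s)
    rw [pathLength_eq_arcLength, hY'.arcLength_eq hg (r := 0) (by norm_num) (by norm_num)
      (by norm_num), sub_zero, mul_one, ← ENNReal.ofReal_toReal (hfin p hp q hq)]
    exact ENNReal.ofReal_le_ofReal ((Real.sqrt_le_left ENNReal.toReal_nonneg).2 hE)
  · exact isPiecewiseSmoothPath_iff.2 ⟨h0, h1, fun t _ => hgeo.2.1 t,
      .single zero_le_one hgeo.1.contDiffOn⟩

end Convergence

/-! ### Sums over the vertices of a polygon -/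

section Cyclic

variable {n : ℕ} [NeZero n] {E : Type*}

theorem sum_add_one [AddCommMonoid E] (F : ZMod n → E) : ∑ i, F (i + 1) = ∑ i, F i :=
  Equiv.sum_comp (Equiv.addRight (1 : ZMod n)) F

theorem sum_sub_one [AddCommMonoid E] (F : ZMod n → E) : ∑ i, F (i - 1) = ∑ i, F i :=
  Equiv.sum_comp (Equiv.subRight (1 : ZMod n)) F

theorem sum_range_add_natCast [AddCommMonoid E] (F : ZMod n → E) (i : ZMod n) :
    ∑ t ∈ Finset.range n, F (i + t) = ∑ j, F j := by
  rw [← Equiv.sum_comp (Equiv.addLeft i) F]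
  refine Finset.sum_nbij' (fun t => (t : ZMod n)) ZMod.val (fun _ _ => Finset.mem_univ _)
    (fun j _ => Finset.mem_range.2 (ZMod.val_lt j))
    (fun t ht => ZMod.val_natCast_of_lt (Finset.mem_range.1 ht))
    (fun j _ => ZMod.natCast_zmod_val j) fun t _ => rfl

variable [NormedAddCommGroup E]

/-- Two values of a function on a cycle differ by at most half of its total variation, since one
may go either way round. -/
theorem norm_sub_le_half_variation (f : ZMod n → E) (i j : ZMod n) :
    ‖f j - f i‖ ≤ (∑ k, ‖f (k + 1) - f k‖) / 2 := by
  obtain ⟨k, hk, rfl⟩ : ∃ k : ℕ, k < n ∧ j = i + k :=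
    ⟨(j - i).val, ZMod.val_lt _, by rw [ZMod.natCast_zmod_val]; abel⟩
  set F : ℕ → E := fun t => f (i + t) with hF
  have hsum : ∑ t ∈ Finset.range n, dist (F t) (F (t + 1)) = ∑ k, ‖f (k + 1) - f k‖ := by
    rw [← sum_range_add_natCast _ i]
    refine Finset.sum_congr rfl fun t _ => ?_
    rw [dist_comm, dist_eq_norm, hF]
    push_cast
    rw [add_assoc]
  have h1 := dist_le_Ico_sum_dist F (Nat.zero_le k)
  have h2 := dist_le_Ico_sum_dist F hk.le
  have h3 := Finset.sum_Ico_consecutive (fun t => dist (F t) (F (t + 1))) (Nat.zero_le k) hk.le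
  have hn : F n = F 0 := by simp [hF]
  rw [hn] at h2
  rw [Finset.range_eq_Ico] at hsum
  rw [dist_comm] at h1
  have h0 : dist (F k) (F 0) = ‖f (i + k) - f i‖ := by simp [hF, dist_eq_norm]
  rw [h0] at h1 h2
  linarith

variable [NormedSpace ℝ E]

/-- Wirtinger's inequality on a cycle, in its uniform form: a function of weighted mean zero is
bounded by its Dirichlet energy. -/
theorem norm_sq_le_of_sum_eq_zero {f : ZMod n → E} {w ν : ZMod n → ℝ} (hw : ∀ i, 0 < w i)
    (hν : ∀ i, 0 < ν i) (hwν : ∑ i, ν i = ∑ i, w i) (hf : ∑ i, w i • f i = 0) (i : ZMod n) :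
    ‖f i‖ ^ 2 ≤ (∑ i, w i) / 4 * ∑ i, ‖f (i + 1) - f i‖ ^ 2 / ν i := by
  set ℓ := ∑ i, w i with hℓ
  set S := ∑ k, ‖f (k + 1) - f k‖ with hS
  have hℓ0 : 0 < ℓ := Finset.sum_pos (fun i _ => hw i) ⟨i, Finset.mem_univ i⟩
  have hS0 : 0 ≤ S := Finset.sum_nonneg fun _ _ => norm_nonneg _
  have hCS : S ^ 2 ≤ (∑ i, ν i) * ∑ i, ‖f (i + 1) - f i‖ ^ 2 / ν i :=
    Finset.sum_sq_le_sum_mul_sum_of_sq_le_mul _ (fun i _ => (hν i).le)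
      (fun i _ => div_nonneg (sq_nonneg _) (hν i).le)
      fun i _ => by have := (hν i).ne'; field_simp; exact le_rfl
  have hmean : ℓ • f i = ∑ j, w j • (f i - f j) := by
    simp only [smul_sub, Finset.sum_sub_distrib, hf, sub_zero, ← Finset.sum_smul, hℓ]
  have hsup : ‖f i‖ ≤ S / 2 := by
    have : ‖ℓ • f i‖ ≤ ℓ * (S / 2) := by
      rw [hmean, hℓ, Finset.sum_mul]
      refine (norm_sum_le _ _).trans (Finset.sum_le_sum fun j _ => ?_)
      rw [norm_smul, Real.norm_of_nonneg (hw j).le]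
      exact mul_le_mul_of_nonneg_left (norm_sub_le_half_variation f j i) (hw j).le
    rw [norm_smul, Real.norm_of_nonneg hℓ0.le] at this
    exact le_of_mul_le_mul_left this hℓ0
  rw [hwν] at hCS
  calc ‖f i‖ ^ 2 ≤ (S / 2) ^ 2 := pow_le_pow_left₀ (norm_nonneg _) hsup 2
    _ = S ^ 2 / 4 := by ring
    _ ≤ (ℓ * ∑ i, ‖f (i + 1) - f i‖ ^ 2 / ν i) / 4 := by gcongr
    _ = _ := by ring

end Cyclic

/-! ### Discrete arc-length derivatives -/

section Derivatives

variable {n d : ℕ} {c : Polygon n d} {w₀ : Polygon n d → ZMod n → ℝ} {m : ℕ}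

theorem edgeLength_pos (hc : c ∈ regularCurves n d) (i : ZMod n) : 0 < edgeLength c i :=
  norm_pos_iff.2 (sub_ne_zero.2 (hc i).symm)

theorem vertexLength_pos (hc : c ∈ regularCurves n d) (i : ZMod n) : 0 < vertexLength c i :=
  half_pos (add_pos (edgeLength_pos hc i) (edgeLength_pos hc (i - 1)))

theorem edgeLength_div_two_le (hw : w₀ = vertexLength ∨ w₀ = edgeLength) (c : Polygon n d)
    (i : ZMod n) : edgeLength c i / 2 ≤ w₀ c i := by
  have h : ∀ j, 0 ≤ edgeLength c j := fun j => norm_nonneg _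
  rcases hw with rfl | rfl
  · rw [vertexLength]
    linarith [h (i - 1)]
  · linarith [h i]

theorem weight_pos (hw : w₀ = vertexLength ∨ w₀ = edgeLength) (hc : c ∈ regularCurves n d)
    (i : ZMod n) : 0 < weight w₀ m c i := by
  unfold weight
  split_ifs
  · exact (half_pos (edgeLength_pos hc i)).trans_le (edgeLength_div_two_le hw c i)
  · exact vertexLength_pos hc i
  · exact edgeLength_pos hc i

theorem weight_of_even (hm : m ≠ 0) (he : Even m) : weight w₀ m c = vertexLength c := by
  ext i; simp [weight, hm, he]

theorem weight_of_odd (hm : ¬Even m) : weight w₀ m c = edgeLength c := by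
  have : m ≠ 0 := by rintro rfl; exact hm Even.zero
  ext i; simp [weight, hm, this]

theorem discreteDeriv_succ_of_even (hm : Even m) (h : Polygon n d) (i : ZMod n) :
    discreteDeriv c h (m + 1) i =
      (edgeLength c i)⁻¹ • (discreteDeriv c h m (i + 1) - discreteDeriv c h m i) := by
  simp [discreteDeriv, hm]

theorem discreteDeriv_succ_of_odd (hm : ¬Even m) (h : Polygon n d) (i : ZMod n) :
    discreteDeriv c h (m + 1) i =
      (vertexLength c i)⁻¹ • (discreteDeriv c h m i - discreteDeriv c h m (i - 1)) := by
  simp [discreteDeriv, hm]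

theorem edgeLength_smul_discreteDeriv (hc : c ∈ regularCurves n d) (hm : Even m)
    (h : Polygon n d) (i : ZMod n) : edgeLength c i • discreteDeriv c h (m + 1) i =
      discreteDeriv c h m (i + 1) - discreteDeriv c h m i := by
  rw [discreteDeriv_succ_of_even hm, smul_inv_smul₀ (edgeLength_pos hc i).ne']

theorem vertexLength_smul_discreteDeriv (hc : c ∈ regularCurves n d) (hm : ¬Even m)
    (h : Polygon n d) (i : ZMod n) : vertexLength c i • discreteDeriv c h (m + 1) i =
      discreteDeriv c h m i - discreteDeriv c h m (i - 1) := by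
  rw [discreteDeriv_succ_of_odd hm, smul_inv_smul₀ (vertexLength_pos hc i).ne']

theorem discreteDeriv_add (c h k : Polygon n d) (m : ℕ) :
    discreteDeriv c (h + k) m = discreteDeriv c h m + discreteDeriv c k m := by
  induction m with
  | zero => rfl
  | succ m ih =>
    ext1 i
    by_cases hm : Even m
    · simp only [discreteDeriv_succ_of_even hm, ih, Pi.add_apply]
      rw [← smul_add]; congr 1; abel
    · simp only [discreteDeriv_succ_of_odd hm, ih, Pi.add_apply]
      rw [← smul_add]; congr 1; abel

theorem discreteDeriv_smul (c h : Polygon n d) (r : ℝ) (m : ℕ) :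
    discreteDeriv c (r • h) m = r • discreteDeriv c h m := by
  induction m with
  | zero => rfl
  | succ m ih =>
    ext1 i
    by_cases hm : Even m
    · simp only [discreteDeriv_succ_of_even hm, ih, Pi.smul_apply]
      rw [← smul_sub, smul_comm]
    · simp only [discreteDeriv_succ_of_odd hm, ih, Pi.smul_apply]
      rw [← smul_sub, smul_comm]

variable [NeZero n]

theorem curveLength_pos (hc : c ∈ regularCurves n d) : 0 < curveLength c :=
  Finset.sum_pos (fun i _ => edgeLength_pos hc i) ⟨0, Finset.mem_univ 0⟩

theorem sum_vertexLength (c : Polygon n d) : ∑ i, vertexLength c i = curveLength c := by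
  simp only [vertexLength, ← Finset.sum_div, Finset.sum_add_distrib]
  rw [sum_sub_one (edgeLength c), curveLength]
  ring

theorem sum_weight (hm : m ≠ 0) : ∑ i, weight w₀ m c i = curveLength c := by
  by_cases he : Even m
  · rw [weight_of_even hm he, sum_vertexLength]
  · rw [weight_of_odd he, curveLength]

theorem homMetric_self (m : ℕ) (c h : Polygon n d) :
    homMetric w₀ m c h h = ∑ i, ‖discreteDeriv c h m i‖ ^ 2 * weight w₀ m c i := by
  simp only [homMetric, real_inner_self_eq_norm_sq]

theorem homMetric_nonneg (hw : w₀ = vertexLength ∨ w₀ = edgeLength) (hc : c ∈ regularCurves n d)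
    (m : ℕ) (h : Polygon n d) : 0 ≤ homMetric w₀ m c h h := by
  rw [homMetric_self]
  exact Finset.sum_nonneg fun i _ => mul_nonneg (sq_nonneg _) (weight_pos hw hc i).le

/-- Derivatives have mean zero. -/
theorem sum_weight_smul_discreteDeriv (hc : c ∈ regularCurves n d) (hm : m ≠ 0)
    (h : Polygon n d) : ∑ i, weight w₀ m c i • discreteDeriv c h m i = 0 := by
  obtain ⟨j, rfl⟩ := Nat.exists_eq_succ_of_ne_zero hm
  by_cases hj : Even j
  · rw [weight_of_odd (by simpa [Nat.even_add_one] using hj)]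
    simp only [Nat.succ_eq_add_one, edgeLength_smul_discreteDeriv hc hj, Finset.sum_sub_distrib,
      sum_add_one (discreteDeriv c h j), sub_self]
  · rw [weight_of_even hm (by simpa [Nat.even_add_one] using hj)]
    simp only [Nat.succ_eq_add_one, vertexLength_smul_discreteDeriv hc hj,
      Finset.sum_sub_distrib, sum_sub_one (discreteDeriv c h j), sub_self]

/-- The uniform Wirtinger inequality for the derivatives of a deformation. -/
theorem norm_sq_discreteDeriv_le (hw : w₀ = vertexLength ∨ w₀ = edgeLength)
    (hc : c ∈ regularCurves n d) (hm : m ≠ 0) (h : Polygon n d) (i : ZMod n) :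
    ‖discreteDeriv c h m i‖ ^ 2 ≤ curveLength c / 4 * homMetric w₀ (m + 1) c h h := by
  by_cases he : Even m
  · have := norm_sq_le_of_sum_eq_zero (w := weight w₀ m c) (ν := edgeLength c)
      (fun i => weight_pos hw hc i) (edgeLength_pos hc)
      (by rw [sum_weight hm, curveLength]) (sum_weight_smul_discreteDeriv hc hm h) i
    rw [sum_weight hm] at this
    refine this.trans (le_of_eq ?_)
    rw [homMetric_self, weight_of_odd (by simpa [Nat.even_add_one] using he)]
    congr 1
    refine Finset.sum_congr rfl fun j _ => ?_
    have h0 := edgeLength_pos hc j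
    rw [discreteDeriv_succ_of_even he, norm_smul, norm_inv, Real.norm_of_nonneg h0.le]
    field_simp
  · have := norm_sq_le_of_sum_eq_zero (w := weight w₀ m c) (ν := fun i => vertexLength c (i + 1))
      (fun i => weight_pos hw hc i) (fun i => vertexLength_pos hc (i + 1))
      (by rw [sum_weight hm, sum_add_one (vertexLength c), sum_vertexLength])
      (sum_weight_smul_discreteDeriv hc hm h) i
    rw [sum_weight hm] at this
    refine this.trans (le_of_eq ?_)
    rw [homMetric_self, weight_of_even m.succ_ne_zero (by simpa [Nat.even_add_one] using he),
      ← sum_add_one fun i => ‖discreteDeriv c h (m + 1) i‖ ^ 2 * vertexLength c i]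
    congr 1
    refine Finset.sum_congr rfl fun j _ => ?_
    have h0 := vertexLength_pos hc (j + 1)
    rw [discreteDeriv_succ_of_odd he, norm_smul, norm_inv, Real.norm_of_nonneg h0.le,
      add_sub_cancel_right]
    field_simp

theorem homMetric_le_mul_homMetric_succ (hw : w₀ = vertexLength ∨ w₀ = edgeLength)
    (hc : c ∈ regularCurves n d) (hm : m ≠ 0) (h : Polygon n d) :
    homMetric w₀ m c h h ≤ curveLength c ^ 2 / 4 * homMetric w₀ (m + 1) c h h := by
  rw [homMetric_self]
  calc ∑ i, ‖discreteDeriv c h m i‖ ^ 2 * weight w₀ m c i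
      ≤ ∑ i, (curveLength c / 4 * homMetric w₀ (m + 1) c h h) * weight w₀ m c i :=
        Finset.sum_le_sum fun i _ => mul_le_mul_of_nonneg_right
          (norm_sq_discreteDeriv_le hw hc hm h i) (weight_pos hw hc i).le
    _ = _ := by rw [← Finset.mul_sum, sum_weight hm]; ring

theorem homMetric_le_pow_mul_homMetric (hw : w₀ = vertexLength ∨ w₀ = edgeLength)
    (hc : c ∈ regularCurves n d) (hm : m ≠ 0) (h : Polygon n d) (k : ℕ) :
    homMetric w₀ m c h h ≤ (curveLength c ^ 2 / 4) ^ k * homMetric w₀ (m + k) c h h := by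
  induction k with
  | zero => simp
  | succ k ih =>
    refine ih.trans ?_
    rw [pow_succ (curveLength c ^ 2 / 4) k, mul_assoc]
    gcongr
    exact homMetric_le_mul_homMetric_succ hw hc (by omega) h

/-- Summation by parts. -/
theorem homMetric_succ_eq (hc : c ∈ regularCurves n d) (m : ℕ) (h : Polygon n d) :
    homMetric w₀ (m + 1) c h h = -∑ i, inner ℝ (discreteDeriv c h (m + 2) i)
      (discreteDeriv c h m i) * weight w₀ (m + 2) c i := by
  set D := discreteDeriv c h with hD
  by_cases he : Even m
  · have he1 : ¬Even (m + 1) := by simpa [Nat.even_add_one] using he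
    have he2 : Even (m + 2) := by simpa [Nat.even_add_one] using he
    rw [homMetric, ← hD, weight_of_odd he1, weight_of_even (by omega) he2]
    have h1 : ∀ i, inner ℝ (D (m + 1) i) (D (m + 1) i) * edgeLength c i =
        inner ℝ (D (m + 1) i) (D m (i + 1)) - inner ℝ (D (m + 1) i) (D m i) := fun i => by
      rw [← inner_sub_right, ← edgeLength_smul_discreteDeriv hc he, real_inner_smul_right, mul_comm]
    have h2 : ∀ i, inner ℝ (D (m + 2) i) (D m i) * vertexLength c i =
        inner ℝ (D (m + 1) i) (D m i) - inner ℝ (D (m + 1) (i - 1)) (D m i) := fun i => by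
      rw [← inner_sub_left, ← vertexLength_smul_discreteDeriv hc he1, real_inner_smul_left, mul_comm]
    simp only [h1, h2, Finset.sum_sub_distrib]
    rw [← sum_add_one fun i => inner ℝ (D (m + 1) (i - 1)) (D m i)]
    simp only [add_sub_cancel_right]
    ring
  · have he1 : Even (m + 1) := by simpa [Nat.even_add_one] using he
    have he2 : ¬Even (m + 2) := by simpa [Nat.even_add_one] using he
    rw [homMetric, ← hD, weight_of_even m.succ_ne_zero he1, weight_of_odd he2]
    have h1 : ∀ i, inner ℝ (D (m + 1) i) (D (m + 1) i) * vertexLength c i =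
        inner ℝ (D (m + 1) i) (D m i) - inner ℝ (D (m + 1) i) (D m (i - 1)) := fun i => by
      rw [← inner_sub_right, ← vertexLength_smul_discreteDeriv hc he, real_inner_smul_right,
        mul_comm]
    have h2 : ∀ i, inner ℝ (D (m + 2) i) (D m i) * edgeLength c i =
        inner ℝ (D (m + 1) (i + 1)) (D m i) - inner ℝ (D (m + 1) i) (D m i) := fun i => by
      rw [← inner_sub_left, ← edgeLength_smul_discreteDeriv hc he1, real_inner_smul_left, mul_comm]
    simp only [h1, h2, Finset.sum_sub_distrib]
    rw [← sum_add_one fun i => inner ℝ (D (m + 1) i) (D m (i - 1))]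
    simp only [add_sub_cancel_right]
    ring

/-- Summation by parts and the Cauchy-Schwarz inequality. The weights in the last sum are those of
an order at least two, hence of total mass the length of the curve, even for `m = 0`. -/
theorem homMetric_succ_le (hw : w₀ = vertexLength ∨ w₀ = edgeLength)
    (hc : c ∈ regularCurves n d) (m : ℕ) (h : Polygon n d) :
    homMetric w₀ (m + 1) c h h ^ 2 ≤ homMetric w₀ (m + 2) c h h *
      ∑ i, ‖discreteDeriv c h m i‖ ^ 2 * weight w₀ (m + 2) c i := by
  have hpos : ∀ i, 0 ≤ weight w₀ (m + 2) c i := fun i => (weight_pos hw hc i).le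
  have h1 : homMetric w₀ (m + 1) c h h ≤ ∑ i, ‖discreteDeriv c h (m + 2) i‖ *
      ‖discreteDeriv c h m i‖ * weight w₀ (m + 2) c i := by
    rw [homMetric_succ_eq hc, ← Finset.sum_neg_distrib]
    refine Finset.sum_le_sum fun i _ => ?_
    rw [← neg_mul]
    exact mul_le_mul_of_nonneg_right ((neg_le_abs _).trans (abs_real_inner_le_norm _ _)) (hpos i)
  refine (pow_le_pow_left₀ (homMetric_nonneg hw hc _ h) h1 2).trans ?_
  rw [homMetric_self]
  exact Finset.sum_sq_le_sum_mul_sum_of_sq_le_mul _ (fun i _ => mul_nonneg (sq_nonneg _) (hpos i))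
    (fun i _ => mul_nonneg (sq_nonneg _) (hpos i)) fun i _ => le_of_eq (by ring)

/-- The homogeneous forms of positive order are logarithmically convex in the order. -/
theorem homMetric_succ_sq_le (hw : w₀ = vertexLength ∨ w₀ = edgeLength)
    (hc : c ∈ regularCurves n d) (hm : m ≠ 0) (h : Polygon n d) :
    homMetric w₀ (m + 1) c h h ^ 2 ≤ homMetric w₀ m c h h * homMetric w₀ (m + 2) c h h := by
  have h1 := homMetric_succ_le hw hc m h
  have h2 : weight w₀ (m + 2) c = weight w₀ m c := by
    by_cases he : Even m
    · rw [weight_of_even hm he, weight_of_even (by omega) (by simpa [Nat.even_add_one] using he)]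
    · rw [weight_of_odd he, weight_of_odd (by simpa [Nat.even_add_one] using he)]
  rw [h2, ← homMetric_self, mul_comm] at h1
  exact h1

/-- A consequence of logarithmic convexity: the form of order `2` is bounded by that of order `1`
or by that of any higher order. -/
theorem homMetric_two_le_or (hw : w₀ = vertexLength ∨ w₀ = edgeLength)
    (hc : c ∈ regularCurves n d) (hm : 2 ≤ m) (h : Polygon n d) :
    homMetric w₀ 2 c h h ≤ homMetric w₀ 1 c h h ∨ homMetric w₀ 2 c h h ≤ homMetric w₀ m c h h := by
  refine or_iff_not_imp_left.2 fun hlt => ?_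
  rw [not_le] at hlt
  have hstep : ∀ k, homMetric w₀ (k + 1) c h h < homMetric w₀ (k + 2) c h h := by
    intro k
    induction k with
    | zero => exact hlt
    | succ k ih =>
      by_contra! hle
      have h1 := homMetric_succ_sq_le hw hc k.succ_ne_zero h
      have h0 := homMetric_nonneg hw hc (k + 1) h
      have h2 : homMetric w₀ (k + 1) c h h * homMetric w₀ (k + 3) c h h ≤
          homMetric w₀ (k + 1) c h h * homMetric w₀ (k + 2) c h h :=
        mul_le_mul_of_nonneg_left hle h0
      change homMetric w₀ (k + 2) c h h ^ 2 ≤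
        homMetric w₀ (k + 1) c h h * homMetric w₀ (k + 3) c h h at h1
      nlinarith
  induction m, hm using Nat.le_induction with
  | base => exact le_rfl
  | succ k hk ih =>
    obtain ⟨j, rfl⟩ := Nat.exists_eq_add_of_le' hk
    exact ih.trans (hstep (j + 1)).le

end Derivatives

/-! ### Bounds for deformations in terms of the metric -/

section Bounds

variable {n d : ℕ} [NeZero n] {c : Polygon n d} {w₀ : Polygon n d → ZMod n → ℝ} {m : ℕ}

omit [NeZero n] in
theorem norm_sub_eq_edgeLength_mul (hc : c ∈ regularCurves n d) (h : Polygon n d) (i : ZMod n) :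
    ‖h (i + 1) - h i‖ = edgeLength c i * ‖discreteDeriv c h 1 i‖ := by
  have := edgeLength_smul_discreteDeriv hc Even.zero h i
  change _ = h (i + 1) - h i at this
  rw [← this, norm_smul, Real.norm_of_nonneg (edgeLength_pos hc i).le]

theorem norm_sq_mul_edgeLength_le (hw : w₀ = vertexLength ∨ w₀ = edgeLength)
    (hc : c ∈ regularCurves n d) (h : Polygon n d) (i : ZMod n) :
    ‖h i‖ ^ 2 * edgeLength c i ≤ 2 * homMetric w₀ 0 c h h := by
  have h1 : ‖h i‖ ^ 2 * w₀ c i ≤ homMetric w₀ 0 c h h := by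
    rw [homMetric_self]
    exact Finset.single_le_sum (f := fun i => ‖discreteDeriv c h 0 i‖ ^ 2 * weight w₀ 0 c i)
      (fun i _ => mul_nonneg (sq_nonneg _) (weight_pos hw hc i).le) (Finset.mem_univ i)
  have h2 := mul_le_mul_of_nonneg_left (edgeLength_div_two_le hw c i) (sq_nonneg ‖h i‖)
  linarith

/-- At edges shorter than `δ` a deformation varies little, so that its size at any vertex is
controlled by its size at a vertex with an edge of length at least `δ`. -/
theorem exists_edgeLength_ge_norm_le (hc : c ∈ regularCurves n d) {h : Polygon n d} {F δ : ℝ}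
    (hF : ∀ i, ‖discreteDeriv c h 1 i‖ ≤ F) (hδ : n * δ ≤ curveLength c) (hδ0 : 0 ≤ δ)
    (i : ZMod n) : ∃ j, δ ≤ edgeLength c j ∧ ‖h i‖ ≤ ‖h j‖ + n * (δ * F) := by
  have hF0 : 0 ≤ F := (norm_nonneg _).trans (hF 0)
  obtain ⟨j, hj⟩ : ∃ j, δ ≤ edgeLength c j := by
    by_contra! hlt
    have := Finset.sum_lt_sum_of_nonempty (s := (Finset.univ : Finset (ZMod n)))
      ⟨0, Finset.mem_univ 0⟩ fun i _ => hlt i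
    rw [Finset.sum_const, Finset.card_univ, ZMod.card, nsmul_eq_mul] at this
    exact hδ.not_gt this
  have hex : ∃ k : ℕ, δ ≤ edgeLength c (i + k) :=
    ⟨(j - i).val, by rw [ZMod.natCast_zmod_val, add_sub_cancel]; exact hj⟩
  classical
  set k := Nat.find hex with hk
  have hkn : k ≤ n := (Nat.find_min' hex
    (by rw [ZMod.natCast_zmod_val, add_sub_cancel]; exact hj)).trans (ZMod.val_lt (j - i)).le
  refine ⟨i + k, Nat.find_spec hex, ?_⟩
  have hind : ∀ t ≤ k, ‖h i‖ ≤ ‖h (i + t)‖ + t * (δ * F) := by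
    intro t
    induction t with
    | zero => simp
    | succ t ih =>
      intro ht
      have h1 := Nat.find_min hex (Nat.lt_of_succ_le ht)
      rw [not_le] at h1
      have h2 : ‖h (i + t + 1) - h (i + t)‖ ≤ δ * F := by
        rw [norm_sub_eq_edgeLength_mul hc]
        exact mul_le_mul h1.le (hF _) (norm_nonneg _) hδ0
      have h3 := norm_sub_norm_le (h (i + t)) (h (i + t + 1))
      rw [norm_sub_rev] at h3
      have h4 := ih (Nat.le_of_succ_le ht)
      push_cast
      rw [← add_assoc]
      linarith
  refine (hind k le_rfl).trans ?_
  gcongr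

/-- On long curves, deformations are bounded by the metric of order at least two. -/
theorem norm_sq_le_mul_sobolevMetric (hw : w₀ = vertexLength ∨ w₀ = edgeLength)
    (hc : c ∈ regularCurves n d) (hm : 2 ≤ m) (hℓ : 1 ≤ curveLength c) (h : Polygon n d)
    (i : ZMod n) :
    ‖h i‖ ^ 2 ≤ 8 * n * curveLength c * sobolevMetric w₀ m c h h := by
  obtain ⟨i₀, -, hi₀⟩ := Finset.exists_max_image (Finset.univ : Finset (ZMod n))
    (fun i => ‖h i‖) ⟨0, Finset.mem_univ 0⟩
  set ℓ := curveLength c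
  set S := ‖h i₀‖
  set G := fun k => homMetric w₀ k c h h with hG
  have hG0 : ∀ k, 0 ≤ G k := fun k => homMetric_nonneg hw hc k h
  have hℓ0 : 0 < ℓ := one_pos.trans_le hℓ
  have hn : (0 : ℝ) < n := by exact_mod_cast NeZero.pos n
  have hiS : ‖h i‖ ^ 2 ≤ S ^ 2 := pow_le_pow_left₀ (norm_nonneg _) (hi₀ i (Finset.mem_univ i)) 2
  refine hiS.trans ?_
  -- the basic estimate, with a threshold `δ` for the length of an edge that is yet to be chosen
  have hbasic : ∀ δ > 0, n * δ ≤ ℓ → S ^ 2 ≤ 4 * G 0 / δ + n ^ 2 * δ ^ 2 * ℓ * G 2 / 2 := by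
    intro δ hδ hδℓ
    have hF : ∀ i, ‖discreteDeriv c h 1 i‖ ≤ √(ℓ / 4 * G 2) := fun i =>
      Real.le_sqrt_of_sq_le (norm_sq_discreteDeriv_le hw hc one_ne_zero h i)
    obtain ⟨j, hj, hS⟩ := exists_edgeLength_ge_norm_le hc hF hδℓ hδ.le i₀
    have h1 : ‖h j‖ ^ 2 ≤ 2 * G 0 / δ := by
      rw [le_div_iff₀ hδ]
      exact (mul_le_mul_of_nonneg_left hj (sq_nonneg _)).trans (norm_sq_mul_edgeLength_le hw hc h j)
    have h2 : (n * (δ * √(ℓ / 4 * G 2))) ^ 2 = n ^ 2 * δ ^ 2 * ℓ * G 2 / 4 := by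
      rw [mul_pow, mul_pow, Real.sq_sqrt (mul_nonneg (by positivity) (hG0 2))]
      ring
    calc S ^ 2 ≤ (‖h j‖ + n * (δ * √(ℓ / 4 * G 2))) ^ 2 := pow_le_pow_left₀ (norm_nonneg _) hS 2
      _ ≤ 2 * (‖h j‖ ^ 2 + (n * (δ * √(ℓ / 4 * G 2))) ^ 2) := add_sq_le
      _ ≤ 2 * (2 * G 0 / δ + n ^ 2 * δ ^ 2 * ℓ * G 2 / 4) := by rw [h2]; gcongr
      _ = _ := by ring
  have hg : sobolevMetric w₀ m c h h = G 0 + G m := rfl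
  have hnℓ : 0 ≤ n * ℓ := by positivity
  rw [hg]
  rcases homMetric_two_le_or hw hc hm h with h21 | h2m
  · -- if order `1` dominates order `2`, interpolation with order `0` bounds order `2` by `S`
    change G 2 ≤ G 1 at h21
    have h3 : G 1 ^ 2 ≤ G 2 * (S ^ 2 * ℓ) := by
      refine (homMetric_succ_le hw hc 0 h).trans (mul_le_mul_of_nonneg_left ?_ (hG0 2))
      rw [show ℓ = ∑ i, weight w₀ 2 c i from (sum_weight two_ne_zero).symm, Finset.mul_sum]
      refine Finset.sum_le_sum fun j hj => mul_le_mul_of_nonneg_right ?_ (weight_pos hw hc j).le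
      exact pow_le_pow_left₀ (norm_nonneg _) (hi₀ j hj) 2
    have h4 : G 2 ≤ S ^ 2 * ℓ := by
      have h0 : 0 ≤ S ^ 2 * ℓ := by positivity
      by_contra! hlt
      nlinarith [hG0 2, hG0 1, mul_le_mul h21 h21 (hG0 2) (hG0 1)]
    -- with this `δ` the second term is absorbed in the left-hand side
    have h5 := hbasic (1 / (n * ℓ)) (by positivity) (by
      have : n * (1 / (n * ℓ)) = 1 / ℓ := by field_simp
      rw [this]
      exact ((div_le_one hℓ0).2 hℓ).trans hℓ)
    have h6 : n ^ 2 * (1 / (n * ℓ)) ^ 2 * ℓ * G 2 / 2 ≤ S ^ 2 / 2 := by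
      have : n ^ 2 * (1 / (n * ℓ)) ^ 2 * ℓ * G 2 / 2 = G 2 / ℓ / 2 := by field_simp
      rw [this]
      gcongr
      rwa [div_le_iff₀ hℓ0]
    have h7 : 4 * G 0 / (1 / (n * ℓ)) = 4 * (n * ℓ) * G 0 := by field_simp
    rw [h7] at h5
    have h8 := mul_nonneg hnℓ (hG0 m)
    linarith
  · have h5 := hbasic (1 / n) (by positivity) (by
      have : n * (1 / (n : ℝ)) = 1 := by field_simp
      rw [this]; exact hℓ)
    have h6 : (n : ℝ) ^ 2 * (1 / n) ^ 2 * ℓ * G 2 / 2 = ℓ * G 2 / 2 := by field_simp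
    have h7 : 4 * G 0 / (1 / (n : ℝ)) = 4 * n * G 0 := by field_simp
    rw [h6, h7] at h5
    have hn1 : (1 : ℝ) ≤ n := by exact_mod_cast NeZero.one_le
    have h8 : ℓ * G 2 ≤ n * ℓ * G m :=
      mul_le_mul (le_mul_of_one_le_left hℓ0.le hn1) h2m (hG0 2) hnℓ
    have h9 : n * G 0 ≤ n * ℓ * G 0 :=
      mul_le_mul_of_nonneg_right (le_mul_of_one_le_right hn.le hℓ) (hG0 0)
    have h10 := mul_nonneg hnℓ (hG0 m)
    have h11 := mul_nonneg hnℓ (hG0 0)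
    linarith

theorem sobolevMetric_nonneg (hw : w₀ = vertexLength ∨ w₀ = edgeLength)
    (hc : c ∈ regularCurves n d) (h : Polygon n d) : 0 ≤ sobolevMetric w₀ m c h h :=
  add_nonneg (homMetric_nonneg hw hc 0 h) (homMetric_nonneg hw hc m h)

/-- On curves of bounded length, first derivatives are bounded by the metric. -/
theorem norm_discreteDeriv_one_le (hw : w₀ = vertexLength ∨ w₀ = edgeLength)
    (hc : c ∈ regularCurves n d) (hm : 2 ≤ m) {L : ℝ} (hL : curveLength c ≤ L) (h : Polygon n d)
    (i : ZMod n) : ‖discreteDeriv c h 1 i‖ ≤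
      √(L / 4 * (L ^ 2 / 4) ^ (m - 2)) * √(sobolevMetric w₀ m c h h) := by
  have hℓ0 := curveLength_pos hc
  have hL0 : 0 ≤ L := hℓ0.le.trans hL
  rw [← Real.sqrt_mul (by positivity)]
  refine Real.le_sqrt_of_sq_le ((norm_sq_discreteDeriv_le hw hc one_ne_zero h i).trans ?_)
  have h1 := homMetric_le_pow_mul_homMetric hw hc two_ne_zero h (m - 2)
  rw [Nat.add_sub_cancel' hm] at h1
  have h2 : homMetric w₀ m c h h ≤ sobolevMetric w₀ m c h h :=
    le_add_of_nonneg_left (homMetric_nonneg hw hc 0 h)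
  have h3 := homMetric_nonneg hw hc m h
  calc curveLength c / 4 * homMetric w₀ 2 c h h
      ≤ curveLength c / 4 * ((curveLength c ^ 2 / 4) ^ (m - 2) * homMetric w₀ m c h h) := by gcongr
    _ ≤ L / 4 * ((L ^ 2 / 4) ^ (m - 2) * sobolevMetric w₀ m c h h) := by gcongr
    _ = _ := by ring

/-- The total variation of a deformation is bounded by the length of the curve times the norm of
the metric of order at least two. -/
theorem exists_sum_norm_sub_le (hw : w₀ = vertexLength ∨ w₀ = edgeLength) (hm : 2 ≤ m) :
    ∃ C : ℝ, 0 ≤ C ∧ ∀ c ∈ regularCurves n d, ∀ h : Polygon n d,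
      ∑ i, ‖h (i + 1) - h i‖ ≤ C * curveLength c * √(sobolevMetric w₀ m c h h) := by
  refine ⟨1 + n * (2 * √(8 * n)), by positivity, fun c hc h => ?_⟩
  -- on curves of length at most `1`, the constant `1` suffices by Wirtinger's inequality; on longer
  -- ones the total variation is estimated by the sizes of the `n` values of the deformation
  have hℓ0 := curveLength_pos hc
  set ℓ := curveLength c with hℓ
  rcases le_total ℓ 1 with hℓ1 | hℓ1
  · have h1 : ∀ i, ‖h (i + 1) - h i‖ ≤ edgeLength c i * √(sobolevMetric w₀ m c h h) := fun i => by
      rw [norm_sub_eq_edgeLength_mul hc]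
      refine mul_le_mul_of_nonneg_left ?_ (edgeLength_pos hc i).le
      refine (norm_discreteDeriv_one_le hw hc hm hℓ1 h i).trans
        (mul_le_of_le_one_left (Real.sqrt_nonneg _) (Real.sqrt_le_one.2 ?_))
      have : ((1 : ℝ) ^ 2 / 4) ^ (m - 2) ≤ 1 := pow_le_one₀ (by norm_num) (by norm_num)
      linarith
    refine (Finset.sum_le_sum fun i _ => h1 i).trans ?_
    rw [← Finset.sum_mul]
    change ℓ * _ ≤ _
    gcongr
    exact le_mul_of_one_le_left hℓ0.le (by
      have : (0 : ℝ) ≤ n * (2 * √(8 * n)) := by positivity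
      linarith)
  · have hS : ∀ i, ‖h i‖ ≤ √(8 * n) * (ℓ * √(sobolevMetric w₀ m c h h)) := fun i => by
      refine le_of_sq_le_sq ?_ (by positivity)
      refine (norm_sq_le_mul_sobolevMetric hw hc hm hℓ1 h i).trans ?_
      rw [mul_pow, mul_pow, Real.sq_sqrt (by positivity),
        Real.sq_sqrt (sobolevMetric_nonneg hw hc h), mul_assoc (8 * (n : ℝ))]
      have h2 : ℓ ≤ ℓ ^ 2 := by nlinarith
      have := sobolevMetric_nonneg (m := m) hw hc h
      gcongr
    have h1 : ∀ i, ‖h (i + 1) - h i‖ ≤ 2 * (√(8 * n) * (ℓ * √(sobolevMetric w₀ m c h h))) :=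
      fun i => (norm_sub_le _ _).trans (by linarith [hS i, hS (i + 1)])
    refine (Finset.sum_le_sum fun i _ => h1 i).trans ?_
    rw [Finset.sum_const, Finset.card_univ, ZMod.card, nsmul_eq_mul]
    have : 0 ≤ ℓ * √(sobolevMetric w₀ m c h h) := by positivity
    linarith

end Bounds

/-! ### The Sobolev metric is Riemannian -/

section Smooth

variable {n d : ℕ} [NeZero n] {c : Polygon n d} {w₀ : Polygon n d → ZMod n → ℝ} {m : ℕ}

/-- The edge `e_i` as a linear function of the polygon. -/
noncomputable def edgeMap (n d : ℕ) (i : ZMod n) :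
    Polygon n d →L[ℝ] EuclideanSpace ℝ (Fin d) :=
  ContinuousLinearMap.proj (R := ℝ) (φ := fun _ : ZMod n => EuclideanSpace ℝ (Fin d)) (i + 1) -
    ContinuousLinearMap.proj i

theorem contDiffOn_edgeLength (i : ZMod n) :
    ContDiffOn ℝ ∞ (fun c : Polygon n d => edgeLength c i) (regularCurves n d) :=
  (edgeMap n d i).contDiff.contDiffOn.norm ℝ fun _ hc => norm_pos_iff.1 (edgeLength_pos hc i)

theorem contDiffOn_vertexLength (i : ZMod n) :
    ContDiffOn ℝ ∞ (fun c : Polygon n d => vertexLength c i) (regularCurves n d) :=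
  ((contDiffOn_edgeLength i).add (contDiffOn_edgeLength (i - 1))).div_const 2

theorem contDiffOn_weight (hw : w₀ = vertexLength ∨ w₀ = edgeLength) (m : ℕ) (i : ZMod n) :
    ContDiffOn ℝ ∞ (fun c => weight w₀ m c i) (regularCurves n d) := by
  unfold weight
  split_ifs
  · rcases hw with rfl | rfl
    exacts [contDiffOn_vertexLength i, contDiffOn_edgeLength i]
  · exact contDiffOn_vertexLength i
  · exact contDiffOn_edgeLength i

theorem contDiffOn_discreteDeriv (h : Polygon n d) (m : ℕ) (i : ZMod n) :
    ContDiffOn ℝ ∞ (fun c => discreteDeriv c h m i) (regularCurves n d) := by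
  induction m generalizing i with
  | zero => exact contDiffOn_const
  | succ m ih =>
    by_cases hm : Even m
    · simp only [discreteDeriv_succ_of_even hm]
      exact ((contDiffOn_edgeLength i).inv fun c hc => (edgeLength_pos hc i).ne').smul
        ((ih (i + 1)).sub (ih i))
    · simp only [discreteDeriv_succ_of_odd hm]
      exact ((contDiffOn_vertexLength i).inv fun c hc => (vertexLength_pos hc i).ne').smul
        ((ih i).sub (ih (i - 1)))

theorem isOpen_regularCurves : IsOpen (regularCurves n d) := by
  have : regularCurves n d = ⋂ i : ZMod n, {c | c i ≠ c (i + 1)} := by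
    ext c; simp [regularCurves]
  rw [this]
  exact isOpen_iInter_of_finite fun i => isOpen_ne_fun (continuous_apply i) (continuous_apply _)

theorem isRiemannianMetricOn_sobolevMetric (hw : w₀ = vertexLength ∨ w₀ = edgeLength) :
    IsRiemannianMetricOn (regularCurves n d) (sobolevMetric w₀ m) where
  isOpen := isOpen_regularCurves
  add_left c _ h₁ h₂ k := by
    simp only [sobolevMetric, homMetric, discreteDeriv_add, Pi.add_apply, inner_add_left, add_mul,
      Finset.sum_add_distrib]
    ring
  smul_left c _ a h k := by
    simp only [sobolevMetric, homMetric, discreteDeriv_smul, Pi.smul_apply, real_inner_smul_left,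
      mul_assoc, ← Finset.mul_sum]
    ring
  symm c _ h k := by
    simp only [sobolevMetric, homMetric, real_inner_comm]
  pos c hc h hh := by
    obtain ⟨i, hi⟩ := Function.ne_iff.1 hh
    refine add_pos_of_pos_of_nonneg ?_ (homMetric_nonneg hw hc m h)
    have h1 := norm_sq_mul_edgeLength_le hw hc h i
    have h2 : 0 < ‖h i‖ ^ 2 * edgeLength c i :=
      mul_pos (pow_pos (norm_pos_iff.2 hi) 2) (edgeLength_pos hc i)
    linarith
  smooth h k := by
    have : ∀ m, ContDiffOn ℝ ∞ (fun c => homMetric w₀ m c h k) (regularCurves n d) := fun m =>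
      ContDiffOn.sum fun i _ => ((contDiffOn_discreteDeriv h m i).inner ℝ
        (contDiffOn_discreteDeriv k m i)).mul (contDiffOn_weight hw m i)
    exact (this 0).add (this m)

theorem abs_fderiv_edgeLength_le (hc : c ∈ regularCurves n d) (h : Polygon n d) (i : ZMod n) :
    |fderiv ℝ (fun c => edgeLength c i) c h| ≤ ‖h (i + 1) - h i‖ := by
  have hd : DifferentiableAt ℝ (fun v : EuclideanSpace ℝ (Fin d) => ‖v‖) (edgeMap n d i c) :=
    (contDiffAt_norm (n := 1) ℝ (norm_pos_iff.1 (edgeLength_pos hc i))).differentiableAt one_ne_zero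
  have hf : HasFDerivAt (fun c => edgeLength c i) _ c :=
    hd.hasFDerivAt.comp c (edgeMap n d i).hasFDerivAt
  rw [hf.fderiv]
  refine ((fderiv ℝ (fun v : EuclideanSpace ℝ (Fin d) => ‖v‖) (edgeMap n d i c)).le_opNorm
    (edgeMap n d i h)).trans (mul_le_of_le_one_left (norm_nonneg _) ?_)
  exact norm_fderiv_le_of_lipschitz ℝ (lipschitzWith_one_norm (E := EuclideanSpace ℝ (Fin d)))

end Smooth

/-! ### Bounds on geodesic balls -/

section Balls

variable {n d : ℕ} [NeZero n] {p : Polygon n d} {w₀ : Polygon n d → ZMod n → ℝ} {m : ℕ}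

/-- The logarithm of the length is Lipschitz: its derivative is at most the total variation of the
deformation divided by the length. -/
theorem exists_abs_log_curveLength_sub_le (hw : w₀ = vertexLength ∨ w₀ = edgeLength)
    (hm : 2 ≤ m) (r : ℝ) : ∃ B : ℝ, ∀ p : Polygon n d,
      ∀ c ∈ geodesicBall (regularCurves n d) (sobolevMetric w₀ m) p r,
        |Real.log (curveLength c) - Real.log (curveLength p)| ≤ B := by
  obtain ⟨C, hC, hle⟩ := exists_sum_norm_sub_le (n := n) (d := d) hw hm
  refine ⟨C * max r 0, fun p c hcb => ?_⟩
  obtain ⟨γ, rfl, rfl, hU, hs, hlt⟩ := exists_path_of_geodesicDist_lt hcb.2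
  have hsm : ContDiffOn ℝ ∞ (fun c : Polygon n d => curveLength c) (regularCurves n d) :=
    ContDiffOn.sum fun i _ => contDiffOn_edgeLength i
  have hopen : IsOpen (regularCurves n d) := isOpen_regularCurves
  refine norm_sub_le_arcLength (f := fun c => Real.log (curveLength c)) hC hopen
    ((hsm.of_le (by norm_cast)).log fun c hc => (curveLength_pos hc).ne') hs hU
    (fun t ht v => ?_) (le_max_right r 0)
    (hlt.le.trans (ENNReal.ofReal_le_ofReal (le_max_left r 0)))
  have hc := hU t ht
  have hd : ∀ i, DifferentiableAt ℝ (fun c : Polygon n d => edgeLength c i) (γ t) := fun i =>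
    ((contDiffOn_edgeLength i).contDiffAt (hopen.mem_nhds hc)).differentiableAt (by simp)
  have hdl : HasFDerivAt (fun c : Polygon n d => curveLength c)
      (∑ i, fderiv ℝ (fun c : Polygon n d => edgeLength c i) (γ t)) (γ t) :=
    HasFDerivAt.fun_sum fun i _ => (hd i).hasFDerivAt
  have hℓ := curveLength_pos hc
  rw [(hdl.log hℓ.ne').fderiv, smul_apply, norm_smul, norm_inv, Real.norm_of_nonneg hℓ.le,
    inv_mul_le_iff₀ hℓ, sum_apply]
  refine (norm_sum_le _ _).trans ((Finset.sum_le_sum fun i _ =>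
    abs_fderiv_edgeLength_le hc v i).trans ((hle _ hc v).trans (le_of_eq ?_)))
  ring

/-- The length and its inverse are bounded on geodesic balls. -/
theorem exists_curveLength_le (hw : w₀ = vertexLength ∨ w₀ = edgeLength) (hm : 2 ≤ m)
    (p : Polygon n d) (r : ℝ) :
    ∃ C : ℝ, ∀ c ∈ geodesicBall (regularCurves n d) (sobolevMetric w₀ m) p r,
      curveLength c ≤ C ∧ 1 / curveLength c ≤ C := by
  obtain ⟨B, hB⟩ := exists_abs_log_curveLength_sub_le (n := n) (d := d) hw hm r
  refine ⟨Real.exp (B + |Real.log (curveLength p)|), fun c hc => ?_⟩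
  have h1 := abs_le.1 (hB p c hc)
  have h2 := abs_le.1 (le_refl |Real.log (curveLength p)|)
  have hℓ := curveLength_pos hc.1
  constructor
  · rw [← Real.log_le_iff_le_exp hℓ]
    linarith
  · rw [← Real.log_le_iff_le_exp (by positivity), one_div, Real.log_inv]
    linarith

/-- On a ball, where the length is bounded, the logarithms of the edge lengths are Lipschitz: their
derivatives are at most the first derivatives of the deformation. -/
theorem exists_abs_log_edgeLength_sub_le (hw : w₀ = vertexLength ∨ w₀ = edgeLength)
    (hm : 2 ≤ m) (p : Polygon n d) (r : ℝ) : ∃ B : ℝ,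
      ∀ c ∈ geodesicBall (regularCurves n d) (sobolevMetric w₀ m) p r, ∀ i,
        |Real.log (edgeLength c i) - Real.log (edgeLength p i)| ≤ B := by
  obtain ⟨L, hL⟩ := exists_curveLength_le (n := n) (d := d) hw hm p r
  refine ⟨√(L / 4 * (L ^ 2 / 4) ^ (m - 2)) * max r 0, fun c hcb i => ?_⟩
  obtain ⟨γ, rfl, rfl, hU, hs, hlt⟩ := exists_path_of_geodesicDist_lt hcb.2
  have hopen : IsOpen (regularCurves n d) := isOpen_regularCurves
  have hg := isRiemannianMetricOn_sobolevMetric (n := n) (d := d) (m := m) hw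
  have hball := geodesicBall_subset_of_path (p := γ 0) (R := r) hg hs hU
    (by rwa [geodesicDist_self hg (hU 0 ⟨le_rfl, zero_le_one⟩), zero_add])
  refine norm_sub_le_arcLength (f := fun c => Real.log (edgeLength c i)) (Real.sqrt_nonneg _) hopen
    (((contDiffOn_edgeLength i).of_le (by norm_cast)).log fun c hc => (edgeLength_pos hc i).ne')
    hs hU (fun t ht v => ?_) (le_max_right r 0)
    (hlt.le.trans (ENNReal.ofReal_le_ofReal (le_max_left r 0)))
  have hc := hU t ht
  have hd : DifferentiableAt ℝ (fun c : Polygon n d => edgeLength c i) (γ t) :=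
    ((contDiffOn_edgeLength i).contDiffAt (hopen.mem_nhds hc)).differentiableAt (by simp)
  have he := edgeLength_pos hc i
  rw [(hd.hasFDerivAt.log he.ne').fderiv, smul_apply, norm_smul, norm_inv,
    Real.norm_of_nonneg he.le, inv_mul_le_iff₀ he]
  refine (abs_fderiv_edgeLength_le hc v i).trans ?_
  rw [norm_sub_eq_edgeLength_mul hc]
  exact mul_le_mul_of_nonneg_left (norm_discreteDeriv_one_le hw hc hm (hL _ (hball t ht)).1 v i)
    he.le

/-- On a ball the edges are bounded below, so that the ball stays away from the boundary of the set
of regular curves, and the metric dominates the sup norm, so that the ball is bounded. -/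
theorem hasRelativelyCompactBalls_sobolevMetric (hw : w₀ = vertexLength ∨ w₀ = edgeLength)
    (hm : 2 ≤ m) : HasRelativelyCompactBalls (regularCurves n d) (sobolevMetric w₀ m) := by
  intro p hp r
  obtain ⟨B, hB⟩ := exists_abs_log_edgeLength_sub_le (n := n) (d := d) hw hm p r
  have hopen : IsOpen (regularCurves n d) := isOpen_regularCurves
  have hg := isRiemannianMetricOn_sobolevMetric (n := n) (d := d) (m := m) hw
  -- a common lower bound for the edges of all curves in the ball
  obtain ⟨i₀, -, hi₀⟩ := Finset.exists_min_image (Finset.univ : Finset (ZMod n))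
    (fun i => edgeLength p i) ⟨0, Finset.mem_univ 0⟩
  set ε := edgeLength p i₀ * Real.exp (-B) with hε
  have hε0 : 0 < ε := mul_pos (edgeLength_pos hp i₀) (Real.exp_pos _)
  have hedge : ∀ c ∈ geodesicBall (regularCurves n d) (sobolevMetric w₀ m) p r, ∀ i,
      ε ≤ edgeLength c i := by
    intro c hc i
    have h1 := (abs_le.1 (hB c hc i)).1
    rw [← Real.log_le_log_iff hε0 (edgeLength_pos hc.1 i), hε,
      Real.log_mul (edgeLength_pos hp i₀).ne' (Real.exp_ne_zero _), Real.log_exp]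
    have h2 := Real.log_le_log (edgeLength_pos hp i₀) (hi₀ i (Finset.mem_univ i))
    linarith
  set ρ := √(2 / ε) * max r 0 with hρ
  refine ⟨Metric.closedBall p ρ ∩ {c | ∀ i, ε ≤ edgeLength c i}, fun c hc i heq => ?_, ?_,
    fun c hcb => ⟨?_, hedge c hcb⟩⟩
  · have := hc.2 i
    rw [edgeLength, ← heq, sub_self, norm_zero] at this
    linarith
  · refine (isCompact_closedBall p ρ).inter_right ?_
    simp only [ofPred_forall]
    exact isClosed_iInter fun i => isClosed_le continuous_const (edgeMap n d i).continuous.norm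
  · rw [mem_closedBall_iff_norm]
    obtain ⟨γ, rfl, rfl, hU, hs, hlt⟩ := exists_path_of_geodesicDist_lt hcb.2
    have hball := geodesicBall_subset_of_path (p := γ 0) (R := r) hg hs hU
      (by rwa [geodesicDist_self hg hp, zero_add])
    refine norm_sub_le_arcLength (f := fun c : Polygon n d => c) (Real.sqrt_nonneg _) hopen
      contDiffOn_id hs hU (fun t ht v => ?_) (le_max_right r 0)
      (hlt.le.trans (ENNReal.ofReal_le_ofReal (le_max_left r 0)))
    have hc := hU t ht
    rw [fderiv_fun_id, ContinuousLinearMap.id_apply, pi_norm_le_iff_of_nonneg (by positivity)]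
    intro i
    rw [← Real.sqrt_mul (by positivity)]
    refine Real.le_sqrt_of_sq_le ?_
    have h1 := norm_sq_mul_edgeLength_le hw hc v i
    have h2 : homMetric w₀ 0 (γ t) v v ≤ sobolevMetric w₀ m (γ t) v v :=
      le_add_of_nonneg_right (homMetric_nonneg hw hc m v)
    have h3 := mul_le_mul_of_nonneg_left (hedge _ (hball t ht) i) (sq_nonneg ‖v i‖)
    rw [div_mul_eq_mul_div, le_div_iff₀ hε0]
    linarith

end Balls

/-! ### Connectedness -/

section Connected

variable {n d : ℕ} [NeZero n] {w₀ : Polygon n d → ZMod n → ℝ} {m : ℕ}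

/-- The polygons whose edge `e_i` is parallel to that of `p`. -/
noncomputable def parallelEdge (p : Polygon n d) (i : ZMod n) : Submodule ℝ (Polygon n d) :=
  (Submodule.span ℝ {edgeMap n d i p}).comap (edgeMap n d i).toLinearMap

omit [NeZero n] in
theorem parallelEdge_ne_top (hn : n ≠ 1) (hd : 2 ≤ d) (p : Polygon n d) (i : ZMod n) :
    parallelEdge p i ≠ ⊤ := by
  intro htop
  have hspan : Submodule.span ℝ {edgeMap n d i p} = ⊤ := by
    refine Submodule.eq_top_iff'.2 fun v => ?_
    have h1 : Pi.single (i + 1) v ∈ parallelEdge p i := htop ▸ Submodule.mem_top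
    have hne : i ≠ i + 1 := by
      intro h
      have h10 : (1 : ZMod n) = 0 := by simpa using h.symm
      rw [ZMod.one_eq_zero_iff] at h10
      exact hn h10
    have h2 : edgeMap n d i (Pi.single (i + 1) v) = v := by
      simp [edgeMap, Pi.single_eq_of_ne hne]
    have h3 : edgeMap n d i (Pi.single (i + 1) v) ∈ Submodule.span ℝ {edgeMap n d i p} := h1
    rwa [h2] at h3
  have h1 := finrank_span_le_card (R := ℝ) ({edgeMap n d i p} : Set (EuclideanSpace ℝ (Fin d)))
  rw [hspan, finrank_top, finrank_euclideanSpace_fin] at h1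
  simp at h1
  omega

/-- The segment from `p` to `z` consists of regular curves, since an edge can vanish along it only
if the corresponding edges of `p` and `z` are parallel. -/
theorem geodesicDist_ne_top_of_notMem_parallelEdge (hw : w₀ = vertexLength ∨ w₀ = edgeLength)
    {p z : Polygon n d} (hz : ∀ i, z ∉ parallelEdge p i) (hp : p ∈ regularCurves n d) :
    geodesicDist (regularCurves n d) (sobolevMetric w₀ m) p z ≠ ⊤ := by
  have hg := isRiemannianMetricOn_sobolevMetric (n := n) (d := d) (m := m) hw
  have hseg : ∀ t ∈ Icc (0 : ℝ) 1, p + t • (z - p) ∈ regularCurves n d := by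
    intro t ht i heq
    have h0 : edgeMap n d i (p + t • (z - p)) = 0 := sub_eq_zero.2 heq.symm
    rw [map_add, map_smul, map_sub] at h0
    rcases ht.1.eq_or_lt with rfl | ht0
    · rw [zero_smul, add_zero] at h0
      exact hp i (sub_eq_zero.1 h0).symm
    · refine hz i (Submodule.mem_span_singleton.2 ⟨1 - t⁻¹, ?_⟩)
      have h1 : t • edgeMap n d i z = (t - 1) • edgeMap n d i p := by
        rw [← sub_eq_zero, ← h0]; module
      have h2 : edgeMap n d i z = t⁻¹ • (t - 1) • edgeMap n d i p := by
        rw [← h1, inv_smul_smul₀ ht0.ne']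
      change (1 - t⁻¹) • edgeMap n d i p = edgeMap n d i z
      rw [h2, smul_smul, mul_sub, inv_mul_cancel₀ ht0.ne', mul_one]
  have hcpt : IsCompact ((fun t : ℝ => p + t • (z - p)) '' Icc 0 1) :=
    isCompact_Icc.image (by fun_prop)
  obtain ⟨A, hA, hle⟩ := exists_sqrt_le_mul_norm hg hcpt (by
    rintro _ ⟨t, ht, rfl⟩; exact hseg t ht)
  have := geodesicDist_add_le (x := p) (v := z - p) (B := A * ‖z - p‖) hg hseg fun t ht =>
    hle _ (mem_image_of_mem _ ht) _
  rw [add_sub_cancel] at this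
  exact ne_top_of_le_ne_top ENNReal.ofReal_ne_top this

/-- In dimension at least two any two regular curves are joined by a broken line of regular curves:
its corner is any curve none of whose edges is parallel to that of one of the end points. -/
theorem geodesicDist_sobolevMetric_ne_top (hw : w₀ = vertexLength ∨ w₀ = edgeLength) (hn : n ≠ 1)
    (hd : 2 ≤ d) {p q : Polygon n d} (hp : p ∈ regularCurves n d) (hq : q ∈ regularCurves n d) :
    geodesicDist (regularCurves n d) (sobolevMetric w₀ m) p q ≠ ⊤ := by
  classical
  have hg := isRiemannianMetricOn_sobolevMetric (n := n) (d := d) (m := m) hw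
  set s : Finset (Submodule ℝ (Polygon n d)) :=
    Finset.univ.image (parallelEdge p) ∪ Finset.univ.image (parallelEdge q) with hs
  have htop : ⊤ ∉ s := by
    simp only [hs, Finset.mem_union, Finset.mem_image, Finset.mem_univ, true_and, not_or,
      not_exists]
    exact ⟨parallelEdge_ne_top hn hd p, parallelEdge_ne_top hn hd q⟩
  obtain ⟨z, hz⟩ := (ne_univ_iff_exists_notMem _).1 (Subspace.biUnion_ne_univ_of_top_notMem htop)
  simp only [hs, mem_iUnion, Finset.mem_union, Finset.mem_image, Finset.mem_univ, true_and,
    SetLike.mem_coe, exists_prop, not_exists, not_and] at hz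
  have h1 := geodesicDist_ne_top_of_notMem_parallelEdge (m := m) hw
    (fun i => hz _ (.inl ⟨i, rfl⟩)) hp
  have h2 := geodesicDist_ne_top_of_notMem_parallelEdge (m := m) hw
    (fun i => hz _ (.inr ⟨i, rfl⟩)) hq
  rw [geodesicDist_comm hg] at h2
  exact ne_top_of_le_ne_top (ENNReal.add_ne_top.2 ⟨h1, h2⟩) (geodesicDist_triangle hg)

end Connected

end DiscreteSobolev

theorem mainTheorem6 (n d m : ℕ) [NeZero n]
    (w₀ : DiscreteSobolev.Polygon n d → ZMod n → ℝ)
    (hw : w₀ = DiscreteSobolev.vertexLength ∨ w₀ = DiscreteSobolev.edgeLength) :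
    (1 ≤ m → ∀ c ∈ DiscreteSobolev.regularCurves n d, ∀ h : DiscreteSobolev.Polygon n d,
      DiscreteSobolev.homMetric w₀ m c h h ≤
        DiscreteSobolev.curveLength c ^ 2 / 4 * DiscreteSobolev.homMetric w₀ (m + 1) c h h) ∧
    (3 ≤ n →
      DiscreteSobolev.IsRiemannianMetricOn (DiscreteSobolev.regularCurves n d)
        (DiscreteSobolev.sobolevMetric w₀ m)) ∧
    (3 ≤ n → 2 ≤ m → ∀ p ∈ DiscreteSobolev.regularCurves n d, ∀ r : ℝ, ∃ C : ℝ,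
      ∀ c ∈ DiscreteSobolev.geodesicBall (DiscreteSobolev.regularCurves n d)
          (DiscreteSobolev.sobolevMetric w₀ m) p r,
        DiscreteSobolev.curveLength c ≤ C ∧ 1 / DiscreteSobolev.curveLength c ≤ C) ∧
    (3 ≤ n → 2 ≤ d → 2 ≤ m →
      DiscreteSobolev.IsMetricallyComplete (DiscreteSobolev.regularCurves n d)
        (DiscreteSobolev.sobolevMetric w₀ m) ∧
      DiscreteSobolev.IsGeodesicallyComplete (DiscreteSobolev.regularCurves n d)
        (DiscreteSobolev.sobolevMetric w₀ m) ∧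
      DiscreteSobolev.IsGeodesicallyConvex (DiscreteSobolev.regularCurves n d)
        (DiscreteSobolev.sobolevMetric w₀ m)) := by
  refine ⟨fun hm c hc h => DiscreteSobolev.homMetric_le_mul_homMetric_succ hw hc (by omega) h,
    fun _ => DiscreteSobolev.isRiemannianMetricOn_sobolevMetric hw,
    fun _ hm p _ r => DiscreteSobolev.exists_curveLength_le hw hm p r, fun hn hd hm => ?_⟩
  have hg := DiscreteSobolev.isRiemannianMetricOn_sobolevMetric (n := n) (d := d) (m := m) hw
  have hH := DiscreteSobolev.hasRelativelyCompactBalls_sobolevMetric (n := n) (d := d) hw hm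
  have hfin : ∀ p ∈ DiscreteSobolev.regularCurves n d, ∀ q ∈ DiscreteSobolev.regularCurves n d,
      DiscreteSobolev.geodesicDist (DiscreteSobolev.regularCurves n d)
        (DiscreteSobolev.sobolevMetric w₀ m) p q ≠ ⊤ := fun p hp q hq =>
    DiscreteSobolev.geodesicDist_sobolevMetric_ne_top hw (by omega) hd hp hq
  exact ⟨DiscreteSobolev.isMetricallyComplete_of_compact_balls hg hH hfin,
    DiscreteSobolev.isGeodesicallyComplete_of_compact_balls hg hH,
    DiscreteSobolev.isGeodesicallyConvex_of_compact_balls hg hH hfin⟩
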